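/- Let $\sigma$ be a nonempty set and let $\rho$ be a set of pairs $(u,v)$ of words over $\sigma$ such that $u$ and $v$ have the same length. Suppose that the presented monoid $M=\mathrm{Mon}\langle\sigma\mid\rho\rangle$ is an Ore monoid: it is left-cancellative, and for all $x,y\in M$ there are $p,q\in M$ with $xp=yq$. Let $\mathrm{Frac}(M)$ be its fraction group, i.e. the group of classes $[x,y]$ of pairs in $M\times M$ for the equivalence relation generated by $(x,y)\sim(xz,yz)$, with $[x,y][x',y']=[xz,y'z']$ whenever $yz=x'z'$. Let $\mathcal F$ be the forest-skein category of $(\sigma,\rho)$: its objects are natural numbers, its morphisms $n\to m$ are lists of $n$ finite rooted binary trees with $m$ leaves in total and with interior vertices coloured by $\sigma$, composed by vertical stacking, modulo the smallest equivalence relation that is closed under vertical and horizontal stacking and identifies, for each $(u,v)\in\rho$, the left-vines (trees all of whose interior vertices lie on the path from the root to the first leaf) coloured by $u$ and by $v$, read from the root. Let $\mathcal F^{BV}$ be its braided version: the morphisms $n\to m$ are the diagrams $f\circ\beta$, where $f\in\mathcal F(n,m)$ and $\beta$ is a braid on $m$ strands stacked on top of $f$; a forest stacked on top of a braid is pulled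 down through it, each strand being replaced by as many parallel strands as the tree that it carries has leaves. Then $\mathcal F$ and $\mathcal F^{BV}$ are Ore categories (left-cancellative, and any two morphisms with the same source have a common right-multiple). Let $G$ and $G^{BV}$ be their fraction groups at the object $1$, i.e. the groups of classes $[t,s]$ of pairs of morphisms $t,s\colon 1\to m$ ($m\geq 1$) for the equivalence relation generated by $(t,s)\sim(t\circ p,s\circ p)$, with $[t,s][t',s']=[t\circ p,s'\circ q]$ whenever $s\circ p=t'\circ q$. Then: 1. $G$ is left-orderable if and only if $\mathrm{Frac}(M)$ is left-orderable; 2. $G$ is bi-orderable if and only if $\mathrm{Frac}(M)$ is bi-orderable; 3. $G^{BV}$ is left-orderable if and only if $\mathrm{Frac}(M)$ is left-orderable. Here a group is left-orderable if it has a left-invariant total order, and bi-orderable if it has a total order that is both left- and right-invariant. -/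

import Mathlib

namespace ForestSkein

open CategoryTheory

universe u v w

/-! ## Orderable groups -/

/-- A group is left-orderable if it carries a left-invariant total order. -/
def LeftOrderable (G : Type u) [Group G] : Prop :=
  ∃ _ : LinearOrder G, ∀ g h k : G, h ≤ k → g * h ≤ g * k

/-- A group is bi-orderable if it carries a total order that is left- and right-invariant. -/
def BiOrderable (G : Type u) [Group G] : Prop :=
  ∃ _ : LinearOrder G, ∀ g h k : G, h ≤ k → g * h ≤ g * k ∧ h * g ≤ k * g

/-! ## Calculus of fractions -/

/-- A small category admits a (right) calculus of fractions if it is left-cancellative and any two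
morphisms with the same source have a common right-multiple. -/
class IsOreCategory (C : Type u) [Category.{v} C] : Prop where
  left_cancel : ∀ {x y z : C} (f : x ⟶ y) (g g' : y ⟶ z), f ≫ g = f ≫ g' → g = g'
  ore : ∀ {x y z : C} (f : x ⟶ y) (g : x ⟶ z),
    ∃ (t : C) (p : y ⟶ t) (q : z ⟶ t), f ≫ p = g ≫ q

/-- Pairs `(f, g)` of morphisms out of `x` with the same target, to be read as `f ∘ g⁻¹`. -/
structure FracPair (C : Type u) [Category.{v} C] (x : C) where
  apex : C
  num : x ⟶ apex
  den : x ⟶ apex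

/-- The elementary moves `(f, g) ~ (f ∘ p, g ∘ p)`. -/
inductive FracStep {C : Type u} [Category.{v} C] {x : C} :
    FracPair C x → FracPair C x → Prop
  | mk {y z : C} (f g : x ⟶ y) (p : y ⟶ z) : FracStep ⟨y, f, g⟩ ⟨z, f ≫ p, g ≫ p⟩

/-- The fraction group of `C` at `x`: classes `[f, g]` for the equivalence relation
generated by the elementary moves. -/
def FracGroup (C : Type u) [Category.{v} C] (x : C) : Type (max u v) :=
  Quot (FracStep (C := C) (x := x))

namespace FracGroup

variable {C : Type u} [Category.{v} C] {x : C}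

/-- The class `[f, g]`. -/
def mk {y : C} (f g : x ⟶ y) : FracGroup C x := Quot.mk _ ⟨y, f, g⟩

theorem mk_comp {y z : C} (f g : x ⟶ y) (p : y ⟶ z) : mk (f ≫ p) (g ≫ p) = mk f g :=
  (Quot.sound (FracStep.mk f g p)).symm

theorem mk_eq_of_common [IsOreCategory C] {y y' z z' : C} {d : x ⟶ y} {n : x ⟶ y'}
    {a : x ⟶ y} {b : x ⟶ y'} {p : y ⟶ z} {q : y' ⟶ z} {p' : y ⟶ z'} {q' : y' ⟶ z'}
    (h : d ≫ p = n ≫ q) (h' : d ≫ p' = n ≫ q') :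
    mk (a ≫ p) (b ≫ q) = mk (a ≫ p') (b ≫ q') := by
  obtain ⟨t, r, r', hr⟩ := IsOreCategory.ore (d ≫ p) (d ≫ p')
  have h1 : p ≫ r = p' ≫ r' := by
    apply IsOreCategory.left_cancel d
    simpa using hr
  have h2 : q ≫ r = q' ≫ r' := by
    apply IsOreCategory.left_cancel n
    rw [h, h'] at hr
    simpa using hr
  rw [← mk_comp (a ≫ p) (b ≫ q) r, ← mk_comp (a ≫ p') (b ≫ q') r']
  simp only [Category.assoc, h1, h2]

/-- `[f, g] [f', g'] = [f ∘ p, g' ∘ q]` for a chosen pair with `g ∘ p = f' ∘ q`. -/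
noncomputable def mulPair [IsOreCategory C] (a b : FracPair C x) : FracGroup C x :=
  mk (a.num ≫ (IsOreCategory.ore a.den b.num).choose_spec.choose)
    (b.den ≫ (IsOreCategory.ore a.den b.num).choose_spec.choose_spec.choose)

theorem mulPair_eq [IsOreCategory C] (a b : FracPair C x) {z : C} (p : a.apex ⟶ z)
    (q : b.apex ⟶ z) (h : a.den ≫ p = b.num ≫ q) :
    mulPair a b = mk (a.num ≫ p) (b.den ≫ q) :=
  mk_eq_of_common (IsOreCategory.ore a.den b.num).choose_spec.choose_spec.choose_spec h

noncomputable instance [IsOreCategory C] : Mul (FracGroup C x) where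
  mul := Quot.lift₂ mulPair
    (by
      rintro a _ _ ⟨f, g, r⟩
      obtain ⟨z, p, q, h⟩ := IsOreCategory.ore a.den (f ≫ r)
      rw [mulPair_eq a ⟨_, f ≫ r, g ≫ r⟩ p q h,
        mulPair_eq a ⟨_, f, g⟩ p (r ≫ q) (by simpa using h)]
      simp)
    (by
      rintro _ _ b ⟨f, g, r⟩
      obtain ⟨z, p, q, h⟩ := IsOreCategory.ore (g ≫ r) b.num
      rw [mulPair_eq ⟨_, f ≫ r, g ≫ r⟩ b p q h,
        mulPair_eq ⟨_, f, g⟩ b (r ≫ p) q (by simpa using h)]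
      simp)

/-- The multiplication rule: `[f, g] [f', g'] = [f ∘ p, g' ∘ q]` whenever `g ∘ p = f' ∘ q`. -/
theorem mk_mul_mk [IsOreCategory C] {y y' z : C} (f g : x ⟶ y) (f' g' : x ⟶ y') (p : y ⟶ z)
    (q : y' ⟶ z) (h : g ≫ p = f' ≫ q) : mk f g * mk f' g' = mk (f ≫ p) (g' ≫ q) :=
  mulPair_eq ⟨y, f, g⟩ ⟨y', f', g'⟩ p q h

instance : One (FracGroup C x) := ⟨mk (𝟙 x) (𝟙 x)⟩

instance : Inv (FracGroup C x) where
  inv := Quot.lift (fun a => mk a.den a.num) (by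
    rintro _ _ ⟨f, g, r⟩
    exact (mk_comp g f r).symm)

theorem inv_mk {y : C} (f g : x ⟶ y) : (mk f g)⁻¹ = mk g f := rfl

theorem one_def : (1 : FracGroup C x) = mk (𝟙 x) (𝟙 x) := rfl

noncomputable instance [IsOreCategory C] : Group (FracGroup C x) :=
  Group.ofLeftAxioms
    (by
      rintro ⟨ya, a, a'⟩ ⟨yb, b, b'⟩ ⟨yc, c, c'⟩
      change mk a a' * mk b b' * mk c c' = mk a a' * (mk b b' * mk c c')
      obtain ⟨z, p, q, h⟩ := IsOreCategory.ore a' b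
      obtain ⟨z', s, t, h'⟩ := IsOreCategory.ore (b' ≫ q) c
      rw [mk_mul_mk a a' b b' p q h, mk_mul_mk _ _ c c' s t h',
        mk_mul_mk b b' c c' (q ≫ s) t (by simpa using h'),
        mk_mul_mk a a' _ _ (p ≫ s) (𝟙 _) (by simp [reassoc_of% h])]
      simp)
    (by
      rintro ⟨y, f, g⟩
      change mk (𝟙 x) (𝟙 x) * mk f g = mk f g
      rw [mk_mul_mk _ _ f g f (𝟙 _) (by simp), Category.id_comp, Category.comp_id])
    (by
      rintro ⟨y, f, g⟩
      change mk g f * mk f g = mk (𝟙 x) (𝟙 x)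
      rw [mk_mul_mk g f f g (𝟙 _) (𝟙 _) rfl, Category.comp_id, ← mk_comp (𝟙 x) (𝟙 x) g,
        Category.id_comp])

end FracGroup

/-! ## Ore monoids and their fraction groups -/

/-- Ore monoids: left-cancellative monoids with common right-multiples. -/
class IsOreMonoid (M : Type u) [Monoid M] : Prop where
  left_cancel : ∀ x y y' : M, x * y = x * y' → y = y'
  ore : ∀ x y : M, ∃ p q : M, x * p = y * q

/-- The one-object category with endomorphism monoid `M`, where `f ≫ g = f * g`. -/
inductive OneObj (M : Type u) : Type
  | star

instance (M : Type u) [Monoid M] : Category.{u} (OneObj M) where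
  Hom _ _ := M
  id _ := (1 : M)
  comp f g := (f * g : M)
  id_comp f := one_mul (M := M) f
  comp_id f := mul_one (M := M) f
  assoc f g h := mul_assoc (G := M) f g h

instance (M : Type u) [Monoid M] [IsOreMonoid M] : IsOreCategory (OneObj M) where
  left_cancel f g g' h := IsOreMonoid.left_cancel (M := M) f g g' h
  ore f g := by
    obtain ⟨p, q, h⟩ := IsOreMonoid.ore (M := M) f g
    exact ⟨OneObj.star, p, q, h⟩

/-- The fraction group `Frac(M)`: classes `[x, y]` of pairs of elements of `M` for the relation
generated by `(x, y) ~ (x z, y z)`, with `[x, y] [x', y'] = [x z, y' z']` when `y z = x' z'`. -/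
abbrev Frac (M : Type u) [Monoid M] : Type u := FracGroup (OneObj M) OneObj.star

/-- A set of monoid relations is homogeneous if it relates words of the same length only. -/
def IsHomogeneous {σ : Type u} (ρ : FreeMonoid σ → FreeMonoid σ → Prop) : Prop :=
  ∀ p q : FreeMonoid σ, ρ p q → p.length = q.length

/-! ## Coloured trees and forests

A coloured tree over `S` is a term of `BinaryTree S`: `nil` is the trivial tree and
`node c l r` has a `c`-coloured root vertex with subtrees `l` (left) and `r` (right). -/

section Sequences

variable {S : Type u}

/-- `graft t g` puts the tree `g i` on the `i`-th leaf of `t`, for `i < t.numLeaves`. -/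
def graft : BinaryTree S → (ℕ → BinaryTree S) → BinaryTree S
  | .nil, g => g 0
  | .node c l r, g => .node c (graft l g) (graft r fun i => g (l.numLeaves + i))

/-- The total number of leaves of the `c` trees `f a, …, f (a + c - 1)`. -/
def blockLeaves (f : ℕ → BinaryTree S) (a c : ℕ) : ℕ :=
  ∑ i ∈ Finset.range c, (f (a + i)).numLeaves

/-- The number of leaves of a sequence of trees lying strictly to the left of its `i`-th tree. -/
def offset (f : ℕ → BinaryTree S) (i : ℕ) : ℕ := ∑ k ∈ Finset.range i, (f k).numLeaves

/-- Vertical stacking of `g` on top of `f`. -/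
def stack (f g : ℕ → BinaryTree S) (i : ℕ) : BinaryTree S :=
  graft (f i) fun k => g (offset f i + k)

theorem offset_zero (f : ℕ → BinaryTree S) : offset f 0 = 0 := rfl

theorem offset_succ (f : ℕ → BinaryTree S) (i : ℕ) :
    offset f (i + 1) = offset f i + (f i).numLeaves := Finset.sum_range_succ _ _

theorem blockLeaves_zero (f : ℕ → BinaryTree S) (a : ℕ) : blockLeaves f a 0 = 0 := rfl

theorem blockLeaves_succ (f : ℕ → BinaryTree S) (a c : ℕ) :
    blockLeaves f a (c + 1) = blockLeaves f a c + (f (a + c)).numLeaves :=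
  Finset.sum_range_succ _ _

theorem offset_add (f : ℕ → BinaryTree S) (a c : ℕ) :
    offset f (a + c) = offset f a + blockLeaves f a c := Finset.sum_range_add _ _ _

theorem blockLeaves_add (f : ℕ → BinaryTree S) (a c d : ℕ) :
    blockLeaves f a (c + d) = blockLeaves f a c + blockLeaves f (a + c) d := by
  simp only [blockLeaves, Finset.sum_range_add, add_assoc]

theorem blockLeaves_congr {f g : ℕ → BinaryTree S} {a b c : ℕ}
    (h : ∀ i < c, f (a + i) = g (b + i)) : blockLeaves f a c = blockLeaves g b c :=
  Finset.sum_congr rfl fun i hi => by rw [h i (Finset.mem_range.1 hi)]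

theorem offset_congr {f g : ℕ → BinaryTree S} {c : ℕ} (h : ∀ i < c, f i = g i) :
    offset f c = offset g c :=
  Finset.sum_congr rfl fun i hi => by rw [h i (Finset.mem_range.1 hi)]

theorem offset_mono (f : ℕ → BinaryTree S) {a b : ℕ} (h : a ≤ b) : offset f a ≤ offset f b := by
  obtain ⟨c, rfl⟩ := Nat.exists_eq_add_of_le h
  rw [offset_add]
  omega

theorem graft_congr (t : BinaryTree S) {g h : ℕ → BinaryTree S}
    (H : ∀ i < t.numLeaves, g i = h i) : graft t g = graft t h := by
  induction t generalizing g h with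
  | nil => exact H 0 (by simp [BinaryTree.numLeaves])
  | node c l r ihl ihr =>
    simp only [BinaryTree.numLeaves] at H
    simp only [graft]
    rw [ihl fun i hi => H i (by omega), ihr fun i hi => H (l.numLeaves + i) (by omega)]

theorem numLeaves_graft (t : BinaryTree S) (g : ℕ → BinaryTree S) :
    (graft t g).numLeaves = ∑ i ∈ Finset.range t.numLeaves, (g i).numLeaves := by
  induction t generalizing g with
  | nil => simp [graft, BinaryTree.numLeaves]
  | node c l r ihl ihr =>
    simp only [graft, BinaryTree.numLeaves, ihl, ihr, Finset.sum_range_add]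

theorem numLeaves_stack (f g : ℕ → BinaryTree S) (i : ℕ) :
    (stack f g i).numLeaves = blockLeaves g (offset f i) (f i).numLeaves := numLeaves_graft _ _

theorem offset_stack (f g : ℕ → BinaryTree S) (i : ℕ) :
    offset (stack f g) i = offset g (offset f i) := by
  induction i with
  | zero => rfl
  | succ i ih => rw [offset_succ, ih, offset_succ, offset_add, numLeaves_stack]

theorem graft_graft (t : BinaryTree S) (g h : ℕ → BinaryTree S) :
    graft (graft t g) h = graft t (stack g h) := by
  induction t generalizing g h with
  | nil =>
    simp only [graft, stack]
    exact congrArg _ (funext fun k => by simp [offset_zero])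
  | node c l r ihl ihr =>
    simp only [graft, ihl, ihr]
    congr 2
    funext i
    simp only [stack]
    refine graft_congr _ fun k _ => ?_
    congr 1
    rw [offset_add, numLeaves_graft, ← add_assoc]
    rfl

theorem stack_assoc (f g h : ℕ → BinaryTree S) : stack (stack f g) h = stack f (stack g h) := by
  funext i
  rw [stack, stack, graft_graft]
  simp only [offset_stack]
  refine graft_congr _ fun k _ => ?_
  simp only [stack]
  refine graft_congr _ fun l _ => ?_
  rw [offset_add, add_assoc]
  rfl

theorem offset_nil (i : ℕ) : offset (fun _ => (BinaryTree.nil : BinaryTree S)) i = i := by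
  simp [offset, BinaryTree.numLeaves]

theorem graft_nil (t : BinaryTree S) : graft t (fun _ => .nil) = t := by
  induction t with
  | nil => rfl
  | node c l r ihl ihr => simp only [graft, ihl, ihr]

end Sequences

/-- A coloured forest with `n` roots and `m` leaves: a list of `n` trees with `m` leaves in total.
The list is indexed from `0` and padded by trivial trees beyond the `n`-th entry. -/
@[ext]
structure Forest (S : Type u) (n m : ℕ) where
  tree : ℕ → BinaryTree S
  padding : ∀ i, n ≤ i → tree i = .nil
  leaves : offset tree n = m

namespace Forest

variable {S : Type u}

/-- The forest with `n` trivial trees. -/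
def id (S : Type u) (n : ℕ) : Forest S n n := ⟨fun _ => .nil, fun _ _ => rfl, offset_nil n⟩

/-- The composition `f ∘ g`: stack `g` on top of `f`. -/
def comp {n m k : ℕ} (f : Forest S n m) (g : Forest S m k) : Forest S n k where
  tree := stack f.tree g.tree
  padding i hi := by
    rw [stack, f.padding i hi, graft, add_zero, g.padding]
    exact f.leaves.symm.trans_le (offset_mono _ hi)
  leaves := by rw [offset_stack, f.leaves, g.leaves]

theorem comp_assoc {n m k l : ℕ} (f : Forest S n m) (g : Forest S m k) (h : Forest S k l) :
    (f.comp g).comp h = f.comp (g.comp h) := Forest.ext (stack_assoc _ _ _)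

theorem id_comp {n m : ℕ} (f : Forest S n m) : (id S n).comp f = f := by
  refine Forest.ext (funext fun i => ?_)
  simp only [comp, id, stack, graft, offset_nil, add_zero]

theorem comp_id {n m : ℕ} (f : Forest S n m) : f.comp (id S m) = f :=
  Forest.ext (funext fun _ => graft_nil _)

end Forest

/-- The free forest-skein category over `S`: objects are natural numbers, morphisms from `n` to
`m` are the coloured forests with `n` roots and `m` leaves. -/
structure FreeFS (S : Type u) : Type where
  card : ℕ

instance (S : Type u) : Category.{u} (FreeFS S) where
  Hom a b := Forest S a.card b.card
  id a := Forest.id S a.card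
  comp f g := f.comp g
  id_comp f := Forest.id_comp f
  comp_id f := Forest.comp_id f
  assoc f g h := Forest.comp_assoc f g h

/-! ## Forest-skein categories -/

/-- The equivalence relation on coloured trees generated by the skein relations `R` and closed
under the forest operations: the smallest one that contains `R` and is closed under stacking. -/
inductive SkeinEq {S : Type u} (R : BinaryTree S → BinaryTree S → Prop) :
    BinaryTree S → BinaryTree S → Prop
  | rel {t s : BinaryTree S} : R t s → SkeinEq R t s
  | refl (t : BinaryTree S) : SkeinEq R t t
  | symm {t s : BinaryTree S} : SkeinEq R t s → SkeinEq R s t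
  | trans {t s r : BinaryTree S} : SkeinEq R t s → SkeinEq R s r → SkeinEq R t r
  | graft {t s : BinaryTree S} {f g : ℕ → BinaryTree S} :
      SkeinEq R t s → (∀ i, SkeinEq R (f i) (g i)) →
      SkeinEq R (ForestSkein.graft t f) (ForestSkein.graft s g)

/-- Two forests are skein equivalent if they are so tree by tree. -/
def skeinRel {S : Type u} (R : BinaryTree S → BinaryTree S → Prop) : HomRel (FreeFS S) :=
  fun _ _ f g => ∀ i, SkeinEq R (Forest.tree f i) (Forest.tree g i)

/-- The forest-skein category with skein presentation `(S, R)`. -/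
abbrev FS {S : Type u} (R : BinaryTree S → BinaryTree S → Prop) : Type :=
  CategoryTheory.Quotient (skeinRel R)

/-- The left-vine whose left branch, read from the root, is coloured by the given word. -/
def leftVine {σ : Type u} : List σ → BinaryTree σ
  | [] => .nil
  | a :: p => .node a (leftVine p) .nil

/-- The skein relations attached to monoid relations: pairs of left-vines. -/
inductive vineRel {σ : Type u} (ρ : FreeMonoid σ → FreeMonoid σ → Prop) :
    BinaryTree σ → BinaryTree σ → Prop
  | mk {p q : FreeMonoid σ} : ρ p q → vineRel ρ (leftVine p.toList) (leftVine q.toList)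

/-! ## Braid groups and block crossings -/

/-- The relations of Artin's presentation of the braid group on `n` strands. -/
def artinRels (n : ℕ) : Set (FreeGroup (Fin (n - 1))) :=
  {r | ∃ i j : Fin (n - 1), (i : ℕ) + 1 < j ∧
      r = FreeGroup.of i * FreeGroup.of j * (FreeGroup.of j * FreeGroup.of i)⁻¹} ∪
  {r | ∃ i j : Fin (n - 1), (i : ℕ) + 1 = j ∧
      r = FreeGroup.of i * FreeGroup.of j * FreeGroup.of i *
        (FreeGroup.of j * FreeGroup.of i * FreeGroup.of j)⁻¹}

/-- Artin's braid group on `n` strands. A product `β * γ` is the diagram with `γ` on top of `β`. -/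
abbrev Braid (n : ℕ) : Type := PresentedGroup (artinRels n)

/-- The crossing of the strands at positions `i` and `i + 1`, counted from `0`
(and `1` if `n ≤ i + 1`). -/
def crossing (n i : ℕ) : Braid n :=
  if h : i < n - 1 then PresentedGroup.of ⟨i, h⟩ else 1

section Blocks

variable {H : Type w} [Group H] (s : ℕ → H)

/-- The strand at bottom position `j` crosses the next `q` strands. -/
def strandOver (j : ℕ) : ℕ → H
  | 0 => 1
  | q + 1 => strandOver j q * s (j + q)

/-- The `p` parallel strands at bottom positions `j, …, j + p - 1` cross the next
`q` parallel strands. -/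
def blockOver (j : ℕ) : ℕ → ℕ → H
  | 0, _ => 1
  | p + 1, q => blockOver (j + 1) p q * strandOver s j q

theorem strandOver_succ (j q : ℕ) : strandOver s j (q + 1) = strandOver s j q * s (j + q) := rfl

theorem blockOver_succ (j p q : ℕ) :
    blockOver s j (p + 1) q = blockOver s (j + 1) p q * strandOver s j q := rfl

theorem strandOver_add (j q r : ℕ) :
    strandOver s j (q + r) = strandOver s j q * strandOver s (j + q) r := by
  induction r with
  | zero => simp [strandOver]
  | succ r ih => rw [← add_assoc, strandOver_succ, ih, strandOver_succ, mul_assoc, add_assoc]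

theorem blockOver_zero_right (j p : ℕ) : blockOver s j p 0 = 1 := by
  induction p generalizing j with
  | zero => rfl
  | succ p ih => rw [blockOver_succ, ih, strandOver, one_mul]

theorem blockOver_add_left (j p p' q : ℕ) :
    blockOver s j (p + p') q = blockOver s (j + p) p' q * blockOver s j p q := by
  induction p generalizing j with
  | zero => simp [blockOver]
  | succ p ih =>
    rw [show p + 1 + p' = (p + p') + 1 by omega, blockOver_succ, ih, blockOver_succ, mul_assoc,
      show j + 1 + p = j + (p + 1) by omega]

/-- The Artin relations on `n` strands for a sequence of group elements. -/
structure IsArtin (n : ℕ) : Prop where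
  comm : ∀ i k, i + 1 < k → Commute (s i) (s k)
  braid : ∀ i, i + 2 < n → s i * s (i + 1) * s i = s (i + 1) * s i * s (i + 1)

namespace IsArtin

variable {s} {n : ℕ}

theorem commute_strandOver (hs : IsArtin s n) {i j q : ℕ} (h : i + 1 < j ∨ j + q < i) :
    Commute (s i) (strandOver s j q) := by
  induction q with
  | zero => exact Commute.one_right _
  | succ q ih =>
    refine Commute.mul_right (ih (by omega)) ?_
    rcases h with h | h
    · exact hs.comm _ _ (by omega)
    · exact (hs.comm _ _ (by omega)).symm

theorem commute_blockOver (hs : IsArtin s n) {i j p q : ℕ} (h : i + 1 < j ∨ j + p + q ≤ i) :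
    Commute (s i) (blockOver s j p q) := by
  induction p generalizing j with
  | zero => exact Commute.one_right _
  | succ p ih =>
    exact Commute.mul_right (ih (by omega)) (hs.commute_strandOver (by omega))

theorem strandOver_commute_blockOver (hs : IsArtin s n) {i r j p q : ℕ}
    (h : i + r < j ∨ j + p + q ≤ i) :
    Commute (strandOver s i r) (blockOver s j p q) := by
  induction r with
  | zero => exact Commute.one_left _
  | succ r ih =>
    exact Commute.mul_left (ih (by omega)) (hs.commute_blockOver (by omega))

theorem blockOver_commute_blockOver (hs : IsArtin s n) {i r t j p q : ℕ}
    (h : i + r + t ≤ j) :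
    Commute (blockOver s i r t) (blockOver s j p q) := by
  induction r generalizing i with
  | zero => exact Commute.one_left _
  | succ r ih =>
    exact Commute.mul_left (ih (by omega)) (hs.strandOver_commute_blockOver (by omega))

theorem blockOver_add_right (hs : IsArtin s n) (j p q r : ℕ) :
    blockOver s j p (q + r) = blockOver s j p q * blockOver s (j + q) p r := by
  induction p generalizing j with
  | zero => simp [blockOver]
  | succ p ih =>
    have h := hs.strandOver_commute_blockOver (i := j) (r := q) (j := j + 1 + q) (p := p) (q := r)
      (by omega)
    rw [blockOver_succ, ih, strandOver_add, blockOver_succ, blockOver_succ,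
      show j + q + 1 = j + 1 + q by omega]
    simp only [mul_assoc]
    rw [← mul_assoc (blockOver s (j + 1 + q) p r), ← h.eq]
    simp only [mul_assoc]

theorem strandOver_slide (hs : IsArtin s n) (j i c : ℕ) (h : j + i + 2 + c < n) :
    s (j + i + 1) * strandOver s j (i + 2 + c) = strandOver s j (i + 2 + c) * s (j + i) := by
  have h1 := hs.commute_strandOver (i := j + i + 1) (j := j) (q := i) (by omega)
  have h2 := hs.commute_strandOver (i := j + i) (j := j + i + 2) (q := c) (by omega)
  have h3 := hs.braid (j + i) (by omega)
  rw [strandOver_add, show i + 2 = i + 1 + 1 by omega, strandOver_succ, strandOver_succ,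
    show j + (i + 1) = j + i + 1 by omega, show j + (i + 1 + 1) = j + i + 2 by omega]
  calc s (j + i + 1) * (strandOver s j i * s (j + i) * s (j + i + 1) *
          strandOver s (j + i + 2) c)
      = (s (j + i + 1) * strandOver s j i) * (s (j + i) * s (j + i + 1)) *
          strandOver s (j + i + 2) c := by simp only [mul_assoc]
    _ = strandOver s j i * (s (j + i + 1) * s (j + i) * s (j + i + 1)) *
          strandOver s (j + i + 2) c := by rw [h1.eq]; simp only [mul_assoc]
    _ = strandOver s j i * (s (j + i) * s (j + i + 1)) *
          (s (j + i) * strandOver s (j + i + 2) c) := by rw [← h3]; simp only [mul_assoc]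
    _ = _ := by rw [h2.eq]; simp only [mul_assoc]

theorem blockOver_slide (hs : IsArtin s n) (j p i q : ℕ) (hi : i + 1 < q) (h : j + p + q ≤ n) :
    s (j + p + i) * blockOver s j p q = blockOver s j p q * s (j + i) := by
  obtain ⟨c, rfl⟩ := Nat.exists_eq_add_of_le (show i + 2 ≤ q by omega)
  induction p generalizing j with
  | zero => simp [blockOver]
  | succ p ih =>
    have h1 := ih (j + 1) (by omega)
    have h2 := hs.strandOver_slide j i c (by omega)
    rw [blockOver_succ, ← mul_assoc, show j + (p + 1) + i = j + 1 + p + i by omega, h1, mul_assoc,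
      show j + 1 + i = j + i + 1 by omega, h2, mul_assoc]

theorem strandOver_blockOver_slide (hs : IsArtin s n) (j p i r q : ℕ) (hi : i + r < q)
    (h : j + p + q ≤ n) :
    strandOver s (j + p + i) r * blockOver s j p q =
      blockOver s j p q * strandOver s (j + i) r := by
  induction r with
  | zero => simp [strandOver]
  | succ r ih =>
    have h1 := hs.blockOver_slide j p (i + r) q (by omega) h
    rw [strandOver_succ, strandOver_succ, mul_assoc, show j + p + i + r = j + p + (i + r) by omega,
      h1, ← mul_assoc, ih (by omega), mul_assoc, add_assoc]

theorem blockOver_blockOver_slide (hs : IsArtin s n) (j p i a r q : ℕ) (hi : i + a + r ≤ q)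
    (h : j + p + q ≤ n) :
    blockOver s (j + p + i) a r * blockOver s j p q =
      blockOver s j p q * blockOver s (j + i) a r := by
  induction a generalizing i with
  | zero => simp [blockOver]
  | succ a ih =>
    have h1 := hs.strandOver_blockOver_slide j p i r q (by omega) h
    have h2 := ih (i + 1) (by omega)
    rw [blockOver_succ, blockOver_succ, mul_assoc, h1, ← mul_assoc,
      show j + p + i + 1 = j + p + (i + 1) by omega, h2, mul_assoc, add_assoc]

theorem yangBaxter (hs : IsArtin s n) (j p q r : ℕ) (h : j + p + q + r ≤ n) :
    blockOver s j p q * blockOver s (j + q) p r * blockOver s j q r =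
      blockOver s (j + p) q r * blockOver s j p r * blockOver s (j + r) p q := by
  have h1 := hs.blockOver_blockOver_slide j p 0 q r (q + r) (by omega) (by omega)
  simp only [add_zero] at h1
  rw [← hs.blockOver_add_right, ← h1, add_comm q r, hs.blockOver_add_right, mul_assoc]

end IsArtin

end Blocks

theorem isArtin_crossing (n : ℕ) : IsArtin (crossing n) n where
  comm i k hik := by
    unfold crossing
    split_ifs with h1 h2
    · have h := PresentedGroup.one_of_mem (rels := artinRels n) (Or.inl ⟨⟨i, h1⟩, ⟨k, h2⟩, hik, rfl⟩)
      simp only [map_mul, map_inv, mul_inv_eq_one] at h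
      exact h
    · exact Commute.one_right _
    · exact Commute.one_left _
    · exact Commute.one_left _
  braid i hi := by
    unfold crossing
    rw [dif_pos (show i < n - 1 by omega), dif_pos (show i + 1 < n - 1 by omega)]
    have h := PresentedGroup.one_of_mem (rels := artinRels n)
      (Or.inr ⟨⟨i, by omega⟩, ⟨i + 1, by omega⟩, rfl, rfl⟩)
    simp only [map_mul, map_inv, mul_inv_eq_one] at h
    exact h

/-! ## The action of braids on forests and the cabling of braids along forests -/

section Action

variable {S : Type u}

/-- Exchange the entries `i` and `i + 1` of a sequence. -/
def swapSeq (g : ℕ → BinaryTree S) (i x : ℕ) : BinaryTree S :=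
  if x = i then g (i + 1) else if x = i + 1 then g i else g x

theorem swapSeq_left (g : ℕ → BinaryTree S) (i : ℕ) : swapSeq g i i = g (i + 1) := if_pos rfl

theorem swapSeq_right (g : ℕ → BinaryTree S) (i : ℕ) : swapSeq g i (i + 1) = g i := by
  simp [swapSeq]

theorem swapSeq_of_ne (g : ℕ → BinaryTree S) {i x : ℕ} (h : x ≠ i) (h' : x ≠ i + 1) :
    swapSeq g i x = g x := by simp [swapSeq, h, h']

theorem swapSeq_swapSeq (g : ℕ → BinaryTree S) (i : ℕ) : swapSeq (swapSeq g i) i = g := by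
  funext x
  unfold swapSeq
  split_ifs <;> first | omega | simp_all

theorem offset_swapSeq (g : ℕ → BinaryTree S) (i k : ℕ) (h : k ≠ i + 1) :
    offset (swapSeq g i) k = offset g k := by
  rcases Nat.lt_or_ge k (i + 1) with hk | hk
  · exact offset_congr fun x hx => swapSeq_of_ne g (by omega) (by omega)
  · obtain ⟨c, rfl⟩ := Nat.exists_eq_add_of_le (show i + 2 ≤ k by omega)
    have h1 : offset (swapSeq g i) i = offset g i :=
      offset_congr fun x hx => swapSeq_of_ne g (by omega) (by omega)
    have h2 : blockLeaves (swapSeq g i) (i + 2) c = blockLeaves g (i + 2) c :=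
      blockLeaves_congr fun x hx => swapSeq_of_ne g (by omega) (by omega)
    have h3 : ∀ f : ℕ → BinaryTree S,
        offset f (i + 2) = offset f i + (f i).numLeaves + (f (i + 1)).numLeaves := fun f => by
      rw [← offset_succ, ← offset_succ]
    rw [offset_add _ (i + 2) c, offset_add _ (i + 2) c, h2, h3, h3, h1, swapSeq_left, swapSeq_right]
    omega

theorem offset_swapSeq_mid (g : ℕ → BinaryTree S) (i : ℕ) :
    offset (swapSeq g i) (i + 1) = offset g i + (g (i + 1)).numLeaves := by
  rw [offset_succ, offset_swapSeq g i i (by omega), swapSeq_left]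

/-- Exchange the trees `i` and `i + 1` of a forest. -/
def Forest.swap {m n : ℕ} (g : Forest S m n) (i : ℕ) (hi : i + 1 < m) : Forest S m n where
  tree := swapSeq g.tree i
  padding x hx := by rw [swapSeq_of_ne _ (by omega) (by omega), g.padding x hx]
  leaves := by rw [offset_swapSeq _ _ _ (by omega), g.leaves]

/-- The cabling along `g` of the crossing of the strands `i` and `i + 1`: after a forest `g` is
pulled down through this crossing, the strand at bottom position `i` carries the tree `i + 1` of
`g` and is replaced by as many parallel strands as this tree has leaves, and similarly for the
other strand. -/
def cableCrossing (n : ℕ) (g : ℕ → BinaryTree S) (i : ℕ) : Braid n :=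
  blockOver (crossing n) (offset g i) (g (i + 1)).numLeaves (g i).numLeaves

/-- The crossing `i` acts on pairs (forest `g`, braid `b` on top of it) by pulling `g` down through
the crossing and multiplying `b` by the cabled crossing. -/
def crossStep (S : Type u) (m n i : ℕ) (hi : i + 1 < m) :
    Equiv.Perm (Forest S m n × Braid n) where
  toFun x := (x.1.swap i hi, cableCrossing n x.1.tree i * x.2)
  invFun x := (x.1.swap i hi, (cableCrossing n (x.1.swap i hi).tree i)⁻¹ * x.2)
  left_inv x := by
    refine Prod.ext (Forest.ext (swapSeq_swapSeq _ _)) ?_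
    simp [Forest.swap, swapSeq_swapSeq]
  right_inv x := by
    refine Prod.ext (Forest.ext (swapSeq_swapSeq _ _)) ?_
    simp

theorem crossStep_comm (m n i j : ℕ) (hj : j + 1 < m) (hij : i + 1 < j) :
    crossStep S m n i (by omega) * crossStep S m n j hj =
      crossStep S m n j hj * crossStep S m n i (by omega) := by
  refine Equiv.ext fun x => Prod.ext (Forest.ext (funext fun k => ?_)) ?_
  · simp only [Equiv.Perm.mul_apply, crossStep, Equiv.coe_fn_mk, Forest.swap]
    unfold swapSeq
    split_ifs <;> first | rfl | omega
  · simp only [Equiv.Perm.mul_apply, crossStep, Equiv.coe_fn_mk, Forest.swap, ← mul_assoc]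
    congr 1
    unfold cableCrossing
    rw [offset_swapSeq _ j i (by omega), offset_swapSeq _ i j (by omega),
      swapSeq_of_ne _ (show i + 1 ≠ j by omega) (by omega),
      swapSeq_of_ne _ (show i ≠ j by omega) (by omega),
      swapSeq_of_ne _ (show j + 1 ≠ i by omega) (by omega),
      swapSeq_of_ne _ (show j ≠ i by omega) (by omega)]
    refine ((isArtin_crossing n).blockOver_commute_blockOver ?_).eq
    have h := offset_mono x.1.tree (show i + 1 + 1 ≤ j by omega)
    simp only [offset_succ] at h
    omega

theorem crossStep_braid (m n i : ℕ) (hi : i + 2 < m) :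
    crossStep S m n i (by omega) * crossStep S m n (i + 1) (by omega) *
        crossStep S m n i (by omega) =
      crossStep S m n (i + 1) (by omega) * crossStep S m n i (by omega) *
        crossStep S m n (i + 1) (by omega) := by
  refine Equiv.ext fun x => Prod.ext (Forest.ext (funext fun k => ?_)) ?_
  · simp only [Equiv.Perm.mul_apply, crossStep, Equiv.coe_fn_mk, Forest.swap]
    unfold swapSeq
    split_ifs <;> first | rfl | omega
  · simp only [Equiv.Perm.mul_apply, crossStep, Equiv.coe_fn_mk, Forest.swap, ← mul_assoc]
    congr 1
    obtain ⟨g, b⟩ := x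
    have hle := offset_mono g.tree (show i + 1 + 1 + 1 ≤ m by omega)
    rw [g.leaves, offset_succ, offset_succ, offset_succ,
      show g.tree (i + 2) = g.tree (i + 1 + 1) from rfl] at hle
    have h1 : ∀ g : ℕ → BinaryTree S, swapSeq g i (i + 1 + 1) = g (i + 1 + 1) := fun g =>
      swapSeq_of_ne g (by omega) (by omega)
    have h2 : ∀ g : ℕ → BinaryTree S, swapSeq g (i + 1) i = g i := fun g =>
      swapSeq_of_ne g (by omega) (by omega)
    unfold cableCrossing
    simp only [h1, h2, swapSeq_left, swapSeq_right,
      offset_swapSeq _ i i (by omega), offset_swapSeq _ (i + 1) i (by omega), offset_succ]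
    exact (isArtin_crossing n).yangBaxter _ _ _ _ (by omega)

/-- The action of braids on pairs (forest, braid on top of it). -/
def braidAct (S : Type u) (m n : ℕ) : Braid m →* Equiv.Perm (Forest S m n × Braid n) :=
  PresentedGroup.toGroup (f := fun i : Fin (m - 1) => crossStep S m n i (by omega)) (by
    rintro r (⟨i, j, hij, rfl⟩ | ⟨i, j, hij, rfl⟩)
    · simp only [map_mul, map_inv, FreeGroup.lift_apply_of, mul_inv_eq_one]
      exact crossStep_comm m n i j (by omega) hij
    · simp only [map_mul, map_inv, FreeGroup.lift_apply_of, mul_inv_eq_one]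
      simp only [← hij]
      exact crossStep_braid m n i (by omega))

variable {m n k : ℕ}

/-- The forest `β · f` obtained by pulling `f` down through the braid `β`. -/
def pull (β : Braid m) (f : Forest S m n) : Forest S m n := (braidAct S m n β (f, 1)).1

/-- The braid obtained from `β` by replacing its strands by parallel strands, one for each
leaf of the tree of `f` that the strand carries, so that `β ∘ f = (β · f) ∘ cable β f`. -/
def cable (β : Braid m) (f : Forest S m n) : Braid n := (braidAct S m n β (f, 1)).2

theorem braidAct_of (i : Fin (m - 1)) :
    braidAct S m n (PresentedGroup.of i) = crossStep S m n i (by omega) :=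
  PresentedGroup.toGroup.of _

theorem braid_induction {P : Braid m → Prop} (one : P 1)
    (of : ∀ i : Fin (m - 1), P (PresentedGroup.of i)) (inv : ∀ β, P β → P β⁻¹)
    (mul : ∀ β γ, P β → P γ → P (β * γ)) (β : Braid m) : P β := by
  induction β using PresentedGroup.induction_on with
  | _ z =>
    induction z using FreeGroup.induction_on with
    | C1 => simpa using one
    | of i => exact of i
    | inv_of i h => exact inv _ h
    | mul x y hx hy => simpa using mul _ _ hx hy

theorem braidAct_apply (β : Braid m) (f : Forest S m n) (b : Braid n) :
    braidAct S m n β (f, b) = (pull β f, cable β f * b) := by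
  suffices h : ∀ (f : Forest S m n) (b c : Braid n), braidAct S m n β (f, b * c) =
      ((braidAct S m n β (f, b)).1, (braidAct S m n β (f, b)).2 * c) by
    simpa [pull, cable] using h f 1 b
  induction β using braid_induction with
  | one => simp
  | of i =>
    intro f b c
    simp [braidAct_of, crossStep, mul_assoc]
  | inv β ih =>
    intro f b c
    apply (braidAct S m n β).injective
    rw [ih]
    simp
  | mul β γ hβ hγ =>
    intro f b c
    simp only [map_mul, Equiv.Perm.mul_apply]
    rw [hγ, hβ]

theorem pull_one (f : Forest S m n) : pull 1 f = f := by simp [pull]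

theorem cable_one (f : Forest S m n) : cable 1 f = 1 := by simp [cable]

theorem pull_mul (β γ : Braid m) (f : Forest S m n) : pull (β * γ) f = pull β (pull γ f) := by
  have h := braidAct_apply (β * γ) f 1
  rw [map_mul, Equiv.Perm.mul_apply, braidAct_apply, braidAct_apply] at h
  exact (congrArg Prod.fst h).symm

theorem cable_mul (β γ : Braid m) (f : Forest S m n) :
    cable (β * γ) f = cable β (pull γ f) * cable γ f := by
  have h := braidAct_apply (β * γ) f 1
  rw [map_mul, Equiv.Perm.mul_apply, braidAct_apply, braidAct_apply] at h
  simpa using (congrArg Prod.snd h).symm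

theorem pull_of (i : Fin (m - 1)) (f : Forest S m n) :
    pull (PresentedGroup.of i) f = f.swap i (by omega) := by
  rw [pull, braidAct_of]
  rfl

theorem cable_of (i : Fin (m - 1)) (f : Forest S m n) :
    cable (PresentedGroup.of i) f = cableCrossing n f.tree i := by
  rw [cable, braidAct_of]
  exact mul_one _

theorem pull_id (β : Braid m) : pull β (Forest.id S m) = Forest.id S m := by
  induction β using braid_induction with
  | one => exact pull_one _
  | of i =>
    rw [pull_of]
    refine Forest.ext (funext fun x => ?_)
    simp [Forest.swap, Forest.id, swapSeq]
  | inv β ih =>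
    conv_lhs => rw [← ih]
    rw [← pull_mul, inv_mul_cancel, pull_one]
  | mul β γ hβ hγ => rw [pull_mul, hγ, hβ]

theorem cable_id (β : Braid m) : cable β (Forest.id S m) = β := by
  induction β using braid_induction with
  | one => exact cable_one _
  | of i =>
    rw [cable_of]
    simp [cableCrossing, Forest.id, offset_nil, BinaryTree.numLeaves, blockOver, strandOver,
      crossing]
  | inv β ih =>
    have h := cable_mul β⁻¹ β (Forest.id S m)
    rw [inv_mul_cancel, cable_one, pull_id, ih] at h
    exact (eq_inv_of_mul_eq_one_left h.symm)
  | mul β γ hβ hγ => rw [cable_mul, pull_id, hγ, hβ]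

/-- The effect on a sequence of trees of pulling it down through a block crossing. -/
def blockSeq (g : ℕ → BinaryTree S) (j p q x : ℕ) : BinaryTree S :=
  if x < j then g x else if x < j + p then g (x + q) else if x < j + p + q then g (x - p) else g x

theorem braidAct_crossing {i : ℕ} (hi : i + 1 < m) :
    braidAct S m n (crossing m i) = crossStep S m n i hi := by
  rw [crossing, dif_pos (by omega), braidAct_of]

theorem pull_crossing {i : ℕ} (hi : i + 1 < m) (f : Forest S m n) :
    (pull (crossing m i) f).tree = swapSeq f.tree i := by
  rw [pull, braidAct_crossing hi]
  rfl

theorem cable_crossing {i : ℕ} (hi : i + 1 < m) (f : Forest S m n) :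
    cable (crossing m i) f = cableCrossing n f.tree i := by
  rw [cable, braidAct_crossing hi]
  exact mul_one _

theorem pull_strandOver (j q : ℕ) (h : j + q < m) (f : Forest S m n) :
    (pull (strandOver (crossing m) j q) f).tree = blockSeq f.tree j 1 q := by
  induction q generalizing f with
  | zero =>
    rw [strandOver, pull_one]
    funext x
    unfold blockSeq
    split_ifs <;> rfl
  | succ q ih =>
    rw [strandOver_succ, pull_mul, ih (by omega), pull_crossing (by omega)]
    funext x
    unfold blockSeq swapSeq
    split_ifs <;> first | rfl | omega | (congr 1; omega)

theorem cable_strandOver (j q : ℕ) (h : j + q < m) (f : Forest S m n) :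
    cable (strandOver (crossing m) j q) f =
      blockOver (crossing n) (offset f.tree j) (f.tree (j + q)).numLeaves
        (blockLeaves f.tree j q) := by
  induction q generalizing f with
  | zero => rw [strandOver, cable_one, blockLeaves_zero, blockOver_zero_right]
  | succ q ih =>
    rw [strandOver_succ, cable_mul, ih (by omega), pull_crossing (by omega),
      cable_crossing (by omega), cableCrossing, swapSeq_left, blockLeaves_succ,
      (isArtin_crossing n).blockOver_add_right, offset_swapSeq _ _ _ (by omega), offset_add,
      blockLeaves_congr (g := f.tree) (b := j) fun x hx => swapSeq_of_ne _ (by omega) (by omega),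
      add_assoc]

theorem pull_blockOver (j p q : ℕ) (h : j + p + q ≤ m) (f : Forest S m n) :
    (pull (blockOver (crossing m) j p q) f).tree = blockSeq f.tree j p q := by
  induction p generalizing j f with
  | zero =>
    rw [blockOver, pull_one]
    funext x
    unfold blockSeq
    split_ifs <;> first | rfl | omega
  | succ p ih =>
    rw [blockOver_succ, pull_mul, ih _ (by omega), pull_strandOver _ _ (by omega)]
    funext x
    unfold blockSeq
    split_ifs <;> first | rfl | omega

theorem cable_blockOver (j p q : ℕ) (h : j + p + q ≤ m) (f : Forest S m n) :
    cable (blockOver (crossing m) j p q) f =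
      blockOver (crossing n) (offset f.tree j) (blockLeaves f.tree (j + q) p)
        (blockLeaves f.tree j q) := by
  induction p generalizing j f with
  | zero => rw [blockOver, cable_one, blockLeaves_zero, blockOver]
  | succ p ih =>
    have h1 : offset (blockSeq f.tree j 1 q) (j + 1) =
        offset f.tree j + (f.tree (j + q)).numLeaves := by
      rw [offset_succ]
      congr 1
      · exact offset_congr fun x hx => if_pos hx
      · simp [blockSeq]
    have h2 : blockLeaves (blockSeq f.tree j 1 q) (j + 1 + q) p =
        blockLeaves f.tree (j + q + 1) p :=
      blockLeaves_congr fun x hx => by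
        unfold blockSeq
        split_ifs <;> first | omega | (congr 1; omega)
    have h3 : blockLeaves (blockSeq f.tree j 1 q) (j + 1) q = blockLeaves f.tree j q :=
      blockLeaves_congr fun x hx => by
        unfold blockSeq
        split_ifs <;> first | omega | (congr 1; omega)
    have h4 : blockLeaves f.tree (j + q) (p + 1) =
        (f.tree (j + q)).numLeaves + blockLeaves f.tree (j + q + 1) p := by
      rw [add_comm p 1, blockLeaves_add]
      simp [blockLeaves]
    rw [blockOver_succ, cable_mul, ih _ (by omega), pull_strandOver _ _ (by omega),
      cable_strandOver _ _ (by omega), h1, h2, h3, h4, blockOver_add_left]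

theorem pull_cable_comp (β : Braid m) (f : Forest S m n) (g : Forest S n k) :
    pull β (f.comp g) = (pull β f).comp (pull (cable β f) g) ∧
      cable β (f.comp g) = cable (cable β f) g := by
  induction β using braid_induction generalizing f g with
  | one => simp [pull_one, cable_one]
  | of i =>
    have hi := i.2
    have hle := offset_mono f.tree (show (i : ℕ) + 1 + 1 ≤ m by omega)
    rw [f.leaves, offset_succ, offset_succ] at hle
    rw [pull_of, pull_of, cable_of, cable_of]
    constructor
    · refine Forest.ext (funext fun x => ?_)
      simp only [Forest.comp, Forest.swap, cableCrossing]
      rw [pull_blockOver _ _ _ (by omega)]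
      rcases lt_trichotomy x (i : ℕ) with hx | hx | hx
      · rw [swapSeq_of_ne _ (by omega) (by omega), stack, stack,
          swapSeq_of_ne _ (by omega) (by omega), offset_swapSeq _ _ _ (by omega)]
        refine graft_congr _ fun y hy => ?_
        have := offset_mono f.tree (show x + 1 ≤ i by omega)
        rw [offset_succ] at this
        exact (if_pos (by omega)).symm
      · subst hx
        rw [swapSeq_left, stack, stack, swapSeq_left, offset_swapSeq _ _ _ (by omega), offset_succ]
        refine graft_congr _ fun y hy => ?_
        unfold blockSeq
        split_ifs <;> first | omega | (congr 1; omega)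
      · rcases Nat.eq_or_lt_of_le (show (i : ℕ) + 1 ≤ x from hx) with hx | hx
        · subst hx
          rw [swapSeq_right, stack, stack, swapSeq_right, offset_swapSeq_mid]
          refine graft_congr _ fun y hy => ?_
          unfold blockSeq
          split_ifs <;> first | omega | (congr 1; omega)
        · rw [swapSeq_of_ne _ (by omega) (by omega), stack, stack,
            swapSeq_of_ne _ (by omega) (by omega), offset_swapSeq _ _ _ (by omega)]
          refine graft_congr _ fun y hy => ?_
          have := offset_mono f.tree (show (i : ℕ) + 1 + 1 ≤ x by omega)
          rw [offset_succ, offset_succ] at this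
          unfold blockSeq
          split_ifs <;> first | omega | rfl
    · simp only [cableCrossing, Forest.comp]
      rw [cable_blockOver _ _ _ (by omega), offset_stack, numLeaves_stack, numLeaves_stack,
        offset_succ]
  | inv β ih =>
    have h0 : f = pull β (pull β⁻¹ f) := by rw [← pull_mul, mul_inv_cancel, pull_one]
    have h1 : cable β⁻¹ f = (cable β (pull β⁻¹ f))⁻¹ := by
      apply eq_inv_of_mul_eq_one_right
      rw [← cable_mul, mul_inv_cancel, cable_one]
    have h2 := ih (pull β⁻¹ f) (pull (cable β⁻¹ f) g)
    rw [← h0, ← pull_mul, h1, mul_inv_cancel, pull_one, ← h1] at h2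
    obtain ⟨h2, h3⟩ := h2
    have h4 : pull β⁻¹ (f.comp g) = (pull β⁻¹ f).comp (pull (cable β⁻¹ f) g) := by
      rw [← h2, ← pull_mul, inv_mul_cancel, pull_one]
    refine ⟨h4, ?_⟩
    have h5 : cable β⁻¹ (f.comp g) = (cable β (pull β⁻¹ (f.comp g)))⁻¹ := by
      apply eq_inv_of_mul_eq_one_right
      rw [← cable_mul, mul_inv_cancel, cable_one]
    rw [h5, h4, h3]
    apply inv_eq_of_mul_eq_one_right
    rw [← cable_mul]
    rw [h1, mul_inv_cancel, cable_one]
  | mul β γ hβ hγ =>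
    obtain ⟨h1, h2⟩ := hγ f g
    obtain ⟨h3, h4⟩ := hβ (pull γ f) (pull (cable γ f) g)
    rw [pull_mul, pull_mul, cable_mul, cable_mul, cable_mul, pull_mul, h1, h2, h3, h4]
    exact ⟨rfl, rfl⟩

end Action

/-! ## The braided version of forest-skein categories -/

/-- The braided version of the free forest-skein category over `S`: morphisms from `n` to `m` are
the diagrams `f ∘ β` where `f` is a coloured forest with `n` roots and `m` leaves and `β` is a
braid on `m` strands stacked on top of `f`. -/
structure FreeBVFS (S : Type u) : Type where
  card : ℕ

instance (S : Type u) : Category.{u} (FreeBVFS S) where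
  Hom a b := Forest S a.card b.card × Braid b.card
  id a := (Forest.id S a.card, 1)
  comp x y := (x.1.comp (pull x.2 y.1), cable x.2 y.1 * y.2)
  id_comp x := by
    refine Prod.ext ?_ ?_
    · simp only [pull_one, Forest.id_comp]
    · simp only [cable_one, one_mul]
  comp_id x := by
    refine Prod.ext ?_ ?_
    · simp only [pull_id, Forest.comp_id]
    · simp only [cable_id, mul_one]
  assoc x y z := by
    refine Prod.ext ?_ ?_
    · simp only [Forest.comp_assoc, (pull_cable_comp _ _ _).1, pull_mul]
    · simp only [(pull_cable_comp _ _ _).2, cable_mul, mul_assoc]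

/-- Two diagrams `f ∘ β` and `g ∘ γ` are skein equivalent if `f` and `g` are so and `β = γ`. -/
def skeinRelBV {S : Type u} (R : BinaryTree S → BinaryTree S → Prop) : HomRel (FreeBVFS S) :=
  fun _ _ x y => (∀ i, SkeinEq R (Forest.tree (Prod.fst x) i) (Forest.tree (Prod.fst y) i)) ∧
    Prod.snd x = Prod.snd y

/-- The braided version of the forest-skein category with skein presentation `(S, R)`. -/
abbrev BVFS {S : Type u} (R : BinaryTree S → BinaryTree S → Prop) : Type :=
  CategoryTheory.Quotient (skeinRelBV R)

/-! ## The forest-skein groups of a homogeneously presented monoid -/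

section Monoid

variable {σ : Type u} (ρ : FreeMonoid σ → FreeMonoid σ → Prop)

/-- The forest-skein category of the monoid presentation `(σ, ρ)`. -/
abbrev MonFS : Type := FS (vineRel ρ)

/-- The braided version of the forest-skein category of the monoid presentation `(σ, ρ)`. -/
abbrev MonBVFS : Type := BVFS (vineRel ρ)

/-- The forest-skein group `G`: the fraction group at `1` of the forest-skein category. -/
abbrev FSGroup : Type u := FracGroup (MonFS ρ) ⟨⟨1⟩⟩

/-- The braided forest-skein group `G^BV`. -/
abbrev BVFSGroup : Type u := FracGroup (MonBVFS ρ) ⟨⟨1⟩⟩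

end Monoid

end ForestSkein

namespace ForestSkein

open CategoryTheory

universe u v w

/-! An order is encoded by its positive cone. A cone on a fraction group comes from a relation
between parallel morphisms that is transitive, irreflexive, stable under right composition, and
total up to equality after a common expansion (`FracGroup.IsPositivity`).

From `Frac(M)` to `G`. Label each leaf of a tree by the product in `M` of the colours along the
maximal left-going path that ends there (`leafCode`). Skein relations preserve these codes. Grafting
a forest multiplies the code of each old leaf on the right by the first code of the tree grafted
there, and creates further leaves whose codes do not depend on the old tree (`leafCode_graft`). For
two trees with the same number of leaves, the sequence of quotients of codes in `Frac(M)` is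
therefore unchanged by a common expansion, except that trivial terms are inserted; the sign of its
first nontrivial term defines the order. By left-cancellation the codes determine a tree up to skein
equivalence (`vineEq_of_monCode`). Hence two trees all of whose quotients are trivial become equal
after suitable left-vines are grafted (`exists_comp_forestEq`), and the order is total. If the order
of `Frac(M)` is bi-invariant, so is this one: conjugating an element only conjugates the quotients
up to the first nontrivial one (`CodePos.conj`). Homogeneity keeps the leaves aligned, since code
lengths determine the shape needed.

For `G^BV` the braids are compared first, by Dehornoy's order on the braid group with infinitely
many strands, and leaf codes break ties. This needs four facts: finite braid groups embed
(`toInf_injective`); cabling along a forest preserves Dehornoy positivity (`pos_toInf_cable`); a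
positive braid is nontrivial (`not_pos_one`, because Dynnikov's action strictly increases a
coordinate); and every braid is positive, trivial or negative (`pos_or_eq_one_or_pos_inv`, from the
comparison property of left self-distributive terms evaluated under Dehornoy's bracket).

Conversely, orderability passes to subgroups, and `Frac(M)` sits in both groups: `[x, y]` is
represented by two trees with a root caret, left-vines spelling `x` and `y` on its left leaf, and
right-vines on its right leaf that equalise the numbers of leaves
(`IsSkeinMap.exists_isDifference`). -/

/-! ## Positive cones -/

/-- A group is left-orderable if it has a total positive cone. -/
theorem leftOrderable_of_cone {G : Type u} [Group G] (P : G → Prop)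
    (mul : ∀ a b, P a → P b → P (a * b)) (one : ¬ P 1)
    (total : ∀ a, P a ∨ a = 1 ∨ P a⁻¹) : LeftOrderable G := by
  classical
  refine ⟨{ le := fun a b => a = b ∨ P (a⁻¹ * b)
            le_refl := fun a => Or.inl rfl
            le_trans := ?_
            le_antisymm := ?_
            le_total := ?_
            toDecidableLE := Classical.decRel _ }, ?_⟩
  · rintro a b c (rfl | h) (rfl | h')
    · exact Or.inl rfl
    · exact Or.inr h'
    · exact Or.inr h
    · right
      simpa [mul_assoc] using mul _ _ h h'
  · rintro a b (rfl | h) (h' | h')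
    · rfl
    · rfl
    · exact h'.symm
    · exact (one (by simpa [mul_assoc] using mul _ _ h h')).elim
  · intro a b
    rcases total (a⁻¹ * b) with h | h | h
    · exact Or.inl (Or.inr h)
    · exact Or.inl (Or.inl (inv_mul_eq_one.1 h))
    · exact Or.inr (Or.inr (by simpa using h))
  · rintro g h k (rfl | hk)
    · exact Or.inl rfl
    · right
      simpa [mul_assoc] using hk

/-- A group is bi-orderable if it has a total positive cone that is stable under conjugation. -/
theorem biOrderable_of_cone {G : Type u} [Group G] (P : G → Prop)
    (mul : ∀ a b, P a → P b → P (a * b)) (one : ¬ P 1)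
    (total : ∀ a, P a ∨ a = 1 ∨ P a⁻¹) (conj : ∀ a g, P a → P (g * a * g⁻¹)) :
    BiOrderable G := by
  classical
  refine ⟨{ le := fun a b => a = b ∨ P (a⁻¹ * b)
            le_refl := fun a => Or.inl rfl
            le_trans := ?_
            le_antisymm := ?_
            le_total := ?_
            toDecidableLE := Classical.decRel _ }, ?_⟩
  · rintro a b c (rfl | h) (rfl | h')
    · exact Or.inl rfl
    · exact Or.inr h'
    · exact Or.inr h
    · right
      simpa [mul_assoc] using mul _ _ h h'
  · rintro a b (rfl | h) (h' | h')
    · rfl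
    · rfl
    · exact h'.symm
    · exact (one (by simpa [mul_assoc] using mul _ _ h h')).elim
  · intro a b
    rcases total (a⁻¹ * b) with h | h | h
    · exact Or.inl (Or.inr h)
    · exact Or.inl (Or.inl (inv_mul_eq_one.1 h))
    · exact Or.inr (Or.inr (by simpa using h))
  · rintro g h k (rfl | hk)
    · exact ⟨Or.inl rfl, Or.inl rfl⟩
    · constructor
      · right
        simpa [mul_assoc] using hk
      · right
        simpa [mul_assoc] using conj _ g⁻¹ hk

/-! ## The braid group on infinitely many strands -/

/-- The Artin relations on infinitely many strands. -/
def artinRelsInf : Set (FreeGroup ℕ) :=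
  {r | ∃ i j : ℕ, i + 1 < j ∧
      r = FreeGroup.of i * FreeGroup.of j * (FreeGroup.of j * FreeGroup.of i)⁻¹} ∪
  {r | ∃ i : ℕ, r = FreeGroup.of i * FreeGroup.of (i + 1) * FreeGroup.of i *
        (FreeGroup.of (i + 1) * FreeGroup.of i * FreeGroup.of (i + 1))⁻¹}

/-- The braid group on infinitely many strands. -/
abbrev BraidInf : Type := PresentedGroup artinRelsInf

namespace BraidInf

/-- The crossing of the strands `i` and `i + 1`. -/
def gen (i : ℕ) : BraidInf := PresentedGroup.of i

theorem gen_comm {i j : ℕ} (h : i + 1 < j) : Commute (gen i) (gen j) := by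
  have h := PresentedGroup.one_of_mem (rels := artinRelsInf) (Or.inl ⟨i, j, h, rfl⟩)
  simp only [map_mul, map_inv, mul_inv_eq_one] at h
  exact h

theorem gen_braid (i : ℕ) :
    gen i * gen (i + 1) * gen i = gen (i + 1) * gen i * gen (i + 1) := by
  have h := PresentedGroup.one_of_mem (rels := artinRelsInf) (Or.inr ⟨i, rfl⟩)
  simp only [map_mul, map_inv, mul_inv_eq_one] at h
  exact h

theorem isArtin_gen (n : ℕ) : IsArtin gen n where
  comm _ _ h := gen_comm h
  braid i _ := gen_braid i

/-- The homomorphism from `BraidInf` defined by a sequence satisfying the Artin relations. -/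
def lift {G : Type w} [Group G] (s : ℕ → G) (hs : ∀ n, IsArtin s n) : BraidInf →* G :=
  PresentedGroup.toGroup (f := s) (by
    rintro r (⟨i, j, hij, rfl⟩ | ⟨i, rfl⟩)
    · simp only [map_mul, map_inv, FreeGroup.lift_apply_of, mul_inv_eq_one]
      exact (hs 0).comm i j hij
    · simp only [map_mul, map_inv, FreeGroup.lift_apply_of, mul_inv_eq_one]
      exact (hs (i + 3)).braid i (by omega))

@[simp]
theorem lift_gen {G : Type w} [Group G] (s : ℕ → G) (hs : ∀ n, IsArtin s n) (i : ℕ) :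
    lift s hs (gen i) = s i := PresentedGroup.toGroup.of _

theorem closure_gen : Subgroup.closure (Set.range gen) = ⊤ :=
  PresentedGroup.closure_range_of _

theorem induction {P : BraidInf → Prop} (one : P 1) (gen_mul : ∀ i b, P b → P (gen i * b))
    (inv_gen_mul : ∀ i b, P b → P ((gen i)⁻¹ * b)) (b : BraidInf) : P b := by
  have hb : b ∈ Subgroup.closure (Set.range gen) := by rw [closure_gen]; trivial
  induction hb using Subgroup.closure_induction_left with
  | one => exact one
  | mul_left x hx y _ ih =>
    obtain ⟨i, rfl⟩ := hx
    exact gen_mul i y ih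
  | inv_mul_cancel x hx y _ ih =>
    obtain ⟨i, rfl⟩ := hx
    exact inv_gen_mul i y ih

/-! ### Dehornoy positivity -/

/-- The braids that do not involve the first `k + 1` strands. -/
def tail (k : ℕ) : Subgroup BraidInf := Subgroup.closure (gen '' {i | k < i})

/-- The braids with an expression where only `gen i` with `k ≤ i` occur and where `gen k` occurs
with positive exponents only. -/
def nonneg (k : ℕ) : Submonoid BraidInf := Submonoid.closure ({gen k} ∪ tail k)

/-- The braids with an expression where only `gen i` with `k ≤ i` occur and where `gen k` occurs,
with positive exponents only. -/
def PosAt (k : ℕ) (b : BraidInf) : Prop :=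
  ∃ x ∈ nonneg k, ∃ y ∈ nonneg k, b = x * gen k * y

/-- Dehornoy positive braids. -/
def Pos (b : BraidInf) : Prop := ∃ k, PosAt k b

theorem gen_mem_tail {k i : ℕ} (h : k < i) : gen i ∈ tail k :=
  Subgroup.subset_closure ⟨i, h, rfl⟩

theorem tail_le_nonneg (k : ℕ) : (tail k).toSubmonoid ≤ nonneg k := fun _ hx =>
  Submonoid.subset_closure (Or.inr hx)

theorem gen_mem_nonneg (k : ℕ) : gen k ∈ nonneg k := Submonoid.subset_closure (Or.inl rfl)

theorem PosAt.mul_left {k : ℕ} {a b : BraidInf} (ha : a ∈ nonneg k) (hb : PosAt k b) :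
    PosAt k (a * b) := by
  obtain ⟨x, hx, y, hy, rfl⟩ := hb
  exact ⟨a * x, mul_mem ha hx, y, hy, by simp only [mul_assoc]⟩

theorem PosAt.mul_right {k : ℕ} {a b : BraidInf} (ha : PosAt k a) (hb : b ∈ nonneg k) :
    PosAt k (a * b) := by
  obtain ⟨x, hx, y, hy, rfl⟩ := ha
  exact ⟨x, hx, y * b, mul_mem hy hb, by simp only [mul_assoc]⟩

theorem PosAt.mem_nonneg {k : ℕ} {a : BraidInf} (ha : PosAt k a) : a ∈ nonneg k := by
  obtain ⟨x, hx, y, hy, rfl⟩ := ha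
  exact mul_mem (mul_mem hx (gen_mem_nonneg k)) hy

theorem tail_anti {k l : ℕ} (h : k ≤ l) : tail l ≤ tail k :=
  Subgroup.closure_mono (Set.image_mono fun _ hi => lt_of_le_of_lt h hi)

theorem nonneg_le_tail {k l : ℕ} (h : k < l) : nonneg l ≤ (tail k).toSubmonoid := by
  refine Submonoid.closure_le.2 ?_
  rintro x (rfl | hx)
  · exact gen_mem_tail h
  · exact tail_anti h.le hx

/-- The factor of larger index lies in the tail of the smaller index, where it may be absorbed on
either side. -/
theorem Pos.mul {a b : BraidInf} (ha : Pos a) (hb : Pos b) : Pos (a * b) := by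
  obtain ⟨k, ha⟩ := ha
  obtain ⟨l, hb⟩ := hb
  rcases lt_trichotomy k l with h | rfl | h
  · exact ⟨k, ha.mul_right (tail_le_nonneg k (nonneg_le_tail h hb.mem_nonneg))⟩
  · exact ⟨k, ha.mul_right hb.mem_nonneg⟩
  · exact ⟨l, hb.mul_left (tail_le_nonneg l (nonneg_le_tail h ha.mem_nonneg))⟩

/-! ### Actions given by solutions of the Yang–Baxter equation -/

section YangBaxter

variable {V : Type w}

/-- A bijection of `V × V` acting on the entries `i` and `i + 1` of a sequence. -/
def stepPerm (R : V × V ≃ V × V) (i : ℕ) : Equiv.Perm (ℕ → V) where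
  toFun v x := if x = i then (R (v i, v (i + 1))).1 else
    if x = i + 1 then (R (v i, v (i + 1))).2 else v x
  invFun v x := if x = i then (R.symm (v i, v (i + 1))).1 else
    if x = i + 1 then (R.symm (v i, v (i + 1))).2 else v x
  left_inv v := by
    funext x
    by_cases h1 : x = i
    · subst h1; simp
    · by_cases h2 : x = i + 1
      · subst h2; simp
      · simp [h1, h2]
  right_inv v := by
    funext x
    by_cases h1 : x = i
    · subst h1; simp
    · by_cases h2 : x = i + 1
      · subst h2; simp
      · simp [h1, h2]

theorem stepPerm_apply (R : V × V ≃ V × V) (i : ℕ) (v : ℕ → V) (x : ℕ) :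
    stepPerm R i v x = if x = i then (R (v i, v (i + 1))).1 else
      if x = i + 1 then (R (v i, v (i + 1))).2 else v x := rfl

/-- Distant moves touch disjoint entries. The hypotheses are the set-theoretic Yang–Baxter equation,
split into the first two entries of the result and the third. -/
theorem isArtin_stepPerm (R : V × V ≃ V × V)
    (h1 : ∀ a b c, R ((R (a, b)).1, (R ((R (a, b)).2, c)).1) = ((R (a, (R (b, c)).1)).1,
      (R ((R (a, (R (b, c)).1)).2, (R (b, c)).2)).1))
    (h2 : ∀ a b c, (R ((R (a, b)).2, c)).2 = (R ((R (a, (R (b, c)).1)).2, (R (b, c)).2)).2)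
    (n : ℕ) : IsArtin (stepPerm R) n where
  comm i j hij := by
    refine Equiv.ext fun v => funext fun x => ?_
    have e1 : ¬ (i = j) := by omega
    have e2 : ¬ (i = j + 1) := by omega
    have e3 : ¬ (i + 1 = j) := by omega
    have e4 : ¬ (j = i) := by omega
    have e5 : ¬ (j = i + 1) := by omega
    have e6 : ¬ (j + 1 = i) := by omega
    simp only [Equiv.Perm.mul_apply, stepPerm_apply, e1, e2, e3, e4, e5, e6, if_false,
      Nat.add_right_cancel_iff]
    split_ifs <;> first | rfl | omega
  braid i _ := by
    refine Equiv.ext fun v => funext fun x => ?_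
    have e1 : ¬ (i = i + 1) := by omega
    have e2 : ¬ (i + 1 = i) := by omega
    have e3 : ¬ (i + 1 + 1 = i) := by omega
    have e4 : ¬ (i + 1 + 1 = i + 1) := by omega
    have e5 : ¬ (i = i + 1 + 1) := by omega
    have e6 : ¬ (i + 1 = i + 1 + 1) := by omega
    have h1 := h1 (v i) (v (i + 1)) (v (i + 1 + 1))
    have h2 := h2 (v i) (v (i + 1)) (v (i + 1 + 1))
    simp only [Equiv.Perm.mul_apply, stepPerm_apply, e1, e2, e3, e4, e5, e6, if_false, if_true, h1]
    split_ifs <;> first | rfl | omega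

end YangBaxter

/-- Pairs of positive rational numbers. -/
abbrev PosPair : Type := {p : ℚ × ℚ // 0 < p.1 ∧ 0 < p.2}

/-- The denominator of the Dynnikov map. -/
def dynDen (x y x' y' : ℚ) : ℚ := y * x' + x * (1 + y) * (1 + y')

/-- The subtraction-free version of Dynnikov's action of a crossing. -/
def dyn (p : PosPair × PosPair) : PosPair × PosPair :=
  (⟨(p.1.1.1 + p.1.1.2 * (p.1.1.1 + p.2.1.1),
      p.1.1.2 * p.2.1.2 * p.2.1.1 / dynDen p.1.1.1 p.1.1.2 p.2.1.1 p.2.1.2), by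
      obtain ⟨⟨⟨x, y⟩, hx, hy⟩, ⟨x', y'⟩, hx', hy'⟩ := p
      simp only [dynDen] at *
      constructor <;> positivity⟩,
    ⟨(p.1.1.1 * p.2.1.1 * p.2.1.2 / (p.1.1.1 * p.2.1.2 + p.1.1.1 + p.2.1.1),
      dynDen p.1.1.1 p.1.1.2 p.2.1.1 p.2.1.2 / p.2.1.1), by
      obtain ⟨⟨⟨x, y⟩, hx, hy⟩, ⟨x', y'⟩, hx', hy'⟩ := p
      simp only [dynDen] at *
      constructor <;> positivity⟩)

/-- The inversion of the first components. -/
def invFst (p : PosPair) : PosPair := ⟨(p.1.1⁻¹, p.1.2), inv_pos.2 p.2.1, p.2.2⟩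

/-- Mirror symmetry: inverting the first components exchanges a crossing with its inverse, so no
separate formula for the inverse is needed. -/
theorem dyn_involutive (p : PosPair × PosPair) :
    Prod.map invFst invFst (dyn (Prod.map invFst invFst (dyn p))) = p := by
  obtain ⟨⟨⟨x, y⟩, hx, hy⟩, ⟨x', y'⟩, hx', hy'⟩ := p
  simp only at hx hy hx' hy'
  refine Prod.ext (Subtype.ext (Prod.ext ?_ ?_)) (Subtype.ext (Prod.ext ?_ ?_)) <;>
  · simp only [dyn, invFst, Prod.map, dynDen]
    field_simp
    try ring

theorem invFst_invFst (p : PosPair) : invFst (invFst p) = p :=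
  Subtype.ext (Prod.ext (inv_inv _) rfl)

/-- The Dynnikov map as a bijection. -/
def dynEquiv : PosPair × PosPair ≃ PosPair × PosPair where
  toFun := dyn
  invFun p := Prod.map invFst invFst (dyn (Prod.map invFst invFst p))
  left_inv p := dyn_involutive p
  right_inv p := by
    have h : ∀ q : PosPair × PosPair, Prod.map invFst invFst (Prod.map invFst invFst q) = q :=
      fun q => Prod.ext (invFst_invFst _) (invFst_invFst _)
    have h' := congrArg (Prod.map invFst invFst) (dyn_involutive (Prod.map invFst invFst p))
    rwa [h, h] at h'

end BraidInf

namespace BraidInf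

/-! ### The Yang–Baxter equation for Dynnikov's map -/

section DynnikovRelation

variable (x₁ y₁ x₂ y₂ x₃ y₃ : ℚ)

/-- The numerator of the second component of `dyn` after the crossings `0` and `1`. -/
def dynNumL : ℚ := dynDen x₁ y₁ x₂ y₂ * x₃ + x₁ * x₂ * y₂ * (1 + y₁) * (1 + y₃)

/-- The numerator of the second component of `dyn` after the crossings `1` and `0`. -/
def dynNumR : ℚ := y₁ * dynDen x₂ y₂ x₃ y₃ + x₁ * (1 + y₁) * (1 + y₃)

end DynnikovRelation

/-- The braid relation is checked through closed forms of both sides. After the crossings `0` and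
`1` the third entry is already final, and after the crossings `1` and `0` the first one is; the two
remaining entries on each side are left to `dyn_final_left` and `dyn_final_right`. -/
theorem dyn_stage_left {x₁ y₁ x₂ y₂ x₃ y₃ : ℚ} (h₁ : 0 < x₁ ∧ 0 < y₁) (h₂ : 0 < x₂ ∧ 0 < y₂)
    (h₃ : 0 < x₃ ∧ 0 < y₃) :
    let p := dyn ((dyn (⟨(x₁, y₁), h₁⟩, ⟨(x₂, y₂), h₂⟩)).2, ⟨(x₃, y₃), h₃⟩)
    p.1.1 = ((x₁ * x₂ * y₂ * (1 + y₁) + x₃ * dynDen x₁ y₁ x₂ y₂) / x₂,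
      dynDen x₁ y₁ x₂ y₂ * y₃ * x₃ / dynNumL x₁ y₁ x₂ y₂ x₃ y₃) ∧
    p.2.1 = (x₁ * x₂ * y₂ * x₃ * y₃ / (x₁ * x₂ * y₂ * (1 + y₃) + x₃ * (x₁ * y₂ + x₁ + x₂)),
      dynNumL x₁ y₁ x₂ y₂ x₃ y₃ / (x₂ * x₃)) := by
  obtain ⟨hx₁, hy₁⟩ := h₁
  obtain ⟨hx₂, hy₂⟩ := h₂
  obtain ⟨hx₃, hy₃⟩ := h₃
  have hden : dynDen (x₁ * x₂ * y₂ / (x₁ * y₂ + x₁ + x₂)) (dynDen x₁ y₁ x₂ y₂ / x₂) x₃ y₃ =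
      dynNumL x₁ y₁ x₂ y₂ x₃ y₃ / x₂ := by
    simp only [dynDen, dynNumL]
    field_simp
    ring
  have hD : 0 < dynDen x₁ y₁ x₂ y₂ := by simp only [dynDen]; positivity
  have hN : 0 < dynNumL x₁ y₁ x₂ y₂ x₃ y₃ := by simp only [dynNumL]; positivity
  refine ⟨Prod.ext ?_ ?_, Prod.ext ?_ ?_⟩
  · simp only [dyn, dynDen]
    field_simp
    ring
  · simp only [dyn, hden]
    field_simp
  · simp only [dyn]
    field_simp
    ring
  · simp only [dyn, hden]
    field_simp

theorem dyn_stage_right {x₁ y₁ x₂ y₂ x₃ y₃ : ℚ} (h₁ : 0 < x₁ ∧ 0 < y₁) (h₂ : 0 < x₂ ∧ 0 < y₂)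
    (h₃ : 0 < x₃ ∧ 0 < y₃) :
    let p := dyn (⟨(x₁, y₁), h₁⟩, (dyn (⟨(x₂, y₂), h₂⟩, ⟨(x₃, y₃), h₃⟩)).1)
    p.1.1 = (x₁ + y₁ * (x₁ + (x₂ + y₂ * (x₂ + x₃))),
      y₁ * y₂ * y₃ * x₃ / dynNumR x₁ y₁ x₂ y₂ x₃ y₃) ∧
    p.2.1 = (x₁ * y₂ * y₃ * x₃ / (x₁ * (1 + y₃) + dynDen x₂ y₂ x₃ y₃),
      dynNumR x₁ y₁ x₂ y₂ x₃ y₃ / dynDen x₂ y₂ x₃ y₃) := by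
  obtain ⟨hx₁, hy₁⟩ := h₁
  obtain ⟨hx₂, hy₂⟩ := h₂
  obtain ⟨hx₃, hy₃⟩ := h₃
  have hD : 0 < dynDen x₂ y₂ x₃ y₃ := by simp only [dynDen]; positivity
  have hN : 0 < dynNumR x₁ y₁ x₂ y₂ x₃ y₃ := by simp only [dynNumR]; positivity
  have h1 : 1 + y₂ * y₃ * x₃ / dynDen x₂ y₂ x₃ y₃ =
      (1 + y₃) * (x₂ + y₂ * (x₂ + x₃)) / dynDen x₂ y₂ x₃ y₃ := by
    rw [eq_div_iff hD.ne', add_mul, div_mul_cancel₀ _ hD.ne', dynDen]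
    ring
  have hden : dynDen x₁ y₁ (x₂ + y₂ * (x₂ + x₃)) (y₂ * y₃ * x₃ / dynDen x₂ y₂ x₃ y₃) =
      (x₂ + y₂ * (x₂ + x₃)) * dynNumR x₁ y₁ x₂ y₂ x₃ y₃ / dynDen x₂ y₂ x₃ y₃ := by
    rw [dynDen, h1, dynNumR]
    field_simp
  have h2 : x₁ * (y₂ * y₃ * x₃ / dynDen x₂ y₂ x₃ y₃) + x₁ + (x₂ + y₂ * (x₂ + x₃)) =
      (x₂ + y₂ * (x₂ + x₃)) * (x₁ * (1 + y₃) + dynDen x₂ y₂ x₃ y₃) / dynDen x₂ y₂ x₃ y₃ := by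
    have h : x₁ * (y₂ * y₃ * x₃ / dynDen x₂ y₂ x₃ y₃) + x₁ =
      x₁ * (1 + y₂ * y₃ * x₃ / dynDen x₂ y₂ x₃ y₃) := by ring
    rw [h, h1]
    field_simp
  refine ⟨Prod.ext ?_ ?_, Prod.ext ?_ ?_⟩
  · simp only [dyn]
  · simp only [dyn, hden]
    field_simp
  · simp only [dyn, h2]
    field_simp
  · simp only [dyn, hden]
    field_simp

theorem dyn_final_left {x₁ y₁ x₂ y₂ x₃ y₃ : ℚ} (h₁ : 0 < x₁ ∧ 0 < y₁) (h₂ : 0 < x₂ ∧ 0 < y₂)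
    (h₃ : 0 < x₃ ∧ 0 < y₃) :
    let p := dyn ((dyn (⟨(x₁, y₁), h₁⟩, ⟨(x₂, y₂), h₂⟩)).1,
      (dyn ((dyn (⟨(x₁, y₁), h₁⟩, ⟨(x₂, y₂), h₂⟩)).2, ⟨(x₃, y₃), h₃⟩)).1)
    p.1.1 = (x₁ + y₁ * (x₁ + (x₂ + y₂ * (x₂ + x₃))),
      y₁ * y₂ * y₃ * x₃ / dynNumR x₁ y₁ x₂ y₂ x₃ y₃) ∧
    p.2.1 = ((x₁ + y₁ * (x₁ + x₂)) * y₃ * x₃ / (x₂ * y₃ + x₂ + x₃),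
      x₂ * dynNumR x₁ y₁ x₂ y₂ x₃ y₃ / dynNumL x₁ y₁ x₂ y₂ x₃ y₃) := by
  obtain ⟨l1, -⟩ := dyn_stage_left h₁ h₂ h₃
  obtain ⟨hx₁, hy₁⟩ := h₁
  obtain ⟨hx₂, hy₂⟩ := h₂
  obtain ⟨hx₃, hy₃⟩ := h₃
  set p := (dyn ((dyn (⟨(x₁, y₁), hx₁, hy₁⟩, ⟨(x₂, y₂), hx₂, hy₂⟩)).2, ⟨(x₃, y₃), hx₃, hy₃⟩)).1
    with hp
  clear_value p
  -- The polynomial identities behind the simplification are recorded before the denominators become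
  -- opaque, so that `field_simp` only meets small expressions. `eW` and `eP` factor one plus a
  -- second coordinate; `e1`, `e2` and `e3` produce the cancellations in the new denominators and in
  -- the first entry.
  have eW : dynNumL x₁ y₁ x₂ y₂ x₃ y₃ + dynDen x₁ y₁ x₂ y₂ * y₃ * x₃ =
      (1 + y₃) * (x₁ * x₂ * y₂ * (1 + y₁) + x₃ * dynDen x₁ y₁ x₂ y₂) := by
    simp only [dynNumL]
    ring
  have eP : dynDen x₁ y₁ x₂ y₂ + y₁ * y₂ * x₂ = (1 + y₂) * (x₁ + y₁ * (x₁ + x₂)) := by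
    simp only [dynDen]
    ring
  have e1 : y₁ * y₂ * dynNumL x₁ y₁ x₂ y₂ x₃ y₃ +
      (x₁ + y₁ * (x₁ + x₂)) ^ 2 * (1 + y₂) * (1 + y₃) =
      dynDen x₁ y₁ x₂ y₂ * dynNumR x₁ y₁ x₂ y₂ x₃ y₃ := by
    simp only [dynNumL, dynNumR, dynDen]
    ring
  have e2 : (x₁ + y₁ * (x₁ + x₂)) * (1 + y₃) * x₂ + dynNumL x₁ y₁ x₂ y₂ x₃ y₃ =
      dynDen x₁ y₁ x₂ y₂ * (x₂ * y₃ + x₂ + x₃) := by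
    simp only [dynNumL, dynDen]
    ring
  have e3 : x₁ * dynDen x₁ y₁ x₂ y₂ + y₁ * (x₁ * dynDen x₁ y₁ x₂ y₂ +
      (x₂ * dynDen x₁ y₁ x₂ y₂)) + y₁ * y₂ * x₂ * (x₁ + y₁ * (x₁ + x₂)) + y₁ * y₂ *
        (x₁ * x₂ * y₂ * (1 + y₁) + x₃ * dynDen x₁ y₁ x₂ y₂) =
      (x₁ + y₁ * (x₁ + (x₂ + y₂ * (x₂ + x₃)))) * dynDen x₁ y₁ x₂ y₂ := by
    simp only [dynDen]
    ring
  have hD : 0 < dynDen x₁ y₁ x₂ y₂ := by simp only [dynDen]; positivity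
  have hN : 0 < dynNumL x₁ y₁ x₂ y₂ x₃ y₃ := by simp only [dynNumL]; positivity
  have hN' : 0 < dynNumR x₁ y₁ x₂ y₂ x₃ y₃ := by simp only [dynNumR, dynDen]; positivity
  generalize hDe : dynDen x₁ y₁ x₂ y₂ = D at *
  generalize dynNumL x₁ y₁ x₂ y₂ x₃ y₃ = N at *
  generalize dynNumR x₁ y₁ x₂ y₂ x₃ y₃ = N' at *
  have hW : 0 < x₁ * x₂ * y₂ * (1 + y₁) + x₃ * D := by positivity
  have hP : 0 < x₁ + y₁ * (x₁ + x₂) := by positivity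
  generalize x₁ * x₂ * y₂ * (1 + y₁) + x₃ * D = W at *
  have hden : dynDen (x₁ + y₁ * (x₁ + x₂)) (y₁ * y₂ * x₂ / D) (W / x₂) (D * y₃ * x₃ / N) =
      W * N' / N := by
    have a1 : 1 + y₁ * y₂ * x₂ / D = (1 + y₂) * (x₁ + y₁ * (x₁ + x₂)) / D := by
      rw [← eP]; field_simp
    have a2 : 1 + D * y₃ * x₃ / N = (1 + y₃) * W / N := by
      rw [← eW]; field_simp
    rw [dynDen, a1, a2]
    field_simp
    linear_combination e1
  refine ⟨Prod.ext ?_ ?_, Prod.ext ?_ ?_⟩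
  · simp only [dyn, l1, hDe]
    field_simp
    linear_combination e3
  · simp only [dyn, l1, hDe, hden]
    field_simp
  · have a3 : (x₁ + y₁ * (x₁ + x₂)) * (D * y₃ * x₃ / N) + (x₁ + y₁ * (x₁ + x₂)) + W / x₂ =
        W * D * (x₂ * y₃ + x₂ + x₃) / (N * x₂) := by
      have a2 : (x₁ + y₁ * (x₁ + x₂)) * (D * y₃ * x₃ / N) + (x₁ + y₁ * (x₁ + x₂)) =
          (x₁ + y₁ * (x₁ + x₂)) * ((1 + y₃) * W) / N := by
        rw [← eW]; field_simp; ring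
      rw [a2]
      field_simp
      linear_combination e2
    simp only [dyn, l1, a3]
    field_simp
  · simp only [dyn, l1, hDe, hden]
    field_simp

theorem dyn_final_right {x₁ y₁ x₂ y₂ x₃ y₃ : ℚ} (h₁ : 0 < x₁ ∧ 0 < y₁) (h₂ : 0 < x₂ ∧ 0 < y₂)
    (h₃ : 0 < x₃ ∧ 0 < y₃) :
    let p := dyn ((dyn (⟨(x₁, y₁), h₁⟩, (dyn (⟨(x₂, y₂), h₂⟩, ⟨(x₃, y₃), h₃⟩)).1)).2,
      (dyn (⟨(x₂, y₂), h₂⟩, ⟨(x₃, y₃), h₃⟩)).2)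
    p.1.1 = ((x₁ + y₁ * (x₁ + x₂)) * y₃ * x₃ / (x₂ * y₃ + x₂ + x₃),
      x₂ * dynNumR x₁ y₁ x₂ y₂ x₃ y₃ / dynNumL x₁ y₁ x₂ y₂ x₃ y₃) ∧
    p.2.1 = (x₁ * x₂ * y₂ * x₃ * y₃ / (x₁ * x₂ * y₂ * (1 + y₃) + x₃ * (x₁ * y₂ + x₁ + x₂)),
      dynNumL x₁ y₁ x₂ y₂ x₃ y₃ / (x₂ * x₃)) := by
  obtain ⟨-, r2⟩ := dyn_stage_right h₁ h₂ h₃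
  obtain ⟨hx₁, hy₁⟩ := h₁
  obtain ⟨hx₂, hy₂⟩ := h₂
  obtain ⟨hx₃, hy₃⟩ := h₃
  set p := (dyn (⟨(x₁, y₁), hx₁, hy₁⟩, (dyn (⟨(x₂, y₂), hx₂, hy₂⟩, ⟨(x₃, y₃), hx₃, hy₃⟩)).1)).2
    with hp
  clear_value p
  have e0 : x₃ + dynDen x₂ y₂ x₃ y₃ = (x₂ * y₃ + x₂ + x₃) * (1 + y₂) := by
    simp only [dynDen]
    ring
  have e1 : dynNumR x₁ y₁ x₂ y₂ x₃ y₃ + dynDen x₂ y₂ x₃ y₃ =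
      (1 + y₁) * (x₁ * (1 + y₃) + dynDen x₂ y₂ x₃ y₃) := by
    simp only [dynNumR]
    ring
  have e2 : dynNumR x₁ y₁ x₂ y₂ x₃ y₃ * x₂ * x₃ +
      x₁ * y₂ * (1 + y₁) * (1 + y₂) * (x₂ * y₃ + x₂ + x₃) ^ 2 =
      dynDen x₂ y₂ x₃ y₃ * dynNumL x₁ y₁ x₂ y₂ x₃ y₃ := by
    simp only [dynNumL, dynNumR, dynDen]
    ring
  have e3 : x₁ * y₂ * (1 + y₁) * (x₂ * y₃ + x₂ + x₃) + dynNumR x₁ y₁ x₂ y₂ x₃ y₃ * x₂ =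
      dynDen x₂ y₂ x₃ y₃ * (x₁ + y₁ * (x₁ + x₂)) := by
    simp only [dynNumR, dynDen]
    ring
  have e4 : x₁ * y₂ * (1 + y₂) * (x₂ * y₃ + x₂ + x₃) ^ 2 +
      x₂ * x₃ * (x₁ * (1 + y₃) + dynDen x₂ y₂ x₃ y₃) =
      dynDen x₂ y₂ x₃ y₃ * (x₁ * x₂ * y₂ * (1 + y₃) + x₃ * (x₁ * y₂ + x₁ + x₂)) := by
    simp only [dynDen]
    ring
  have hD : 0 < dynDen x₂ y₂ x₃ y₃ := by simp only [dynDen]; positivity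
  have hN : 0 < dynNumL x₁ y₁ x₂ y₂ x₃ y₃ := by simp only [dynNumL, dynDen]; positivity
  have hN' : 0 < dynNumR x₁ y₁ x₂ y₂ x₃ y₃ := by simp only [dynNumR]; positivity
  generalize hDe : dynDen x₂ y₂ x₃ y₃ = D at *
  generalize dynNumL x₁ y₁ x₂ y₂ x₃ y₃ = N at *
  generalize dynNumR x₁ y₁ x₂ y₂ x₃ y₃ = N' at *
  have hL : 0 < x₁ * (1 + y₃) + D := by positivity
  have hE : 0 < x₂ * y₃ + x₂ + x₃ := by positivity
  generalize x₁ * (1 + y₃) + D = L at *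
  generalize hEe : x₂ * y₃ + x₂ + x₃ = E at *
  have a1 : 1 + D / x₃ = E * (1 + y₂) / x₃ := by rw [← e0]; field_simp
  have a2 : 1 + N' / D = (1 + y₁) * L / D := by rw [← e1]; field_simp; ring
  have hden : dynDen (x₁ * y₂ * y₃ * x₃ / L) (N' / D) (x₂ * x₃ * y₃ / E) (D / x₃) =
      y₃ * N / E := by
    rw [dynDen, a1, a2]
    field_simp
    linear_combination e2
  refine ⟨Prod.ext ?_ ?_, Prod.ext ?_ ?_⟩
  · have h : x₁ * y₂ * y₃ * x₃ / L + N' / D * (x₁ * y₂ * y₃ * x₃ / L + x₂ * x₃ * y₃ / E) =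
        x₁ * y₂ * y₃ * x₃ / L * (1 + N' / D) + N' / D * (x₂ * x₃ * y₃ / E) := by ring
    simp only [dyn, r2, hDe, hEe]
    rw [h, a2]
    field_simp
    linear_combination e3
  · simp only [dyn, r2, hDe, hEe, hden]
    field_simp
  · have h : x₁ * y₂ * y₃ * x₃ / L * (D / x₃) + x₁ * y₂ * y₃ * x₃ / L + x₂ * x₃ * y₃ / E =
        y₃ * (D * (x₁ * x₂ * y₂ * (1 + y₃) + x₃ * (x₁ * y₂ + x₁ + x₂))) / (L * E) := by
      rw [← e4, show x₁ * y₂ * y₃ * x₃ / L * (D / x₃) + x₁ * y₂ * y₃ * x₃ / L =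
        x₁ * y₂ * y₃ * x₃ / L * (1 + D / x₃) by ring, a1]
      field_simp
    simp only [dyn, r2, hDe, hEe, h]
    field_simp
  · simp only [dyn, r2, hDe, hEe, hden]
    field_simp

theorem dyn_braid_left (a b c : PosPair) :
    dyn ((dyn (a, b)).1, (dyn ((dyn (a, b)).2, c)).1) = ((dyn (a, (dyn (b, c)).1)).1,
      (dyn ((dyn (a, (dyn (b, c)).1)).2, (dyn (b, c)).2)).1) :=
  Prod.ext
    (Subtype.ext ((dyn_final_left a.2 b.2 c.2).1.trans (dyn_stage_right a.2 b.2 c.2).1.symm))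
    (Subtype.ext ((dyn_final_left a.2 b.2 c.2).2.trans (dyn_final_right a.2 b.2 c.2).1.symm))

theorem dyn_braid_right (a b c : PosPair) :
    (dyn ((dyn (a, b)).2, c)).2 = (dyn ((dyn (a, (dyn (b, c)).1)).2, (dyn (b, c)).2)).2 :=
  Subtype.ext ((dyn_stage_left a.2 b.2 c.2).2.trans (dyn_final_right a.2 b.2 c.2).2.symm)

/-! ### Positive braids are nontrivial -/

/-- Dynnikov's action. -/
def dynAct : BraidInf →* Equiv.Perm (ℕ → PosPair) :=
  lift (stepPerm dynEquiv) (isArtin_stepPerm dynEquiv dyn_braid_left dyn_braid_right)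

theorem dynAct_of_mem_tail {k : ℕ} {b : BraidInf} (hb : b ∈ tail k) (v : ℕ → PosPair) :
    dynAct b v k = v k := by
  induction hb using Subgroup.closure_induction generalizing v with
  | mem x hx =>
    obtain ⟨i, hi, rfl⟩ := hx
    have hi : k < i := hi
    rw [dynAct, lift_gen, stepPerm_apply, if_neg (by omega), if_neg (by omega)]
  | one => simp
  | mul x y _ _ hx hy => rw [map_mul, Equiv.Perm.mul_apply, hx, hy]
  | inv x _ hx =>
    have h := hx (dynAct x⁻¹ v)
    rwa [← Equiv.Perm.mul_apply, ← map_mul, mul_inv_cancel, map_one, Equiv.Perm.one_apply,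
      eq_comm] at h

theorem lt_dynAct_gen (k : ℕ) (v : ℕ → PosPair) : (v k).1.1 < (dynAct (gen k) v k).1.1 := by
  rw [dynAct, lift_gen, stepPerm_apply, if_pos rfl]
  change _ < (v k).1.1 + (v k).1.2 * ((v k).1.1 + (v (k + 1)).1.1)
  have h1 := (v k).2.1
  have h2 := (v k).2.2
  have h3 := (v (k + 1)).2.1
  have : 0 < (v k).1.2 * ((v k).1.1 + (v (k + 1)).1.1) := by positivity
  linarith

theorem le_dynAct_of_mem_nonneg {k : ℕ} {b : BraidInf} (hb : b ∈ nonneg k) (v : ℕ → PosPair) :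
    (v k).1.1 ≤ (dynAct b v k).1.1 := by
  induction hb using Submonoid.closure_induction generalizing v with
  | mem x hx =>
    rcases hx with rfl | hx
    · exact (lt_dynAct_gen k v).le
    · rw [dynAct_of_mem_tail hx]
  | one => simp
  | mul x y _ _ hx hy =>
    rw [map_mul, Equiv.Perm.mul_apply]
    exact (hy v).trans (hx _)

/-- The first coordinate of entry `k` is fixed by the braids that avoid the first `k + 1` strands
and strictly increased by `gen k`. A braid that is positive at `k` therefore moves every sequence.
-/
theorem not_pos_one : ¬ Pos 1 := by
  rintro ⟨k, x, hx, y, hy, h⟩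
  let v : ℕ → PosPair := fun _ => ⟨(1, 1), one_pos, one_pos⟩
  have h1 := le_dynAct_of_mem_nonneg hy v
  have h2 := lt_dynAct_gen k (dynAct y v)
  have h3 := le_dynAct_of_mem_nonneg hx (dynAct (gen k) (dynAct y v))
  have h4 : dynAct x (dynAct (gen k) (dynAct y v)) = v := by
    rw [← Equiv.Perm.mul_apply, ← Equiv.Perm.mul_apply, ← map_mul, ← map_mul, ← h, map_one,
      Equiv.Perm.one_apply]
  rw [h4] at h3
  linarith

end BraidInf

/-! ## Terms modulo left self-distributivity -/

/-- Terms in one variable and one binary operation. -/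
inductive LDTerm : Type
  | var : LDTerm
  | mul (a b : LDTerm) : LDTerm

namespace LDTerm

/-- One application of left self-distributivity, in the expanding direction. -/
inductive Step : LDTerm → LDTerm → Prop
  | distrib (a b c : LDTerm) : Step (mul a (mul b c)) (mul (mul a b) (mul a c))
  | left {a a' : LDTerm} (b : LDTerm) : Step a a' → Step (mul a b) (mul a' b)
  | right (a : LDTerm) {b b' : LDTerm} : Step b b' → Step (mul a b) (mul a b')

/-- Expansions: finitely many applications of left self-distributivity. -/
abbrev Expands : LDTerm → LDTerm → Prop := Relation.ReflTransGen Step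

theorem Expands.mul {a a' b b' : LDTerm} (h : Expands a a') (h' : Expands b b') :
    Expands (mul a b) (mul a' b') :=
  (Relation.ReflTransGen.lift (p := Step) (fun x => LDTerm.mul x b) (fun _ _ s => Step.left b s) _ _ h).trans
    (Relation.ReflTransGen.lift (LDTerm.mul a') (fun _ _ s => Step.right a' s) _ _ h')

/-- The term `a` distributed to all leaves of a term. -/
def dist (a : LDTerm) : LDTerm → LDTerm
  | var => mul a var
  | mul b c => mul (dist a b) (dist a c)

/-- The common expansion of all one-step expansions of a term. -/
def full : LDTerm → LDTerm
  | var => var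
  | mul a b => dist (full a) (full b)

theorem expands_dist (a b : LDTerm) : Expands (mul a b) (dist a b) := by
  induction b with
  | var => exact .refl
  | mul b c hb hc => exact .head (.distrib a b c) (hb.mul hc)

theorem expands_full (a : LDTerm) : Expands a (full a) := by
  induction a with
  | var => exact .refl
  | mul a b ha hb => exact (ha.mul hb).trans (expands_dist _ _)

theorem Expands.dist_left {a a' : LDTerm} (h : Expands a a') (b : LDTerm) :
    Expands (dist a b) (dist a' b) := by
  induction b with
  | var => exact h.mul .refl
  | mul b c hb hc => exact hb.mul hc

theorem Step.dist_right (a : LDTerm) {b b' : LDTerm} (h : Step b b') :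
    Step (dist a b) (dist a b') := by
  induction h with
  | distrib b c d => exact .distrib _ _ _
  | left c _ ih => exact .left _ ih
  | right c _ ih => exact .right _ ih

theorem Expands.dist {a a' b b' : LDTerm} (h : Expands a a') (h' : Expands b b') :
    Expands (dist a b) (dist a' b') :=
  (h.dist_left b).trans
    (Relation.ReflTransGen.lift (LDTerm.dist a') (fun _ _ s => Step.dist_right a' s) _ _ h')

theorem expands_dist_dist (a b c : LDTerm) :
    Expands (dist a (dist b c)) (dist (dist a b) (dist a c)) := by
  induction c with
  | var => exact expands_dist _ _
  | mul c d hc hd => exact hc.mul hd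

/-- `full` carries out all distributions at once, so whatever is reached in one step can still be
expanded to it. Together with monotonicity of `full` this bounds every expansion by an iterate of
`full`, which gives confluence. -/
theorem Step.expands_full {a b : LDTerm} (h : Step a b) : Expands b (full a) := by
  induction h with
  | distrib a b c =>
    refine (Expands.mul ((a.expands_full.mul b.expands_full).trans (expands_dist _ _))
      ((a.expands_full.mul c.expands_full).trans (expands_dist _ _))).trans ?_
    exact Expands.dist (b := .mul b.full c.full) .refl (expands_dist _ _)
  | left b _ ih => exact (ih.mul b.expands_full).trans (expands_dist _ _)
  | right a _ ih => exact (a.expands_full.mul ih).trans (expands_dist _ _)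

theorem Step.full_expands_full {a b : LDTerm} (h : Step a b) : Expands (full a) (full b) := by
  induction h with
  | distrib a b c => exact expands_dist_dist _ _ _
  | left b _ ih => exact ih.dist .refl
  | right a _ ih => exact Expands.dist .refl ih

theorem Expands.full {a b : LDTerm} (h : Expands a b) : Expands (full a) (full b) := by
  induction h with
  | refl => exact .refl
  | tail _ s ih => exact ih.trans s.full_expands_full

theorem Expands.exists_iterate {a b : LDTerm} (h : Expands a b) :
    ∃ k, ∀ l, k ≤ l → Expands b (LDTerm.full^[l] a) := by
  induction h with
  | refl =>
    refine ⟨0, fun l _ => ?_⟩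
    induction l with
    | zero => exact .refl
    | succ l ih =>
      rw [Function.iterate_succ_apply']
      exact (ih (Nat.zero_le _)).trans (LDTerm.expands_full _)
  | tail _ s ih =>
    obtain ⟨k, hk⟩ := ih
    refine ⟨k + 1, fun l hl => ?_⟩
    obtain ⟨l, rfl⟩ := Nat.exists_eq_add_of_le' (show 1 ≤ l by omega)
    rw [Function.iterate_succ_apply']
    exact s.expands_full.trans (hk l (by omega)).full

theorem Expands.confluent {a b c : LDTerm} (h : Expands a b) (h' : Expands a c) :
    ∃ d, Expands b d ∧ Expands c d := by
  obtain ⟨k, hk⟩ := h.exists_iterate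
  obtain ⟨l, hl⟩ := h'.exists_iterate
  exact ⟨_, hk _ (le_max_left k l), hl _ (le_max_right k l)⟩

/-- Two terms are equivalent if they have a common expansion. -/
def Equiv (a b : LDTerm) : Prop := ∃ c, Expands a c ∧ Expands b c

theorem Equiv.trans {a b c : LDTerm} (h : Equiv a b) (h' : Equiv b c) : Equiv a c := by
  obtain ⟨d, h1, h2⟩ := h
  obtain ⟨e, h3, h4⟩ := h'
  obtain ⟨f, h5, h6⟩ := h2.confluent h3
  exact ⟨f, h1.trans h5, h4.trans h6⟩

theorem Equiv.symm {a b : LDTerm} (h : Equiv a b) : Equiv b a := by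
  obtain ⟨c, h1, h2⟩ := h
  exact ⟨c, h2, h1⟩

theorem Equiv.mul {a a' b b' : LDTerm} (h : Equiv a a') (h' : Equiv b b') :
    Equiv (mul a b) (mul a' b') := by
  obtain ⟨c, h1, h2⟩ := h
  obtain ⟨d, h3, h4⟩ := h'
  exact ⟨_, h1.mul h3, h2.mul h4⟩

theorem Equiv.refl (a : LDTerm) : Equiv a a := ⟨a, .refl, .refl⟩

/-! ### Right powers, left subterms and the comparison property -/

/-- The right powers of the variable. -/
def power : ℕ → LDTerm
  | 0 => var
  | n + 1 => mul var (power n)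

/-- Long right powers absorb any factor on their left. For a product, with `x_l` the term `power l`:
`(ab)x_{l+1} ≡ (ab)(a x_l) ≡ a(b x_l) ≡ a x_{l+1} ≡ x_{l+2}`. Each product costs one extra power. -/
theorem exists_mul_power (a : LDTerm) : ∃ k, ∀ l, k ≤ l → Equiv (mul a (power l)) (power (l + 1)) := by
  induction a with
  | var => exact ⟨0, fun l _ => .refl _⟩
  | mul a b ha hb =>
    obtain ⟨k, hk⟩ := ha
    obtain ⟨k', hk'⟩ := hb
    refine ⟨max k k' + 1, fun l hl => ?_⟩
    obtain ⟨l, rfl⟩ := Nat.exists_eq_add_of_le' (show 1 ≤ l by omega)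
    have h1 := (Equiv.refl (mul a b)).mul (hk l (by omega)).symm
    have h2 : Equiv (mul (mul a b) (mul a (power l))) (mul a (mul b (power l))) :=
      ⟨_, .refl, .single (.distrib _ _ _)⟩
    have h3 := (Equiv.refl a).mul (hk' l (by omega))
    exact ((h1.trans h2).trans h3).trans (hk (l + 1) (by omega))

/-- The subterms of a term on its left branch. -/
inductive LeftSub (a : LDTerm) : LDTerm → Prop
  | refl : LeftSub a a
  | mul {b : LDTerm} (c : LDTerm) : LeftSub a b → LeftSub a (mul b c)

/-- A distribution at the root only pushes the old left branch one level deeper. A step elsewhere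
either expands a term on the left branch or leaves the chosen subterm untouched. -/
theorem LeftSub.step {a b b' : LDTerm} (h : LeftSub a b) (s : Step b b') :
    ∃ a', Expands a a' ∧ LeftSub a' b' := by
  induction s generalizing a with
  | distrib b c d =>
    cases h with
    | refl => exact ⟨_, .single (.distrib _ _ _), .refl⟩
    | mul _ h => exact ⟨a, .refl, .mul _ (.mul _ h)⟩
  | left c s ih =>
    cases h with
    | refl => exact ⟨_, .single (.left c s), .refl⟩
    | mul _ h =>
      obtain ⟨a', h1, h2⟩ := ih h
      exact ⟨a', h1, .mul _ h2⟩
  | right b s ih =>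
    cases h with
    | refl => exact ⟨_, .single (.right b s), .refl⟩
    | mul _ h => exact ⟨a, .refl, .mul _ h⟩

theorem LeftSub.expands {a b b' : LDTerm} (h : LeftSub a b) (s : Expands b b') :
    ∃ a', Expands a a' ∧ LeftSub a' b' := by
  induction s with
  | refl => exact ⟨a, .refl, h⟩
  | tail _ s ih =>
    obtain ⟨a', h1, h2⟩ := ih
    obtain ⟨a'', h3, h4⟩ := h2.step s
    exact ⟨a'', h1.trans h3, h4⟩

theorem LeftSub.comparable {a b c : LDTerm} (h : LeftSub a c) (h' : LeftSub b c) :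
    LeftSub a b ∨ LeftSub b a := by
  induction h with
  | refl => exact Or.inr h'
  | mul d h ih =>
    cases h' with
    | refl => exact Or.inl (.mul _ h)
    | mul _ h' => exact ih h'

/-- Up to expansion, any two terms are left subterms of each other. -/
theorem comparison (a b : LDTerm) :
    ∃ a' b', Expands a a' ∧ Expands b b' ∧ (LeftSub a' b' ∨ LeftSub b' a') := by
  obtain ⟨k, hk⟩ := exists_mul_power a
  obtain ⟨k', hk'⟩ := exists_mul_power b
  -- Multiplied by the same long right power, `a` and `b` become equivalent to one and the same
  -- right power. In a common expansion `c` of the two products, expansions of both `a` and `b` lie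
  -- on the left branch of `c`, and subterms on one branch are nested.
  obtain ⟨c, h1, h2⟩ := (hk _ (le_max_left k k')).trans (hk' _ (le_max_right k k')).symm
  obtain ⟨a', h3, h4⟩ := (LeftSub.mul _ (.refl (a := a))).expands h1
  obtain ⟨b', h5, h6⟩ := (LeftSub.mul _ (.refl (a := b))).expands h2
  exact ⟨a', b', h3, h5, h4.comparable h6⟩

end LDTerm

namespace BraidInf

/-! ## Every braid is positive, trivial or negative -/

/-- The shift `gen i ↦ gen (i + 1)`. -/
def shift : BraidInf →* BraidInf :=
  lift (fun i => gen (i + 1))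
    (fun _ => ⟨fun _ _ h => gen_comm (by omega), fun i _ => gen_braid (i + 1)⟩)

theorem shift_gen (i : ℕ) : shift (gen i) = gen (i + 1) := lift_gen _ _ _

theorem shift_mem_tail (b : BraidInf) : shift b ∈ tail 0 := by
  induction b using induction with
  | one => rw [map_one]; exact one_mem _
  | gen_mul i b ih =>
    rw [map_mul, shift_gen]
    exact mul_mem (gen_mem_tail (by omega)) ih
  | inv_gen_mul i b ih =>
    rw [map_mul, map_inv, shift_gen]
    exact mul_mem (inv_mem (gen_mem_tail (by omega))) ih

theorem shift_mem_tail_succ {k : ℕ} {b : BraidInf} (hb : b ∈ tail k) : shift b ∈ tail (k + 1) := by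
  induction hb using Subgroup.closure_induction with
  | mem x hx =>
    obtain ⟨i, hi, rfl⟩ := hx
    have hi : k < i := hi
    rw [shift_gen]
    exact gen_mem_tail (by omega)
  | one => rw [map_one]; exact one_mem _
  | mul x y _ _ hx hy => rw [map_mul]; exact mul_mem hx hy
  | inv x _ hx => rw [map_inv]; exact inv_mem hx

theorem shift_mem_nonneg {k : ℕ} {b : BraidInf} (hb : b ∈ nonneg k) :
    shift b ∈ nonneg (k + 1) := by
  induction hb using Submonoid.closure_induction with
  | mem x hx =>
    rcases hx with rfl | hx
    · rw [shift_gen]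
      exact gen_mem_nonneg _
    · exact tail_le_nonneg _ (shift_mem_tail_succ hx)
  | one => rw [map_one]; exact one_mem _
  | mul x y _ _ hx hy => rw [map_mul]; exact mul_mem hx hy

theorem Pos.shift {b : BraidInf} (hb : Pos b) : Pos (shift b) := by
  obtain ⟨k, x, hx, y, hy, rfl⟩ := hb
  exact ⟨k + 1, _, shift_mem_nonneg hx, _, shift_mem_nonneg hy, by simp [shift_gen]⟩

theorem commute_gen_shift_shift (b : BraidInf) : Commute (gen 0) (shift (shift b)) := by
  induction b using induction with
  | one => simp
  | gen_mul i b ih =>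
    rw [map_mul, map_mul, shift_gen, shift_gen]
    exact (gen_comm (by omega)).mul_right ih
  | inv_gen_mul i b ih =>
    rw [map_mul, map_mul, map_inv, map_inv, shift_gen, shift_gen]
    exact (gen_comm (by omega)).inv_right.mul_right ih

/-- Dehornoy's bracket. -/
def bracket (a b : BraidInf) : BraidInf := a * shift b * gen 0 * (shift a)⁻¹

/-- Both sides equal `a sh(b) sh²(c) σ₁ σ₀ sh²(b)⁻¹ sh(a)⁻¹`, with `sh` the shift and `σᵢ` the
crossing `gen i`. Only the relation `σ₀σ₁σ₀ = σ₁σ₀σ₁` and the commutation of `σ₀` with doubly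
shifted braids are used. -/
theorem bracket_distrib (a b c : BraidInf) :
    bracket a (bracket b c) = bracket (bracket a b) (bracket a c) := by
  have h1 := (commute_gen_shift_shift c).eq
  have h2 := (commute_gen_shift_shift a).inv_right.eq
  have h3 := (commute_gen_shift_shift b).inv_right.eq
  have h4 : gen 0 * gen 1 * gen 0 * (gen 1)⁻¹ = gen 1 * gen 0 := by
    rw [mul_inv_eq_iff_eq_mul, gen_braid 0]
  simp only [bracket, map_mul, map_inv, shift_gen, zero_add, mul_inv_rev, inv_inv]
  calc a * (shift b * shift (shift c) * gen 1 * (shift (shift b))⁻¹) * gen 0 * (shift a)⁻¹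
      = a * shift b * shift (shift c) * gen 1 * ((shift (shift b))⁻¹ * gen 0) * (shift a)⁻¹ := by
        group
    _ = a * shift b * shift (shift c) * (gen 1 * gen 0) * (shift (shift b))⁻¹ * (shift a)⁻¹ := by
        rw [← h3]; group
    _ = a * shift b * (shift (shift c) * gen 0) * gen 1 * gen 0 * (gen 1)⁻¹ *
          (shift (shift b))⁻¹ * (shift a)⁻¹ := by
        rw [← h4]; group
    _ = a * shift b * gen 0 * shift (shift c) * gen 1 * ((shift (shift a))⁻¹ *
          shift (shift a)) * gen 0 * (gen 1)⁻¹ * (shift (shift b))⁻¹ * (shift a)⁻¹ := by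
        rw [← h1]; group
    _ = a * shift b * gen 0 * shift (shift c) * gen 1 * (shift (shift a))⁻¹ *
          (gen 0 * shift (shift a)) * (gen 1)⁻¹ * (shift (shift b))⁻¹ * (shift a)⁻¹ := by
        rw [(commute_gen_shift_shift a).eq]; group
    _ = _ := by group

/-- The value of a term at the trivial braid for Dehornoy's bracket. -/
def eval : LDTerm → BraidInf
  | .var => 1
  | .mul a b => bracket (eval a) (eval b)

theorem eval_step {a b : LDTerm} (h : a.Step b) : eval a = eval b := by
  induction h with
  | distrib a b c => exact bracket_distrib _ _ _
  | left b _ ih => rw [eval, eval, ih]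
  | right a _ ih => rw [eval, eval, ih]

theorem eval_expands {a b : LDTerm} (h : a.Expands b) : eval a = eval b := by
  induction h with
  | refl => rfl
  | tail _ s ih => exact ih.trans (eval_step s)

theorem posAt_inv_mul_bracket (a b : BraidInf) : PosAt 0 (a⁻¹ * bracket a b) :=
  ⟨shift b, tail_le_nonneg _ (shift_mem_tail b), (shift a)⁻¹,
    tail_le_nonneg _ ((tail 0).inv_mem (shift_mem_tail a)), by rw [bracket]; group⟩

/-- Going up one node on the left branch multiplies the value on the right by `sh(b) σ₀ sh(a)⁻¹`, in
which `σ₀` occurs once and positively. -/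
theorem eval_leftSub {a b : LDTerm} (h : a.LeftSub b) :
    eval a = eval b ∨ PosAt 0 ((eval a)⁻¹ * eval b) := by
  induction h with
  | refl => exact Or.inl rfl
  | mul c h ih =>
    right
    rename_i b
    have h1 := posAt_inv_mul_bracket (eval b) (eval c)
    rcases ih with ih | ih
    · rw [ih]
      exact h1
    · rw [show (eval a)⁻¹ * eval (b.mul c) = ((eval a)⁻¹ * eval b) *
        ((eval b)⁻¹ * bracket (eval b) (eval c)) by rw [eval]; group]
      exact ih.mul_right h1.mem_nonneg

theorem eval_comparison (a b : LDTerm) :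
    eval a = eval b ∨ PosAt 0 ((eval a)⁻¹ * eval b) ∨ PosAt 0 ((eval b)⁻¹ * eval a) := by
  obtain ⟨a', b', h1, h2, h3⟩ := LDTerm.comparison a b
  rw [eval_expands h1, eval_expands h2]
  rcases h3 with h3 | h3
  · exact (eval_leftSub h3).imp id Or.inl
  · exact (eval_leftSub h3).imp Eq.symm Or.inr

/-- The product `a₀ · sh(a₁) · sh²(a₂) ⋯` of the values of a list of terms. -/
def shiftProd : List LDTerm → BraidInf
  | [] => 1
  | a :: l => eval a * shift (shiftProd l)

/-- Terms colour the strands: the crossing `0` turns the colours `a, b` into `a[b], a`. Strands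
beyond the end of the list carry the colour `var`, whose value is `1`. -/
theorem exists_shiftProd_mul_gen (i : ℕ) (l : List LDTerm) :
    ∃ l', shiftProd l' = shiftProd l * gen i := by
  have key : ∀ (a b : LDTerm) (l : List LDTerm),
      shiftProd (.mul a b :: a :: l) = shiftProd (a :: b :: l) * gen 0 := fun a b l => by
    have h := (commute_gen_shift_shift (shiftProd l)).eq
    simp only [shiftProd, eval, bracket, map_mul, mul_assoc, inv_mul_cancel_left]
    rw [h]
  induction i generalizing l with
  | zero =>
    match l with
    | [] => exact ⟨_, (key .var .var []).trans (by simp [shiftProd, eval])⟩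
    | [a] => exact ⟨_, (key a .var []).trans (by simp [shiftProd, eval])⟩
    | a :: b :: l => exact ⟨_, key a b l⟩
  | succ i ih =>
    match l with
    | [] =>
      obtain ⟨l', h⟩ := ih []
      exact ⟨.var :: l', by simp only [shiftProd]; rw [h]; simp [shiftProd, eval, shift_gen]⟩
    | a :: l =>
      obtain ⟨l', h⟩ := ih l
      exact ⟨a :: l', by rw [shiftProd, h]; simp [shiftProd, shift_gen, mul_assoc]⟩

theorem exists_shiftProd {b : BraidInf} (hb : b ∈ Submonoid.closure (Set.range gen)) :
    ∃ l, shiftProd l = b := by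
  induction hb using Submonoid.closure_induction_right with
  | one => exact ⟨[], rfl⟩
  | mul_right x _ y hy ih =>
    obtain ⟨i, rfl⟩ := hy
    obtain ⟨l, rfl⟩ := ih
    exact exists_shiftProd_mul_gen i l

/-- The lists are compared lexicographically. Heads of equal value cancel and the quotient is a
shift of the quotient of the remaining lists. Heads of different values decide the sign at index
`0`, because the shifted factors around them do not involve `gen 0`. -/
theorem shiftProd_comparison (l l' : List LDTerm) :
    (shiftProd l)⁻¹ * shiftProd l' = 1 ∨ Pos ((shiftProd l)⁻¹ * shiftProd l') ∨
      Pos ((shiftProd l)⁻¹ * shiftProd l')⁻¹ := by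
  have key : ∀ (a b : LDTerm) (x y : BraidInf),
      (x⁻¹ * y = 1 ∨ Pos (x⁻¹ * y) ∨ Pos (x⁻¹ * y)⁻¹) →
      ((eval a * shift x)⁻¹ * (eval b * shift y) = 1 ∨
        Pos ((eval a * shift x)⁻¹ * (eval b * shift y)) ∨
        Pos ((eval a * shift x)⁻¹ * (eval b * shift y))⁻¹) := fun a b x y h => by
    rcases eval_comparison a b with hab | hab | hab
    · have e : (eval a * shift x)⁻¹ * (eval b * shift y) = shift (x⁻¹ * y) := by
        rw [hab, map_mul, map_inv]; group
      rw [e, ← map_inv]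
      rcases h with h | h | h
      · exact Or.inl (by rw [h, map_one])
      · exact Or.inr (Or.inl h.shift)
      · exact Or.inr (Or.inr h.shift)
    · refine Or.inr (Or.inl ⟨0, ?_⟩)
      have h1 := (hab.mul_left (tail_le_nonneg 0 ((tail 0).inv_mem (shift_mem_tail x)))).mul_right
        (tail_le_nonneg 0 (shift_mem_tail y))
      simpa [mul_assoc] using h1
    · refine Or.inr (Or.inr ⟨0, ?_⟩)
      have h1 := (hab.mul_left (tail_le_nonneg 0 ((tail 0).inv_mem (shift_mem_tail y)))).mul_right
        (tail_le_nonneg 0 (shift_mem_tail x))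
      simpa [mul_assoc] using h1
  induction l generalizing l' with
  | nil =>
    induction l' with
    | nil => simp [shiftProd]
    | cons b l' ih => simpa [shiftProd, eval] using key .var b 1 (shiftProd l') (by simpa [shiftProd] using ih)
  | cons a l ih =>
    match l' with
    | [] => simpa [shiftProd, eval] using key a .var (shiftProd l) 1 (by simpa [shiftProd] using ih [])
    | b :: l' => exact key a b _ _ (ih l')

/-! ### Every braid is a left fraction of positive braids -/

/-- Garside's half twist on `n + 1` strands. -/
def halfTwist : ℕ → BraidInf
  | 0 => 1
  | n + 1 => strandOver gen 0 (n + 1) * halfTwist n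

theorem commute_gen_halfTwist {n j : ℕ} (h : n < j) : Commute (gen j) (halfTwist n) := by
  induction n with
  | zero => exact Commute.one_right _
  | succ n ih =>
    exact ((isArtin_gen 0).commute_strandOver (by omega)).mul_right (ih (by omega))

theorem gen_succ_mul_strandOver {n j : ℕ} (h : j < n) :
    gen (j + 1) * strandOver gen 0 (n + 1) = strandOver gen 0 (n + 1) * gen j := by
  obtain ⟨c, rfl⟩ := Nat.exists_eq_add_of_le' (show 1 ≤ n by omega)
  obtain ⟨d, rfl⟩ := Nat.exists_eq_add_of_le (show j ≤ c by omega)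
  have h := (isArtin_gen (0 + j + 2 + d + 1)).strandOver_slide 0 j d (by omega)
  rwa [zero_add, show j + 2 + d = j + d + 1 + 1 by omega] at h

/-- Conjugation by the half twist reverses the order of the crossings. A crossing away from the
first strand slides through the outermost strand and is left to the induction; `gen 0` needs the two
outermost strands together. -/
theorem gen_mul_halfTwist {n i : ℕ} (h : i < n) :
    gen i * halfTwist n = halfTwist n * gen (n - 1 - i) := by
  induction n generalizing i with
  | zero => omega
  | succ n ih =>
    match i with
    | j + 1 =>
      rw [halfTwist, ← mul_assoc, gen_succ_mul_strandOver (by omega), mul_assoc, ih (by omega),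
        mul_assoc, show n + 1 - 1 - (j + 1) = n - 1 - j by omega]
    | 0 =>
      match n with
      | 0 => simp [halfTwist, strandOver]
      | m + 1 =>
        -- Write `S_q` for `strandOver gen 0 q`. Sliding one strand through another yields `σ₀
        -- S_{m+2} S_{m+1} = S_{m+2} S_{m+2}`. The last letter `gen (m + 1)` of the second factor
        -- commutes with the inner half twist and comes out on the right.
        have h1 := (isArtin_gen (m + 3)).strandOver_blockOver_slide 0 1 0 (m + 1) (m + 2)
          (by omega) (by omega)
        simp only [blockOver, one_mul, add_zero, zero_add] at h1
        have h2 : strandOver gen 0 (m + 2) = gen 0 * strandOver gen 1 (m + 1) := by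
          rw [add_comm (m + 1) 1, strandOver_add]
          simp [strandOver]
        have h3 := (commute_gen_halfTwist (show m < m + 1 by omega)).eq
        have h4 : strandOver gen 0 (m + 2) = strandOver gen 0 (m + 1) * gen (m + 1) := by
          rw [strandOver_succ, zero_add]
        simp only [halfTwist]
        rw [show m + 1 + 1 - 1 - 0 = m + 1 by omega]
        calc gen 0 * (strandOver gen 0 (m + 2) * (strandOver gen 0 (m + 1) * halfTwist m))
            = gen 0 * (strandOver gen 0 (m + 2) * strandOver gen 0 (m + 1)) * halfTwist m := by
              simp only [mul_assoc]
          _ = strandOver gen 0 (m + 2) * strandOver gen 0 (m + 2) * halfTwist m := by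
              rw [← h1, ← mul_assoc, ← h2]
          _ = strandOver gen 0 (m + 2) * (strandOver gen 0 (m + 1) *
                (gen (m + 1) * halfTwist m)) := by
              nth_rw 2 [h4]; simp only [mul_assoc]
          _ = _ := by rw [h3]; simp only [mul_assoc]

/-- The positive braids on `n + 1` strands. -/
def positives (n : ℕ) : Submonoid BraidInf := Submonoid.closure (gen '' {i | i < n})

theorem gen_mem_positives {n i : ℕ} (h : i < n) : gen i ∈ positives n :=
  Submonoid.subset_closure ⟨i, h, rfl⟩

theorem positives_mono {m n : ℕ} (h : m ≤ n) : positives m ≤ positives n :=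
  Submonoid.closure_mono (Set.image_mono fun _ hi => lt_of_lt_of_le hi h)

theorem positives_le (n : ℕ) : positives n ≤ Submonoid.closure (Set.range gen) :=
  Submonoid.closure_mono (Set.image_subset_range _ _)

theorem strandOver_mem_positives {j q n : ℕ} (h : j + q ≤ n) :
    strandOver gen j q ∈ positives n := by
  induction q with
  | zero => exact one_mem _
  | succ q ih => exact mul_mem (ih (by omega)) (gen_mem_positives (by omega))

theorem halfTwist_mem_positives (n : ℕ) : halfTwist n ∈ positives n := by
  induction n with
  | zero => exact one_mem _
  | succ n ih =>
    exact mul_mem (strandOver_mem_positives (by omega)) (positives_mono (by omega) ih)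

theorem exists_halfTwist_eq {n i : ℕ} (h : i < n) :
    ∃ q ∈ positives n, halfTwist n = gen i * q := by
  induction n generalizing i with
  | zero => omega
  | succ n ih =>
    match i with
    | 0 =>
      refine ⟨strandOver gen 1 n * halfTwist n, mul_mem (strandOver_mem_positives (by omega))
        (positives_mono (by omega) (halfTwist_mem_positives n)), ?_⟩
      rw [halfTwist, add_comm n 1, strandOver_add]
      simp [strandOver, mul_assoc]
    | j + 1 =>
      obtain ⟨q, hq, e⟩ := ih (show j < n by omega)
      refine ⟨strandOver gen 0 (n + 1) * q, mul_mem (strandOver_mem_positives (by omega))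
        (positives_mono (by omega) hq), ?_⟩
      rw [halfTwist, e, ← mul_assoc, ← mul_assoc, gen_succ_mul_strandOver (by omega)]

theorem halfTwist_mul_gen {n i : ℕ} (h : i < n) :
    halfTwist n * gen i = gen (n - 1 - i) * halfTwist n := by
  rw [gen_mul_halfTwist (show n - 1 - i < n by omega), show n - 1 - (n - 1 - i) = i by omega]

theorem halfTwist_conj_mem {n : ℕ} {p : BraidInf} (hp : p ∈ positives n) :
    halfTwist n * p * (halfTwist n)⁻¹ ∈ positives n := by
  induction hp using Submonoid.closure_induction with
  | mem x hx =>
    obtain ⟨i, hi, rfl⟩ := hx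
    have hi : i < n := hi
    rw [halfTwist_mul_gen hi, mul_inv_cancel_right]
    exact gen_mem_positives (by omega)
  | one => simp
  | mul x y _ _ hx hy =>
    rw [show halfTwist n * (x * y) * (halfTwist n)⁻¹ = halfTwist n * x * (halfTwist n)⁻¹ *
      (halfTwist n * y * (halfTwist n)⁻¹) by group]
    exact mul_mem hx hy

/-- Multiplying `p⁻¹q` on the left by `gen i` replaces `p` by `p σᵢ⁻¹`. Multiplying numerator and
denominator on the left by a half twist `Δ` clears the inverse, since `Δ p σᵢ⁻¹ = (Δ p Δ⁻¹)(Δ σᵢ⁻¹)`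
and both factors are positive. -/
theorem exists_positive_fraction (b : BraidInf) :
    ∃ n, ∃ p ∈ positives n, ∃ q ∈ positives n, b = p⁻¹ * q := by
  induction b using induction with
  | one => exact ⟨0, 1, one_mem _, 1, one_mem _, by simp⟩
  | inv_gen_mul i b ih =>
    obtain ⟨n, p, hp, q, hq, rfl⟩ := ih
    exact ⟨max n (i + 1), p * gen i,
      mul_mem (positives_mono (le_max_left _ _) hp) (gen_mem_positives (by omega)), q,
      positives_mono (le_max_left _ _) hq, by group⟩
  | gen_mul i b ih =>
    obtain ⟨n, p, hp, q, hq, rfl⟩ := ih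
    set N := max n (i + 1)
    have hi : i < N := by omega
    obtain ⟨r, hr, e⟩ := exists_halfTwist_eq (show N - 1 - i < N by omega)
    have e' : halfTwist N * (gen i)⁻¹ = r := by
      rw [mul_inv_eq_iff_eq_mul]
      apply mul_left_cancel (a := gen (N - 1 - i))
      rw [← halfTwist_mul_gen hi, ← mul_assoc, ← e]
    refine ⟨N, halfTwist N * p * (halfTwist N)⁻¹ * r,
      mul_mem (halfTwist_conj_mem (positives_mono (le_max_left _ _) hp)) hr, halfTwist N * q,
      mul_mem (halfTwist_mem_positives N) (positives_mono (le_max_left _ _) hq), ?_⟩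
    rw [← e']
    group

theorem pos_or_eq_one_or_pos_inv (b : BraidInf) : Pos b ∨ b = 1 ∨ Pos b⁻¹ := by
  obtain ⟨n, p, hp, q, hq, rfl⟩ := exists_positive_fraction b
  obtain ⟨l, rfl⟩ := exists_shiftProd (positives_le n hp)
  obtain ⟨l', rfl⟩ := exists_shiftProd (positives_le n hq)
  rcases shiftProd_comparison l l' with h | h | h
  · exact Or.inr (Or.inl h)
  · exact Or.inl h
  · exact Or.inr (Or.inr h)

end BraidInf

/-! ## Cabling with arbitrary multiplicities -/

theorem IsArtin.mono {H : Type w} [Group H] {s : ℕ → H} {m n : ℕ} (h : m ≤ n)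
    (hs : IsArtin s n) : IsArtin s m := ⟨hs.comm, fun i hi => hs.braid i (by omega)⟩

namespace Cabling

/-- Exchange the entries `i` and `i + 1` of a sequence. -/
def swap (c : ℕ → ℕ) (i x : ℕ) : ℕ :=
  if x = i then c (i + 1) else if x = i + 1 then c i else c x

/-- The sum of the first `k` entries. -/
def off (c : ℕ → ℕ) (k : ℕ) : ℕ := ∑ x ∈ Finset.range k, c x

theorem off_succ (c : ℕ → ℕ) (k : ℕ) : off c (k + 1) = off c k + c k :=
  Finset.sum_range_succ _ _

theorem off_mono (c : ℕ → ℕ) {a b : ℕ} (h : a ≤ b) : off c a ≤ off c b :=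
  Finset.sum_le_sum_of_subset (Finset.range_mono h)

theorem swap_left (c : ℕ → ℕ) (i : ℕ) : swap c i i = c (i + 1) := if_pos rfl

theorem swap_right (c : ℕ → ℕ) (i : ℕ) : swap c i (i + 1) = c i := by simp [swap]

theorem swap_of_ne (c : ℕ → ℕ) {i x : ℕ} (h : x ≠ i) (h' : x ≠ i + 1) : swap c i x = c x := by
  simp [swap, h, h']

theorem swap_swap (c : ℕ → ℕ) (i : ℕ) : swap (swap c i) i = c := by
  funext x
  unfold swap
  split_ifs <;> first | omega | simp_all

theorem off_swap_of_le (c : ℕ → ℕ) {i k : ℕ} (h : k ≤ i) : off (swap c i) k = off c k :=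
  Finset.sum_congr rfl fun x hx => by
    have := Finset.mem_range.1 hx
    exact swap_of_ne c (by omega) (by omega)

theorem off_swap (c : ℕ → ℕ) (i k : ℕ) (h : k ≠ i + 1) : off (swap c i) k = off c k := by
  rcases Nat.lt_or_ge i k with hk | hk
  · obtain ⟨d, rfl⟩ := Nat.exists_eq_add_of_le (show i + 2 ≤ k by omega)
    clear h hk
    induction d with
    | zero =>
      rw [add_zero, show i + 2 = i + 1 + 1 by omega, off_succ, off_succ, off_succ, off_succ,
        swap_left, swap_right, off_swap_of_le c le_rfl]
      omega
    | succ d ih =>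
      rw [← add_assoc, off_succ, off_succ, ih, swap_of_ne c (by omega) (by omega)]
  · exact off_swap_of_le c hk

variable {H : Type w} [Group H] (s : ℕ → H)

/-- Sequences of multiplicities whose total does not exceed the range of the Artin relations. -/
abbrev Mult : Type := {c : ℕ → ℕ // ∀ k, IsArtin s (off c k)}

variable {s}

theorem isArtin_off_swap {c : ℕ → ℕ} (hc : ∀ k, IsArtin s (off c k)) (i k : ℕ) :
    IsArtin s (off (swap c i) k) := by
  rcases eq_or_ne k (i + 1) with rfl | h
  · refine (hc (i + 1 + 1)).mono ?_
    rw [← off_swap c i (i + 1 + 1) (by omega)]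
    exact off_mono _ (by omega)
  · rw [off_swap c i k h]
    exact hc k

variable (s)

/-- The cabling of the crossing of the strands `i` and `i + 1`. -/
def block (c : ℕ → ℕ) (i : ℕ) : H := blockOver s (off c i) (c (i + 1)) (c i)

/-- The crossing `i` acts by exchanging two multiplicities and multiplying by the cabled
crossing. -/
def step (i : ℕ) : Equiv.Perm (Mult s × H) where
  toFun x := (⟨swap x.1.1 i, isArtin_off_swap x.1.2 i⟩, block s x.1.1 i * x.2)
  invFun x := (⟨swap x.1.1 i, isArtin_off_swap x.1.2 i⟩, (block s (swap x.1.1 i) i)⁻¹ * x.2)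
  left_inv x := Prod.ext (Subtype.ext (swap_swap _ _)) (by simp [swap_swap])
  right_inv x := Prod.ext (Subtype.ext (swap_swap _ _)) (by simp)

variable {s} in
theorem step_fst (i : ℕ) (x : Mult s × H) : (step s i x).1.1 = swap x.1.1 i := rfl

variable {s} in
theorem step_snd (i : ℕ) (x : Mult s × H) : (step s i x).2 = block s x.1.1 i * x.2 := rfl

/-- Disjoint blocks commute, and the braid relation is the Yang–Baxter equation for three block
crossings. The bound built into `Mult` guarantees that these blocks lie in the range where `s`
satisfies the braid relation. -/
theorem isArtin_step (n : ℕ) : IsArtin (step s) n where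
  comm i j hij := by
    refine Equiv.ext fun x => Prod.ext (Subtype.ext (funext fun k => ?_)) ?_
    · simp only [Equiv.Perm.mul_apply, step_fst]
      unfold swap
      split_ifs <;> first | rfl | omega
    · obtain ⟨⟨c, hc⟩, b⟩ := x
      simp only [Equiv.Perm.mul_apply, step_fst, step_snd, ← mul_assoc]
      congr 1
      unfold block
      rw [off_swap _ j i (by omega), off_swap _ i j (by omega),
        swap_of_ne _ (show i + 1 ≠ j by omega) (by omega),
        swap_of_ne _ (show i ≠ j by omega) (by omega),
        swap_of_ne _ (show j + 1 ≠ i by omega) (by omega),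
        swap_of_ne _ (show j ≠ i by omega) (by omega)]
      refine ((hc 0).blockOver_commute_blockOver ?_).eq
      have h := off_mono c (show i + 1 + 1 ≤ j by omega)
      simp only [off_succ] at h
      omega
  braid i _ := by
    refine Equiv.ext fun x => Prod.ext (Subtype.ext (funext fun k => ?_)) ?_
    · simp only [Equiv.Perm.mul_apply, step_fst]
      simp only [swap]
      by_cases h1 : k = i
      · subst h1; simp [show ¬ k + 1 + 1 = k by omega, show ¬ k = k + 1 + 1 by omega]
      by_cases h2 : k = i + 1
      · subst h2; simp [show ¬ i + 1 + 1 = i by omega, show ¬ i = i + 1 + 1 by omega]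
      by_cases h3 : k = i + 1 + 1
      · subst h3; simp [show ¬ i + 1 + 1 = i by omega, show ¬ i = i + 1 + 1 by omega]
      simp [h1, h2, h3]
    · obtain ⟨⟨c, hc⟩, b⟩ := x
      simp only [Equiv.Perm.mul_apply, step_fst, step_snd, ← mul_assoc]
      congr 1
      have h1 : ∀ c : ℕ → ℕ, swap c i (i + 1 + 1) = c (i + 1 + 1) := fun c =>
        swap_of_ne c (by omega) (by omega)
      have h2 : ∀ c : ℕ → ℕ, swap c (i + 1) i = c i := fun c =>
        swap_of_ne c (by omega) (by omega)
      unfold block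
      simp only [h1, h2, swap_left, swap_right,
        off_swap _ i i (by omega), off_swap _ (i + 1) i (by omega), off_succ]
      refine (hc (i + 1 + 1 + 1)).yangBaxter _ _ _ _ ?_
      rw [off_succ, off_succ, off_succ, show c (i + 2) = c (i + 1 + 1) from rfl]
      omega

/-- The action of `BraidInf` by cabling. -/
def act : BraidInf →* Equiv.Perm (Mult s × H) := BraidInf.lift (step s) (isArtin_step s)

theorem act_gen (i : ℕ) : act s (BraidInf.gen i) = step s i := BraidInf.lift_gen _ _ _

/-- The action multiplies the group component on the left, hence commutes with right multiplication
and is determined by its values at `1`. -/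
theorem act_mul_right (b : BraidInf) (c : Mult s) (x y : H) :
    act s b (c, x * y) = ((act s b (c, x)).1, (act s b (c, x)).2 * y) := by
  induction b using BraidInf.induction generalizing c x y with
  | one => simp
  | gen_mul i b ih => simp only [map_mul, Equiv.Perm.mul_apply, ih, act_gen, step, Equiv.coe_fn_mk,
      mul_assoc]
  | inv_gen_mul i b ih =>
    simp only [map_mul, Equiv.Perm.mul_apply, ih, map_inv]
    apply (act s (BraidInf.gen i)).injective
    have h : ∀ z, step s i ((step s i)⁻¹ z) = z := fun z => by
      rw [← Equiv.Perm.mul_apply, mul_inv_cancel, Equiv.Perm.one_apply]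
    rw [act_gen, h]
    conv_lhs => rw [← h (act s b (c, x))]
    refine Prod.ext rfl ?_
    rw [step_snd, step_snd, mul_assoc]

theorem act_apply (b : BraidInf) (c : Mult s) (x : H) :
    act s b (c, x) = ((act s b (c, 1)).1, (act s b (c, 1)).2 * x) := by
  rw [← act_mul_right, one_mul]

end Cabling

/-! ## Finite braids as infinite braids -/

section Inclusion

variable {m n : ℕ}

/-- The inclusion of the braids on `n` strands into the braids on infinitely many strands. -/
def toInf (n : ℕ) : Braid n →* BraidInf :=
  PresentedGroup.toGroup (f := fun i : Fin (n - 1) => BraidInf.gen i) (by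
    rintro r (⟨i, j, hij, rfl⟩ | ⟨i, j, hij, rfl⟩)
    · simp only [map_mul, map_inv, FreeGroup.lift_apply_of, mul_inv_eq_one]
      exact BraidInf.gen_comm hij
    · simp only [map_mul, map_inv, FreeGroup.lift_apply_of, mul_inv_eq_one]
      simp only [← hij]
      exact BraidInf.gen_braid i)

theorem toInf_of (i : Fin (n - 1)) : toInf n (PresentedGroup.of i) = BraidInf.gen i :=
  PresentedGroup.toGroup.of _

theorem toInf_crossing {i : ℕ} (h : i + 1 < n) : toInf n (crossing n i) = BraidInf.gen i := by
  rw [crossing, dif_pos (by omega), toInf_of]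

/-- One copy of each of the first `n` strands. -/
def firstStrands (n x : ℕ) : ℕ := if x < n then 1 else 0

theorem off_firstStrands (n k : ℕ) : Cabling.off (firstStrands n) k = min k n := by
  induction k with
  | zero => simp [Cabling.off]
  | succ k ih =>
    rw [Cabling.off_succ, ih, firstStrands]
    split_ifs <;> omega

/-- With one copy of each of the first `n` strands and none of the others, a finite braid acts by
left multiplication on the group component. -/
theorem act_toInf (b : Braid n) (x : Braid n)
    (hc : ∀ k, IsArtin (crossing n) (Cabling.off (firstStrands n) k)) :
    Cabling.act (crossing n) (toInf n b) (⟨firstStrands n, hc⟩, x) =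
      (⟨firstStrands n, hc⟩, b * x) := by
  induction b using braid_induction generalizing x with
  | one => simp
  | of i =>
    have hi := i.2
    rw [toInf_of, Cabling.act_gen]
    refine Prod.ext (Subtype.ext (funext fun x => ?_)) ?_
    · simp only [Cabling.step, Equiv.coe_fn_mk, Cabling.swap, firstStrands]
      split_ifs <;> omega
    · simp only [Cabling.step, Equiv.coe_fn_mk, Cabling.block, off_firstStrands, firstStrands]
      rw [if_pos (by omega), if_pos (by omega), min_eq_left (by omega)]
      simp [blockOver, strandOver, crossing]
  | inv b ih =>
    apply (Cabling.act (crossing n) (toInf n b)).injective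
    rw [ih, ← Equiv.Perm.mul_apply, ← map_mul, ← map_mul, mul_inv_cancel, mul_inv_cancel_left]
    simp
  | mul b c hb hc => rw [map_mul, map_mul, Equiv.Perm.mul_apply, hc, hb, mul_assoc]

/-- A braid is recovered from its image by the cabling action on `Braid n`. There is no direct
retraction `gen i ↦ crossing n i`: the braid relation breaks at the last crossing, because `crossing
n i` is `1` from there on. Deleting the surplus strands by multiplicity `0` avoids this. -/
theorem toInf_injective (n : ℕ) : Function.Injective (toInf n) := by
  rw [injective_iff_map_eq_one]
  intro b hb
  have hc : ∀ k, IsArtin (crossing n) (Cabling.off (firstStrands n) k) := fun k =>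
    (isArtin_crossing n).mono (by rw [off_firstStrands]; omega)
  have h := act_toInf b 1 hc
  rw [hb, map_one, Equiv.Perm.one_apply] at h
  simpa using (congrArg Prod.snd h).symm

end Inclusion

/-! ## Cabling preserves positivity -/

section Positivity

open BraidInf

/-- A sequence of multiplicities for the cabling of infinite braids. -/
def multInf (c : ℕ → ℕ) : Cabling.Mult gen := ⟨c, fun _ => isArtin_gen _⟩

/-- The cabling of infinite braids. -/
def cableInf (b : BraidInf) (c : ℕ → ℕ) : BraidInf := (Cabling.act gen b (multInf c, 1)).2

/-- The multiplicities below an infinite braid. -/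
def pullInf (b : BraidInf) (c : ℕ → ℕ) : ℕ → ℕ := (Cabling.act gen b (multInf c, 1)).1.1

theorem act_multInf (b : BraidInf) (c : ℕ → ℕ) (x : BraidInf) :
    Cabling.act gen b (multInf c, x) = (multInf (pullInf b c), cableInf b c * x) :=
  Cabling.act_apply gen b _ x

theorem pullInf_mul (a b : BraidInf) (c : ℕ → ℕ) :
    pullInf (a * b) c = pullInf a (pullInf b c) := by
  have h := act_multInf (a * b) c 1
  rw [map_mul, Equiv.Perm.mul_apply, act_multInf, act_multInf] at h
  exact (congrArg (fun x => x.1.1) h).symm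

theorem cableInf_mul (a b : BraidInf) (c : ℕ → ℕ) :
    cableInf (a * b) c = cableInf a (pullInf b c) * cableInf b c := by
  have h := act_multInf (a * b) c 1
  rw [map_mul, Equiv.Perm.mul_apply, act_multInf, act_multInf] at h
  simpa using (congrArg Prod.snd h).symm

theorem pullInf_one (c : ℕ → ℕ) : pullInf 1 c = c := by simp [pullInf, multInf]

theorem cableInf_one (c : ℕ → ℕ) : cableInf 1 c = 1 := by simp [cableInf]

theorem pullInf_gen (i : ℕ) (c : ℕ → ℕ) : pullInf (gen i) c = Cabling.swap c i := by
  rw [pullInf, Cabling.act_gen]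
  rfl

theorem cableInf_gen (i : ℕ) (c : ℕ → ℕ) :
    cableInf (gen i) c = blockOver gen (Cabling.off c i) (c (i + 1)) (c i) := by
  rw [cableInf, Cabling.act_gen]
  exact mul_one _

theorem pullInf_inv_pullInf (b : BraidInf) (c : ℕ → ℕ) : pullInf b⁻¹ (pullInf b c) = c := by
  rw [← pullInf_mul, inv_mul_cancel, pullInf_one]

theorem pullInf_pullInf_inv (b : BraidInf) (c : ℕ → ℕ) : pullInf b (pullInf b⁻¹ c) = c := by
  rw [← pullInf_mul, mul_inv_cancel, pullInf_one]

theorem cableInf_inv (b : BraidInf) (c : ℕ → ℕ) :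
    cableInf b⁻¹ c = (cableInf b (pullInf b⁻¹ c))⁻¹ := by
  apply eq_inv_of_mul_eq_one_right
  rw [← cableInf_mul, mul_inv_cancel, cableInf_one]

theorem pullInf_pos (b : BraidInf) {c : ℕ → ℕ} (hc : ∀ x, 0 < c x) (x : ℕ) :
    0 < pullInf b c x := by
  induction b using BraidInf.induction generalizing x with
  | one => rw [pullInf_one]; exact hc x
  | gen_mul i b ih =>
    rw [pullInf_mul, pullInf_gen, Cabling.swap]
    split_ifs <;> exact ih _
  | inv_gen_mul i b ih =>
    rw [pullInf_mul]
    have h : pullInf (gen i)⁻¹ (pullInf b c) = Cabling.swap (pullInf b c) i := by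
      conv_lhs => rw [← Cabling.swap_swap (pullInf b c) i, ← pullInf_gen]
      rw [pullInf_inv_pullInf]
    rw [h, Cabling.swap]
    split_ifs <;> exact ih _

theorem strandOver_mem_tail {k j : ℕ} (h : k < j) (q : ℕ) : strandOver gen j q ∈ tail k := by
  induction q with
  | zero => exact one_mem _
  | succ q ih => exact mul_mem ih (gen_mem_tail (by omega))

theorem blockOver_mem_tail {k j : ℕ} (h : k < j) (p q : ℕ) : blockOver gen j p q ∈ tail k := by
  induction p generalizing j with
  | zero => exact one_mem _
  | succ p ih => exact mul_mem (ih (by omega)) (strandOver_mem_tail h q)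

/-- Only the first strand of the left block uses `gen j`, as its first letter and exactly once. All
other letters have larger index. -/
theorem posAt_blockOver (j : ℕ) {p q : ℕ} (hp : 0 < p) (hq : 0 < q) :
    PosAt j (blockOver gen j p q) := by
  obtain ⟨p, rfl⟩ := Nat.exists_eq_add_of_le' (show 1 ≤ p by omega)
  obtain ⟨q, rfl⟩ := Nat.exists_eq_add_of_le (show 1 ≤ q by omega)
  refine ⟨_, tail_le_nonneg _ (blockOver_mem_tail (Nat.lt_succ_self j) p (1 + q)), _,
    tail_le_nonneg _ (strandOver_mem_tail (Nat.lt_succ_self j) q), ?_⟩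
  rw [blockOver_succ, strandOver_add]
  simp [strandOver, mul_assoc]

theorem cableInf_tail {k : ℕ} {b : BraidInf} (hb : b ∈ tail k) {c : ℕ → ℕ}
    (hc : ∀ x, 0 < c x) :
    (∀ x ≤ k, pullInf b c x = c x) ∧ cableInf b c ∈ tail (Cabling.off c k) := by
  have off_eq : ∀ {c c' : ℕ → ℕ}, (∀ x ≤ k, c x = c' x) → Cabling.off c k = Cabling.off c' k :=
    fun h => Finset.sum_congr rfl fun x hx => h x (Finset.mem_range.1 hx).le
  induction hb using Subgroup.closure_induction generalizing c with
  | mem x hx =>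
    obtain ⟨i, hi, rfl⟩ := hx
    have hi : k < i := hi
    rw [pullInf_gen, cableInf_gen]
    refine ⟨fun x hx => Cabling.swap_of_ne c (by omega) (by omega), blockOver_mem_tail ?_ _ _⟩
    -- Strand `k` keeps at least one copy, so the block of strand `i > k` starts strictly beyond
    -- `off c k`.
    have h1 := Cabling.off_mono c (show k + 1 ≤ i by omega)
    have h2 := hc k
    rw [Cabling.off_succ] at h1
    omega
  | one =>
    rw [pullInf_one, cableInf_one]
    exact ⟨fun _ _ => rfl, one_mem _⟩
  | mul x y _ _ hx hy =>
    obtain ⟨h1, h2⟩ := hy hc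
    obtain ⟨h3, h4⟩ := hx (pullInf_pos y hc)
    rw [pullInf_mul, cableInf_mul]
    rw [off_eq h1] at h4
    exact ⟨fun z hz => (h3 z hz).trans (h1 z hz), mul_mem h4 h2⟩
  | inv x _ hx =>
    obtain ⟨h1, h2⟩ := hx (pullInf_pos x⁻¹ hc)
    rw [pullInf_pullInf_inv] at h1
    rw [cableInf_inv, off_eq h1]
    exact ⟨fun z hz => (h1 z hz).symm, inv_mem h2⟩

/-- The factors do not change the total multiplicity of the first `k` strands, so the cablings of
all factors are nonnegative at one and the same index. -/
theorem cableInf_nonneg {k : ℕ} {b : BraidInf} (hb : b ∈ nonneg k) {c : ℕ → ℕ}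
    (hc : ∀ x, 0 < c x) : Cabling.off (pullInf b c) k = Cabling.off c k ∧
      cableInf b c ∈ nonneg (Cabling.off c k) := by
  induction hb using Submonoid.closure_induction generalizing c with
  | mem x hx =>
    rcases hx with rfl | hx
    · rw [pullInf_gen, cableInf_gen]
      exact ⟨Cabling.off_swap_of_le c le_rfl, (posAt_blockOver _ (hc _) (hc _)).mem_nonneg⟩
    · obtain ⟨h1, h2⟩ := cableInf_tail hx hc
      exact ⟨Finset.sum_congr rfl fun x hx => h1 x (Finset.mem_range.1 hx).le,
        tail_le_nonneg _ h2⟩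
  | one =>
    rw [pullInf_one, cableInf_one]
    exact ⟨rfl, one_mem _⟩
  | mul x y _ _ hx hy =>
    obtain ⟨h1, h2⟩ := hy hc
    obtain ⟨h3, h4⟩ := hx (pullInf_pos y hc)
    rw [pullInf_mul, cableInf_mul]
    rw [h1] at h3 h4
    exact ⟨h3, mul_mem h4 h2⟩

/-- Cabling with positive multiplicities preserves Dehornoy positivity. -/
theorem pos_cableInf {b : BraidInf} (hb : Pos b) {c : ℕ → ℕ} (hc : ∀ x, 0 < c x) :
    Pos (cableInf b c) := by
  obtain ⟨k, x, hx, y, hy, rfl⟩ := hb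
  obtain ⟨h1, h2⟩ := cableInf_nonneg hy hc
  obtain ⟨h3, h4⟩ := cableInf_nonneg (gen_mem_nonneg k) (pullInf_pos y hc)
  obtain ⟨-, h5⟩ := cableInf_nonneg hx (pullInf_pos (gen k) (pullInf_pos y hc))
  refine ⟨Cabling.off c k, ?_⟩
  rw [cableInf_mul, cableInf_mul]
  refine PosAt.mul_right (PosAt.mul_left (by rwa [h3, h1] at h5) ?_) h2
  rw [cableInf_gen, h1]
  exact posAt_blockOver _ (pullInf_pos y hc _) (pullInf_pos y hc _)

/-- The numbers of leaves of a sequence of trees. -/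
def leafMult {S : Type u} (f : ℕ → BinaryTree S) (x : ℕ) : ℕ := (f x).numLeaves

theorem toInf_strandOver {n j q : ℕ} (h : j + q < n) :
    toInf n (strandOver (crossing n) j q) = strandOver gen j q := by
  induction q with
  | zero => exact map_one _
  | succ q ih =>
    rw [strandOver_succ, map_mul, ih (by omega), toInf_crossing (by omega), strandOver_succ]

theorem toInf_blockOver {n j p q : ℕ} (h : j + p + q ≤ n) :
    toInf n (blockOver (crossing n) j p q) = blockOver gen j p q := by
  induction p generalizing j with
  | zero => exact map_one _
  | succ p ih =>
    rw [blockOver_succ, map_mul, ih (by omega), toInf_strandOver (by omega), blockOver_succ]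

/-- Cabling along a forest uses only the leaf numbers of its trees, so it is computed by the cabling
of infinite braids. -/
theorem toInf_cable {S : Type u} {m n : ℕ} (b : Braid m) (f : Forest S m n) :
    pullInf (toInf m b) (leafMult f.tree) = leafMult (pull b f).tree ∧
      cableInf (toInf m b) (leafMult f.tree) = toInf n (cable b f) := by
  induction b using braid_induction generalizing f with
  | one => simp only [map_one, pullInf_one, cableInf_one, pull_one, cable_one, and_self]
  | of i =>
    have hi := i.2
    rw [toInf_of, pull_of, cable_of, pullInf_gen, cableInf_gen, cableCrossing]
    constructor
    · funext x
      simp only [Forest.swap, swapSeq, Cabling.swap, leafMult]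
      split_ifs <;> rfl
    · have h := offset_mono f.tree (show (i : ℕ) + 1 + 1 ≤ m by omega)
      rw [f.leaves, offset_succ, offset_succ] at h
      rw [toInf_blockOver (by omega)]
      rfl
  | inv b ih =>
    obtain ⟨h1, h2⟩ := ih (pull b⁻¹ f)
    rw [← pull_mul, mul_inv_cancel, pull_one] at h1
    have h3 : cable b⁻¹ f = (cable b (pull b⁻¹ f))⁻¹ := by
      apply eq_inv_of_mul_eq_one_right
      rw [← cable_mul, mul_inv_cancel, cable_one]
    have h4 : pullInf (toInf m b)⁻¹ (leafMult f.tree) = leafMult (pull b⁻¹ f).tree := by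
      rw [← h1, pullInf_inv_pullInf]
    rw [map_inv, cableInf_inv, h4, h2, h3, map_inv]
    exact ⟨rfl, rfl⟩
  | mul b c hb hc =>
    obtain ⟨h1, h2⟩ := hc f
    obtain ⟨h3, h4⟩ := hb (pull c f)
    rw [map_mul, pullInf_mul, cableInf_mul, h1, h2, h3, h4, pull_mul, cable_mul, map_mul]
    exact ⟨rfl, rfl⟩

/-- Cabling along a forest preserves Dehornoy positivity. -/
theorem pos_toInf_cable {S : Type u} {m n : ℕ} {b : Braid m} (hb : Pos (toInf m b))
    (f : Forest S m n) : Pos (toInf n (cable b f)) := by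
  rw [← (toInf_cable b f).2]
  exact pos_cableInf hb fun x => (f.tree x).numLeaves_pos

end Positivity

/-! ## Orders on fraction groups -/

namespace FracGroup

variable {C : Type u} [Category.{v} C] {x : C}

theorem exists_mk (a : FracGroup C x) : ∃ (y : C) (f g : x ⟶ y), a = mk f g := by
  obtain ⟨⟨y, f, g⟩⟩ := a
  exact ⟨y, f, g, rfl⟩

theorem mk_self [IsOreCategory C] {y : C} (f : x ⟶ y) : mk f f = 1 := by
  rw [one_def, ← mk_comp (𝟙 x) (𝟙 x) f, Category.id_comp]

theorem mk_mul_mk_self [IsOreCategory C] {y : C} (f g h : x ⟶ y) : mk f g * mk g h = mk f h := by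
  rw [mk_mul_mk f g g h (𝟙 _) (𝟙 _) rfl, Category.comp_id, Category.comp_id]

/-- Two fractions are equal only if they have a common expansion. -/
theorem exists_of_mk_eq [IsOreCategory C] {y y' : C} {f g : x ⟶ y} {f' g' : x ⟶ y'}
    (h : mk f g = mk f' g') :
    ∃ (z : C) (p : y ⟶ z) (q : y' ⟶ z), f ≫ p = f' ≫ q ∧ g ≫ p = g' ≫ q := by
  have h := Quot.eqvGen_exact h
  suffices H : ∀ a b : FracPair C x, Relation.EqvGen FracStep a b →
      ∃ (z : C) (p : a.apex ⟶ z) (q : b.apex ⟶ z),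
        a.num ≫ p = b.num ≫ q ∧ a.den ≫ p = b.den ≫ q from H _ _ h
  intro a b hab
  induction hab with
  | rel a b h =>
    obtain ⟨f, g, p⟩ := h
    exact ⟨_, p, 𝟙 _, by simp⟩
  | refl a => exact ⟨_, 𝟙 _, 𝟙 _, rfl, rfl⟩
  | symm a b _ ih =>
    obtain ⟨z, p, q, h1, h2⟩ := ih
    exact ⟨z, q, p, h1.symm, h2.symm⟩
  | trans a b c _ _ ih ih' =>
    obtain ⟨z, p, q, h1, h2⟩ := ih
    obtain ⟨z', p', q', h3, h4⟩ := ih'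
    obtain ⟨t, r, r', hr⟩ := IsOreCategory.ore q p'
    refine ⟨t, p ≫ r, q' ≫ r', ?_, ?_⟩
    · rw [reassoc_of% h1, hr, ← Category.assoc, h3, Category.assoc]
    · rw [reassoc_of% h2, hr, ← Category.assoc, h4, Category.assoc]

theorem exists_of_mk_eq_one [IsOreCategory C] {y : C} {f g : x ⟶ y} (h : mk f g = 1) :
    ∃ (z : C) (p : y ⟶ z), f ≫ p = g ≫ p := by
  obtain ⟨z, p, q, h1, h2⟩ := exists_of_mk_eq (h.trans (mk_self f).symm)
  exact ⟨z, p, h1.trans h2.symm⟩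

theorem mk_eq_one_of_comp [IsOreCategory C] {y z : C} {f g : x ⟶ y} {p : y ⟶ z}
    (h : f ≫ p = g ≫ p) : mk f g = 1 := by rw [← mk_comp f g p, h, mk_self]

/-- A total, transitive and irreflexive relation between morphisms out of `x` with the same
target, stable under composition. -/
structure IsPositivity (Pos : ∀ {y : C}, (x ⟶ y) → (x ⟶ y) → Prop) : Prop where
  comp : ∀ {y z : C} (f g : x ⟶ y) (p : y ⟶ z), Pos f g → Pos (f ≫ p) (g ≫ p)
  trans : ∀ {y : C} (f g h : x ⟶ y), Pos f g → Pos g h → Pos f h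
  irrefl : ∀ {y : C} (f : x ⟶ y), ¬ Pos f f
  total : ∀ {y : C} (f g : x ⟶ y), Pos f g ∨ Pos g f ∨ ∃ (z : C) (p : y ⟶ z), f ≫ p = g ≫ p

section Cone

variable [IsOreCategory C] {Pos : ∀ {y : C}, (x ⟶ y) → (x ⟶ y) → Prop}

/-- The fractions `[f, g]` with `f` and `g` in the relation `Pos`. -/
def Cone (Pos : ∀ {y : C}, (x ⟶ y) → (x ⟶ y) → Prop) (a : FracGroup C x) : Prop :=
  ∃ (y : C) (f g : x ⟶ y), a = mk f g ∧ Pos f g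

theorem IsPositivity.cone_mul (hP : IsPositivity Pos) (a b : FracGroup C x) (ha : Cone Pos a)
    (hb : Cone Pos b) : Cone Pos (a * b) := by
  obtain ⟨y, f, g, rfl, h⟩ := ha
  obtain ⟨y', f', g', rfl, h'⟩ := hb
  obtain ⟨z, p, q, e⟩ := IsOreCategory.ore g f'
  refine ⟨z, f ≫ p, g' ≫ q, mk_mul_mk f g f' g' p q e, ?_⟩
  refine hP.trans _ (g ≫ p) _ (hP.comp _ _ _ h) ?_
  rw [e]
  exact hP.comp _ _ _ h'

theorem IsPositivity.not_cone_one (hP : IsPositivity Pos) :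
    ¬ Cone Pos (1 : FracGroup C x) := by
  rintro ⟨y, f, g, e, h⟩
  obtain ⟨z, p, hp⟩ := exists_of_mk_eq_one e.symm
  have := hP.comp f g p h
  rw [hp] at this
  exact hP.irrefl _ this

theorem IsPositivity.cone_total (hP : IsPositivity Pos) (a : FracGroup C x) :
    Cone Pos a ∨ a = 1 ∨ Cone Pos a⁻¹ := by
  obtain ⟨y, f, g, rfl⟩ := exists_mk a
  rcases hP.total f g with h | h | ⟨z, p, h⟩
  · exact Or.inl ⟨y, f, g, rfl, h⟩
  · exact Or.inr (Or.inr ⟨y, g, f, rfl, h⟩)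
  · exact Or.inr (Or.inl (mk_eq_one_of_comp h))

theorem IsPositivity.leftOrderable (hP : IsPositivity Pos) : LeftOrderable (FracGroup C x) :=
  leftOrderable_of_cone (Cone Pos) hP.cone_mul hP.not_cone_one hP.cone_total

/-- The hypothesis says that the sign of `[sq, sp]` does not depend on `s`. After expansion, a
conjugation amounts exactly to such a change of `s`. -/
theorem IsPositivity.biOrderable (hP : IsPositivity Pos)
    (conj : ∀ {y z : C} (s t : x ⟶ y) (p q : y ⟶ z), Pos (s ≫ q) (s ≫ p) →
      Pos (t ≫ q) (t ≫ p)) : BiOrderable (FracGroup C x) := by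
  refine biOrderable_of_cone (Cone Pos) hP.cone_mul hP.not_cone_one hP.cone_total ?_
  rintro _ b ⟨y, s, r, rfl, h⟩
  obtain ⟨y', t, s', rfl⟩ := exists_mk b
  -- With `s'k = sl` and `slp = rlq`, the fraction `[s, r]` is `[s'kq, s'kp]`, and its conjugate
  -- `[t, s'][s, r][s', t]` is `[tkq, tkp]`.
  obtain ⟨z, k, l, e⟩ := IsOreCategory.ore s' s
  obtain ⟨z', p, q, e'⟩ := IsOreCategory.ore (s ≫ l) (r ≫ l)
  refine ⟨z', t ≫ k ≫ q, t ≫ k ≫ p, ?_, ?_⟩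
  · rw [inv_mk, ← mk_comp t s' (k ≫ q), ← mk_comp s r (l ≫ q), ← mk_comp s' t (k ≫ p)]
    have e1 : s ≫ l ≫ q = s' ≫ k ≫ q := by rw [reassoc_of% e]
    have e2 : r ≫ l ≫ q = s' ≫ k ≫ p := by
      rw [reassoc_of% e]
      simpa using e'.symm
    rw [e1, e2, mk_mul_mk_self, mk_mul_mk_self]
  · have h1 : Pos (s' ≫ k ≫ q) (s' ≫ k ≫ p) := by
      have e1 : s' ≫ k ≫ q = s ≫ l ≫ q := by rw [reassoc_of% e]
      have e2 : s' ≫ k ≫ p = r ≫ l ≫ q := by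
        rw [reassoc_of% e]
        simpa using e'
      rw [e1, e2]
      exact hP.comp _ _ _ h
    rw [← Category.assoc, ← Category.assoc]
    exact conj (s' ≫ k) (t ≫ k) p q (by simpa using h1)

end Cone

end FracGroup

/-! ## Fraction groups of monoids -/

section FracMonoid

variable {M : Type u} [Monoid M]

/-- The fraction `[x, y]` of two elements of a monoid. -/
def frac (x y : M) : Frac M :=
  FracGroup.mk (C := OneObj M) (x := OneObj.star) (y := OneObj.star) x y

theorem frac_mul_right (x y z : M) : frac (x * z) (y * z) = frac x y :=
  FracGroup.mk_comp (C := OneObj M) (x := OneObj.star) (y := OneObj.star) (z := OneObj.star) x y z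

theorem frac_inv (x y : M) : (frac x y)⁻¹ = frac y x := rfl

variable [IsOreMonoid M]

theorem frac_self (x : M) : frac x x = 1 :=
  FracGroup.mk_self (C := OneObj M) (x := OneObj.star) (y := OneObj.star) x

theorem frac_mul_frac (x y z : M) : frac x y * frac y z = frac x z :=
  FracGroup.mk_mul_mk_self (C := OneObj M) (x := OneObj.star) (y := OneObj.star) x y z

theorem frac_mul_left (z x y : M) : frac (z * x) (z * y) = frac z 1 * frac x y * (frac z 1)⁻¹ := by
  rw [frac_inv, ← frac_mul_right z 1 x, ← frac_mul_right 1 z y, one_mul, one_mul, frac_mul_frac,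
    frac_mul_frac]

theorem exists_of_frac_eq_one {x y : M} (h : frac x y = 1) : ∃ z, x * z = y * z := by
  obtain ⟨_, p, h⟩ := FracGroup.exists_of_mk_eq_one (C := OneObj M) (x := OneObj.star)
    (y := OneObj.star) h
  exact ⟨p, h⟩

end FracMonoid

/-! ### Pulling orders back to the fraction group of a monoid -/

section Difference

variable {M : Type u} [Monoid M] {G : Type w} [Group G]

theorem one_lt_inv_of_lt_one [LinearOrder G] (hG : ∀ g h k : G, h ≤ k → g * h ≤ g * k) {g : G}
    (h : g < 1) : 1 < g⁻¹ := by
  refine lt_of_le_of_ne (by simpa using hG g⁻¹ _ _ h.le) fun h' => h.ne ?_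
  rw [← inv_inv g, ← h', inv_one]

theorem one_lt_conj [LinearOrder G]
    (hG : ∀ g h k : G, h ≤ k → g * h ≤ g * k ∧ h * g ≤ k * g) (g : G) {k : G} (h : 1 < k) :
    1 < g * k * g⁻¹ := by
  have h1 := (hG g⁻¹ _ _ (hG g _ _ h.le).1).2
  refine lt_of_le_of_ne (by simpa using h1) fun h2 => h.ne ?_
  rw [eq_mul_inv_iff_mul_eq, one_mul] at h2
  exact (mul_eq_left.1 h2.symm).symm

/-- A map `φ` that behaves like `(x, y) ↦ [x, y]`. -/
structure IsDifference (φ : M → M → G) : Prop where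
  mul : ∀ x y z, φ x y * φ y z = φ x z
  mul_right : ∀ x y z, φ (x * z) (y * z) = φ x y
  one : ∀ x y, φ x y = 1 → ∃ z, x * z = y * z

variable {φ : M → M → G}

theorem IsDifference.self (hφ : IsDifference φ) (x : M) : φ x x = 1 := by
  simpa using hφ.mul x x x

theorem IsDifference.inv (hφ : IsDifference φ) (x y : M) : (φ x y)⁻¹ = φ y x :=
  inv_eq_of_mul_eq_one_right ((hφ.mul x y x).trans (hφ.self x))

/-- The rules for `φ` are those of an injective homomorphism `[x, y] ↦ φ x y`. They suffice to pull
the order back without constructing this homomorphism. -/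
theorem IsDifference.isPositivity [LinearOrder G] (hG : ∀ g h k : G, h ≤ k → g * h ≤ g * k)
    (hφ : IsDifference φ) : FracGroup.IsPositivity (C := OneObj M) (x := OneObj.star)
      (fun {_} (x y : M) => 1 < φ x y) where
  comp {_ _} x y z h := h.trans_eq (hφ.mul_right x y z).symm
  trans {_} x y z h h' := by
    have h2 := hG (φ x y) 1 (φ y z) h'.le
    rw [mul_one, hφ.mul x y z] at h2
    exact h.trans_le h2
  irrefl {_} x h := by
    rw [hφ.self] at h
    exact lt_irrefl _ h
  total {_} x y := by
    rcases lt_trichotomy 1 (φ x y) with h | h | h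
    · exact Or.inl h
    · obtain ⟨z, hz⟩ := hφ.one x y h.symm
      exact Or.inr (Or.inr ⟨OneObj.star, z, hz⟩)
    · refine Or.inr (Or.inl ?_)
      have h2 := one_lt_inv_of_lt_one hG h
      rwa [hφ.inv] at h2

theorem IsDifference.leftOrderable [IsOreMonoid M] (hφ : IsDifference φ) (hG : LeftOrderable G) :
    LeftOrderable (Frac M) := by
  obtain ⟨_, hG⟩ := hG
  exact (hφ.isPositivity hG).leftOrderable

theorem IsDifference.biOrderable [IsOreMonoid M] (hφ : IsDifference φ) (hG : BiOrderable G) :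
    BiOrderable (Frac M) := by
  obtain ⟨_, hG⟩ := hG
  refine (hφ.isPositivity fun g h k hk => (hG g h k hk).1).biOrderable ?_
  intro _ _ s t p q h
  change 1 < φ (t * q : M) (t * p : M)
  replace h : 1 < φ (s * q : M) (s * p : M) := h
  -- Insert `sq` and `sp`: `φ(tq, tp) = φ(tq, sq) φ(sq, sp) φ(sp, tp)`, and the outer factors are
  -- `φ(t, s)` and its inverse.
  have e : φ (t * q : M) (t * p : M) =
      φ (t : M) (s : M) * φ (s * q : M) (s * p : M) * (φ (t : M) (s : M))⁻¹ := by
    rw [hφ.inv, ← hφ.mul_right (t : M) (s : M) (q : M), ← hφ.mul_right (s : M) (t : M) (p : M),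
      hφ.mul, hφ.mul]
  rw [e]
  exact one_lt_conj hG _ h

end Difference

/-! ## Leaf codes of trees -/

section LeafCode

variable {σ : Type u} {M : Type v} [Monoid M] (θ : σ → M)

/-- The product of the colours, read from the root, along the maximal left-going path that ends at
a given leaf. -/
def leafCode : BinaryTree σ → ℕ → M
  | .nil, _ => 1
  | .node c l r, i => if i < l.numLeaves then (if i = 0 then θ c else 1) * leafCode l i
      else leafCode r (i - l.numLeaves)

theorem leafCode_of_le (t : BinaryTree σ) {i : ℕ} (h : t.numLeaves ≤ i) : leafCode θ t i = 1 := by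
  induction t generalizing i with
  | nil => rfl
  | node c l r _ ihr =>
    simp only [BinaryTree.numLeaves] at h
    rw [leafCode, if_neg (by omega), ihr (by omega)]

theorem offset_lt_offset (f : ℕ → BinaryTree σ) {a b : ℕ} (h : a < b) : offset f a < offset f b := by
  have h1 := offset_mono f (show a + 1 ≤ b from h)
  have h2 := (f a).numLeaves_pos
  rw [offset_succ] at h1
  omega

theorem le_offset (f : ℕ → BinaryTree σ) (a : ℕ) : a ≤ offset f a := by
  induction a with
  | zero => exact Nat.zero_le _
  | succ a ih => exact Nat.succ_le_of_lt (ih.trans_lt (offset_lt_offset f (Nat.lt_succ_self a)))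

/-- Every position lies in a unique tree of a sequence. -/
theorem exists_offset (f : ℕ → BinaryTree σ) (x : ℕ) :
    ∃ j i, i < (f j).numLeaves ∧ x = offset f j + i := by
  induction x with
  | zero => exact ⟨0, 0, (f 0).numLeaves_pos, rfl⟩
  | succ x ih =>
    obtain ⟨j, i, hi, rfl⟩ := ih
    rcases Nat.lt_or_ge (i + 1) (f j).numLeaves with h | h
    · exact ⟨j, i + 1, h, by omega⟩
    · exact ⟨j + 1, 0, (f (j + 1)).numLeaves_pos, by rw [offset_succ]; omega⟩

theorem offset_add_inj (f : ℕ → BinaryTree σ) {j j' i i' : ℕ} (hi : i < (f j).numLeaves)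
    (hi' : i' < (f j').numLeaves) (h : offset f j + i = offset f j' + i') : j = j' ∧ i = i' := by
  have key : ∀ {j j' i i' : ℕ}, i < (f j).numLeaves → offset f j + i = offset f j' + i' →
      ¬ j < j' := fun {j j' i i'} hi h hj => by
    have h1 := offset_mono f (show j + 1 ≤ j' from hj)
    rw [offset_succ] at h1
    omega
  obtain rfl : j = j' := le_antisymm (not_lt.1 (key hi' h.symm)) (not_lt.1 (key hi h))
  exact ⟨rfl, by omega⟩

theorem numLeaves_graft_eq_offset (t : BinaryTree σ) (f : ℕ → BinaryTree σ) :
    (graft t f).numLeaves = offset f t.numLeaves := numLeaves_graft t f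

theorem offset_shift (f : ℕ → BinaryTree σ) (a j : ℕ) :
    offset f (a + j) = offset f a + offset (fun i => f (a + i)) j := offset_add f a j

/-- The leaf code of a tree with trees grafted onto its leaves. -/
theorem leafCode_graft (t : BinaryTree σ) (f : ℕ → BinaryTree σ) {j i : ℕ} (hj : j < t.numLeaves)
    (hi : i < (f j).numLeaves) : leafCode θ (graft t f) (offset f j + i) =
      (if i = 0 then leafCode θ t j else 1) * leafCode θ (f j) i := by
  induction t generalizing f j with
  | nil =>
    obtain rfl : j = 0 := by simpa using hj
    simp [graft, leafCode, offset_zero]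
  | node c l r ihl ihr =>
    simp only [BinaryTree.numLeaves] at hj
    simp only [graft, leafCode]
    rw [numLeaves_graft_eq_offset]
    rcases Nat.lt_or_ge j l.numLeaves with h | h
    · have h1 := offset_mono f (show j + 1 ≤ l.numLeaves from h)
      rw [offset_succ] at h1
      rw [if_pos (by omega), if_pos h, ihl f h hi]
      rcases Nat.eq_zero_or_pos j with rfl | hj0
      · simp only [offset_zero, zero_add, if_true]
        split_ifs <;> simp [mul_assoc]
      · have h2 := le_offset f j
        rw [if_neg (show ¬ offset f j + i = 0 by omega), if_neg (show ¬ j = 0 by omega), one_mul,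
          one_mul]
    · obtain ⟨k, rfl⟩ := Nat.exists_eq_add_of_le h
      rw [offset_shift, if_neg (by omega), if_neg (show ¬ l.numLeaves + k < l.numLeaves by omega),
        Nat.add_sub_cancel_left, show offset f l.numLeaves + offset (fun i => f (l.numLeaves + i)) k + i -
          offset f l.numLeaves = offset (fun i => f (l.numLeaves + i)) k + i by omega,
        ihr (fun i => f (l.numLeaves + i)) (by omega) hi]

theorem leafCode_graft_zero (t : BinaryTree σ) (f : ℕ → BinaryTree σ) {j : ℕ}
    (hj : j < t.numLeaves) : leafCode θ (graft t f) (offset f j) =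
      leafCode θ t j * leafCode θ (f j) 0 := by
  have h := leafCode_graft θ t f hj (f j).numLeaves_pos
  rwa [if_pos rfl, add_zero] at h

variable {θ}

/-- The lengths of the leaf codes of the first leaves of a tree. -/
theorem le_sum_leafCode (len : M → ℕ) (len_one : len 1 = 0)
    (len_mul : ∀ c m, len (θ c * m) = len m + 1) (t : BinaryTree σ) :
    (∀ y < t.numLeaves, y ≤ ∑ x ∈ Finset.range y, len (leafCode θ t x)) ∧
      ∑ x ∈ Finset.range t.numLeaves, len (leafCode θ t x) + 1 = t.numLeaves := by
  induction t with
  | nil => simp [leafCode, len_one]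
  | node c l r ihl ihr =>
    -- The root colour enters only the code of the first leaf, so it adds one to every nonempty
    -- partial sum over the left subtree.
    have h1 : ∀ y ≤ l.numLeaves, 0 < y →
        ∑ x ∈ Finset.range y, len (leafCode θ (.node c l r) x) =
          ∑ x ∈ Finset.range y, len (leafCode θ l x) + 1 := fun y hy hy0 => by
      obtain ⟨y, rfl⟩ := Nat.exists_eq_add_of_le' hy0
      rw [Finset.sum_range_succ', Finset.sum_range_succ']
      have h2 : len (leafCode θ (.node c l r) 0) = len (leafCode θ l 0) + 1 := by
        rw [leafCode, if_pos l.numLeaves_pos, if_pos rfl, len_mul]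
      rw [h2, ← add_assoc]
      congr 2
      refine Finset.sum_congr rfl fun x hx => ?_
      have := Finset.mem_range.1 hx
      rw [leafCode, if_pos (by omega), if_neg (by omega), one_mul]
    have h2 : ∀ y, ∑ x ∈ Finset.range (l.numLeaves + y), len (leafCode θ (.node c l r) x) =
        l.numLeaves + ∑ x ∈ Finset.range y, len (leafCode θ r x) := fun y => by
      rw [Finset.sum_range_add, h1 _ le_rfl l.numLeaves_pos, ihl.2]
      congr 1
      refine Finset.sum_congr rfl fun x _ => ?_
      rw [leafCode, if_neg (by omega), Nat.add_sub_cancel_left]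
    simp only [BinaryTree.numLeaves]
    refine ⟨fun y hy => ?_, ?_⟩
    · rcases Nat.lt_or_ge y l.numLeaves with h | h
      · rcases Nat.eq_zero_or_pos y with rfl | hy0
        · exact Nat.zero_le _
        · rw [h1 y h.le hy0]
          exact (ihl.1 y h).trans (Nat.le_succ _)
      · obtain ⟨k, rfl⟩ := Nat.exists_eq_add_of_le h
        rw [h2]
        exact Nat.add_le_add_left (ihr.1 k (by omega)) _
    · rw [h2, add_assoc, ihr.2]

/-- The number of leaves of a tree is determined by the lengths of its leaf codes. -/
theorem numLeaves_eq_of_len (len : M → ℕ) (len_one : len 1 = 0)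
    (len_mul : ∀ c m, len (θ c * m) = len m + 1) {t s : BinaryTree σ}
    (h : ∀ x, x < t.numLeaves → x < s.numLeaves →
      len (leafCode θ t x) = len (leafCode θ s x)) : t.numLeaves = s.numLeaves := by
  -- As for Łukasiewicz words, the number of leaves is the least `y` for which the first `y` codes
  -- have total length less than `y`. If `t` had fewer leaves than `s`, the sum over the leaves of
  -- `t` would be both below that number and at least that number.
  have key : ∀ {t s : BinaryTree σ}, (∀ x, x < t.numLeaves → x < s.numLeaves →
      len (leafCode θ t x) = len (leafCode θ s x)) → ¬ t.numLeaves < s.numLeaves := by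
    intro t s h hlt
    have h1 := (le_sum_leafCode len len_one len_mul t).2
    have h2 := (le_sum_leafCode len len_one len_mul s).1 _ hlt
    have h3 : ∑ x ∈ Finset.range t.numLeaves, len (leafCode θ t x) =
        ∑ x ∈ Finset.range t.numLeaves, len (leafCode θ s x) :=
      Finset.sum_congr rfl fun x hx => by
        have := Finset.mem_range.1 hx
        exact h x this (by omega)
    omega
  exact le_antisymm (not_lt.1 (key fun x hx hx' => (h x hx' hx).symm)) (not_lt.1 (key h))

end LeafCode

/-! ## The skein relations of a homogeneously presented monoid -/

theorem numLeaves_leftVine {σ : Type u} (w : List σ) :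
    (leftVine w).numLeaves = w.length + 1 := by
  induction w with
  | nil => rfl
  | cons a w ih => simp [leftVine, ih]

/-- The sequence with a given first tree and trivial trees elsewhere. -/
def single {σ : Type u} (t : BinaryTree σ) (i : ℕ) : BinaryTree σ := if i = 0 then t else .nil

theorem leftVine_append {σ : Type u} (p q : List σ) :
    leftVine (p ++ q) = graft (leftVine p) (single (leftVine q)) := by
  induction p with
  | nil => rfl
  | cons a p ih =>
    rw [List.cons_append, leftVine, leftVine, graft, ih, graft, single, if_neg]
    have := (leftVine p).numLeaves_pos
    omega

/-- A tree is a left-vine with smaller trees grafted onto its leaves other than the first. -/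
theorem exists_eq_graft_leftVine {σ : Type u} (t : BinaryTree σ) :
    ∃ (w : List σ) (g : ℕ → BinaryTree σ), t = graft (leftVine w) g ∧ g 0 = .nil ∧
      ∀ i, g i = .nil ∨ (g i).numNodes < t.numNodes := by
  induction t with
  | nil => exact ⟨[], fun _ => .nil, rfl, rfl, fun _ => Or.inl rfl⟩
  | node c l r ihl _ =>
    obtain ⟨w, g, hl, h0, hg⟩ := ihl
    refine ⟨c :: w, fun i => if i < w.length + 1 then g i else r, ?_, ?_, fun i => ?_⟩
    · rw [leftVine, graft]
      congr 1
      · rw [hl]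
        refine graft_congr _ fun i hi => ?_
        rw [numLeaves_leftVine] at hi
        rw [if_pos hi]
      · rw [graft, numLeaves_leftVine, if_neg (by omega)]
    · exact (if_pos (by omega)).trans h0
    · dsimp only
      split_ifs
      · refine (hg i).imp_right fun h => ?_
        simp only [BinaryTree.numNodes]
        omega
      · right
        simp only [BinaryTree.numNodes]
        omega

section Skein

variable {σ : Type u} {ρ : FreeMonoid σ → FreeMonoid σ → Prop}

/-- The skein equivalence of trees attached to monoid relations. -/
abbrev VineEq (ρ : FreeMonoid σ → FreeMonoid σ → Prop) : BinaryTree σ → BinaryTree σ → Prop :=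
  SkeinEq (vineRel ρ)

/-- The leaf code with values in the presented monoid. -/
abbrev monCode (ρ : FreeMonoid σ → FreeMonoid σ → Prop) : BinaryTree σ → ℕ → PresentedMonoid ρ :=
  leafCode (PresentedMonoid.of ρ)

theorem monCode_graft (t : BinaryTree σ) (f : ℕ → BinaryTree σ) {j i : ℕ}
    (hj : j < t.numLeaves) (hi : i < (f j).numLeaves) :
    monCode ρ (graft t f) (offset f j + i) =
      (if i = 0 then monCode ρ t j else 1) * monCode ρ (f j) i := leafCode_graft _ t f hj hi

theorem monCode_graft_zero (t : BinaryTree σ) (f : ℕ → BinaryTree σ) :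
    monCode ρ (graft t f) 0 = monCode ρ t 0 * monCode ρ (f 0) 0 :=
  leafCode_graft_zero _ t f t.numLeaves_pos

theorem monCode_of_le (t : BinaryTree σ) {i : ℕ} (h : t.numLeaves ≤ i) : monCode ρ t i = 1 :=
  leafCode_of_le _ t h

theorem monCode_leftVine_zero (w : List σ) :
    monCode ρ (leftVine w) 0 = PresentedMonoid.mk ρ (FreeMonoid.ofList w) := by
  induction w with
  | nil => exact (map_one (PresentedMonoid.mk ρ)).symm
  | cons a w ih =>
    rw [FreeMonoid.ofList_cons, map_mul, ← ih]
    simp only [leftVine, leafCode, if_pos (BinaryTree.numLeaves_pos _), if_true]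
    rfl

theorem monCode_leftVine_pos (w : List σ) {i : ℕ} (hi : 0 < i) :
    monCode ρ (leftVine w) i = 1 := by
  induction w with
  | nil => rfl
  | cons a w ih =>
    rw [leftVine, monCode, leafCode]
    split_ifs with h1 h2
    · omega
    · rw [one_mul]; exact ih
    · rfl

/-- Concatenating words is grafting a left-vine onto the first leaf, so the skein equivalence of
left-vines respects the congruence generated by `ρ`. -/
theorem VineEq.leftVine {p q : FreeMonoid σ}
    (h : PresentedMonoid.mk ρ p = PresentedMonoid.mk ρ q) :
    VineEq ρ (leftVine p.toList) (leftVine q.toList) := by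
  have h' : ConGen.Rel ρ p q := PresentedMonoid.mk_eq_mk_iff.1 h
  clear h
  induction h' with
  | of x y h => exact .rel (.mk h)
  | refl x => exact .refl _
  | symm _ ih => exact .symm ih
  | trans _ _ ih ih' => exact .trans ih ih'
  | mul _ _ ih ih' =>
    rw [FreeMonoid.toList_mul, FreeMonoid.toList_mul, leftVine_append, leftVine_append]
    refine .graft ih fun i => ?_
    unfold single
    split_ifs
    · exact ih'
    · exact .refl _

theorem lift_const_eq_length (w : FreeMonoid σ) :
    FreeMonoid.lift (fun _ => Multiplicative.ofAdd 1) w = Multiplicative.ofAdd w.length := by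
  induction w using FreeMonoid.inductionOn with
  | one => rfl
  | of x => simp
  | mul x y hx hy => rw [map_mul, hx, hy, FreeMonoid.length_mul, ofAdd_add]

/-- The length of an element of a homogeneously presented monoid, as a homomorphism. -/
def monLengthHom (hρ : IsHomogeneous ρ) : PresentedMonoid ρ →* Multiplicative ℕ :=
  PresentedMonoid.lift (fun _ => Multiplicative.ofAdd 1) fun p q h => by
    rw [lift_const_eq_length, lift_const_eq_length, hρ p q h]

/-- The length of an element of a homogeneously presented monoid. -/
def monLength (hρ : IsHomogeneous ρ) (x : PresentedMonoid ρ) : ℕ :=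
  Multiplicative.toAdd (monLengthHom hρ x)

theorem monLength_one (hρ : IsHomogeneous ρ) : monLength hρ 1 = 0 := by
  rw [monLength, map_one, toAdd_one]

theorem monLength_mul (hρ : IsHomogeneous ρ) (x y : PresentedMonoid ρ) :
    monLength hρ (x * y) = monLength hρ x + monLength hρ y := by
  rw [monLength, map_mul, toAdd_mul, monLength, monLength]

theorem monLength_mk (hρ : IsHomogeneous ρ) (w : FreeMonoid σ) :
    monLength hρ (PresentedMonoid.mk ρ w) = w.length :=
  congrArg Multiplicative.toAdd (lift_const_eq_length w)

theorem monLength_of_mul (hρ : IsHomogeneous ρ) (c : σ) (x : PresentedMonoid ρ) :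
    monLength hρ (PresentedMonoid.of ρ c * x) = monLength hρ x + 1 := by
  rw [monLength_mul, add_comm]
  congr 1

theorem VineEq.numLeaves (hρ : IsHomogeneous ρ) {t s : BinaryTree σ} (h : VineEq ρ t s) :
    t.numLeaves = s.numLeaves := by
  induction h with
  | rel h =>
    obtain ⟨h⟩ := h
    rw [numLeaves_leftVine, numLeaves_leftVine]
    exact congrArg (· + 1) (hρ _ _ h)
  | refl t => rfl
  | symm _ ih => exact ih.symm
  | trans _ _ ih ih' => exact ih.trans ih'
  | graft _ _ ih ih' =>
    rw [numLeaves_graft, numLeaves_graft, ih]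
    exact Finset.sum_congr rfl fun i _ => ih' i

/-- Sizes of trees can often be compared only once their positions are known to agree; this
induction from left to right resolves the circularity. -/
theorem offset_eq_of_numLeaves {f g : ℕ → BinaryTree σ} {n : ℕ}
    (h : ∀ j < n, offset f j = offset g j → (f j).numLeaves = (g j).numLeaves) {j : ℕ}
    (hj : j ≤ n) : offset f j = offset g j := by
  induction j with
  | zero => rfl
  | succ j ih => rw [offset_succ, offset_succ, ih (by omega), h j (by omega) (ih (by omega))]

/-- Homogeneity keeps every leaf at its position, so the codes of grafted trees multiply in the same
way on both sides. -/
theorem VineEq.monCode (hρ : IsHomogeneous ρ) {t s : BinaryTree σ} (h : VineEq ρ t s) (x : ℕ) :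
    monCode ρ t x = monCode ρ s x := by
  induction h generalizing x with
  | rel h =>
    obtain ⟨h⟩ := h
    rcases Nat.eq_zero_or_pos x with rfl | hx
    · rw [monCode_leftVine_zero, monCode_leftVine_zero]
      exact PresentedMonoid.mk_eq_mk_of_rel h
    · rw [monCode_leftVine_pos _ hx, monCode_leftVine_pos _ hx]
  | refl t => rfl
  | symm _ ih => exact (ih x).symm
  | trans _ _ ih ih' => exact (ih x).trans (ih' x)
  | @graft t s f g h h' ih ih' =>
    have hoff : ∀ j, offset f j = offset g j := fun j =>
      Finset.sum_congr rfl fun i _ => VineEq.numLeaves hρ (h' i)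
    have hts := VineEq.numLeaves hρ h
    obtain ⟨j, i, hi, rfl⟩ := exists_offset f x
    rcases Nat.lt_or_ge j t.numLeaves with hj | hj
    · rw [monCode_graft t f hj hi, hoff j, monCode_graft s g (hts ▸ hj)
        (VineEq.numLeaves hρ (h' j) ▸ hi), ih, ih']
    · have h1 := offset_mono f hj
      rw [monCode_of_le, monCode_of_le]
      · rw [numLeaves_graft_eq_offset, ← hts, ← hoff]; omega
      · rw [numLeaves_graft_eq_offset]; omega

theorem VineEq.graft_of_lt {t s : BinaryTree σ} {f g : ℕ → BinaryTree σ} {n : ℕ}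
    (ht : t.numLeaves ≤ n) (hs : s.numLeaves ≤ n) (h : VineEq ρ t s)
    (h' : ∀ i < n, VineEq ρ (f i) (g i)) : VineEq ρ (graft t f) (graft s g) := by
  rw [graft_congr t (h := fun i => if i < n then f i else .nil) fun i hi =>
      (if_pos (show i < n by omega)).symm,
    graft_congr s (h := fun i => if i < n then g i else .nil) fun i hi =>
      (if_pos (show i < n by omega)).symm]
  refine .graft h fun i => ?_
  split_ifs with hi
  · exact h' i hi
  · exact .refl _

theorem numLeaves_eq_of_monCode (hρ : IsHomogeneous ρ) {t s : BinaryTree σ}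
    (h : ∀ x < t.numLeaves, x < s.numLeaves → monCode ρ t x = monCode ρ s x) :
    t.numLeaves = s.numLeaves :=
  numLeaves_eq_of_len (monLength hρ) (monLength_one hρ) (monLength_of_mul hρ)
    fun x hx hx' => congrArg _ (h x hx hx')

theorem eq_nil_of_numLeaves {t : BinaryTree σ} (h : t.numLeaves = 1) : t = .nil := by
  cases t with
  | nil => rfl
  | node c l r =>
    have h1 := l.numLeaves_pos
    have h2 := r.numLeaves_pos
    simp only [BinaryTree.numLeaves] at h
    omega

/-- Trees grafted onto the leaves of a sequence of trees, tree by tree. -/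
theorem exists_stack_eq (f : ℕ → BinaryTree σ) (F : ℕ → ℕ → BinaryTree σ) :
    ∃ P : ℕ → BinaryTree σ, (∀ i, stack f P i = graft (f i) (F i)) ∧
      ∀ j i, i < (f j).numLeaves → P (offset f j + i) = F j i := by
  choose a b hb hx using exists_offset f
  have h : ∀ j i, i < (f j).numLeaves → F (a (offset f j + i)) (b (offset f j + i)) = F j i :=
    fun j i hi => by
      obtain ⟨h1, h2⟩ := offset_add_inj f hi (hb _) (hx (offset f j + i))
      rw [← h1, ← h2]
  exact ⟨fun x => F (a x) (b x), fun i => graft_congr _ fun k hk => h i k hk, h⟩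

/-! ### Rigidity, cancellation and common multiples of trees -/

section Ore

variable [IsOreMonoid (PresentedMonoid ρ)]

/-- If the codes of two grafted trees agree, so do the codes of the trees that are grafted. -/
theorem monCode_eq_of_graft {t s : BinaryTree σ} {f g : ℕ → BinaryTree σ}
    (h : ∀ x < (graft t f).numLeaves, x < (graft s g).numLeaves →
      monCode ρ (graft t f) x = monCode ρ (graft s g) x) {j : ℕ} (hj : j < t.numLeaves)
    (hj' : j < s.numLeaves) (hts : monCode ρ t j = monCode ρ s j)
    (hoff : offset f j = offset g j) (y : ℕ) (hy : y < (f j).numLeaves)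
    (hy' : y < (g j).numLeaves) : monCode ρ (f j) y = monCode ρ (g j) y := by
  have h1 := offset_mono f (show j + 1 ≤ t.numLeaves from hj)
  have h2 := offset_mono g (show j + 1 ≤ s.numLeaves from hj')
  rw [offset_succ] at h1 h2
  have h3 := h (offset f j + y) (by rw [numLeaves_graft_eq_offset]; omega)
    (by rw [numLeaves_graft_eq_offset]; omega)
  rw [monCode_graft t f hj hy, hoff, monCode_graft s g hj' hy', hts] at h3
  exact IsOreMonoid.left_cancel _ _ _ h3

/-- A tree is determined up to skein equivalence by its leaf codes. -/
theorem vineEq_of_monCode (hρ : IsHomogeneous ρ) {t s : BinaryTree σ}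
    (h : ∀ x < t.numLeaves, x < s.numLeaves → monCode ρ t x = monCode ρ s x) : VineEq ρ t s := by
  induction hn : t.numNodes using Nat.strong_induction_on generalizing t s with
  | _ n ih =>
    subst hn
    by_cases ht : t = .nil
    · subst ht
      rw [eq_nil_of_numLeaves (numLeaves_eq_of_monCode hρ h).symm]
      exact .refl _
    · have hpos : 0 < t.numNodes := by
        cases t with
        | nil => exact (ht rfl).elim
        | node c l r => exact Nat.succ_pos _
      obtain ⟨w, g, et, g0, hg⟩ := exists_eq_graft_leftVine t
      obtain ⟨w', g', es, g0', -⟩ := exists_eq_graft_leftVine s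
      -- Nothing is grafted onto the first leaf of either vine, so the first codes are the classes
      -- of the full words `w` and `w'`.
      have h0 := h 0 t.numLeaves_pos s.numLeaves_pos
      have e0 : ∀ (w : List σ) (g : ℕ → BinaryTree σ), g 0 = .nil →
          monCode ρ (graft (leftVine w) g) 0 = PresentedMonoid.mk ρ (FreeMonoid.ofList w) := by
        intro w g hg
        rw [monCode_graft_zero, hg, monCode_leftVine_zero]
        exact mul_one _
      rw [et, es, e0 w g g0, e0 w' g' g0'] at h0
      have hv : VineEq ρ (leftVine w) (leftVine w') := VineEq.leftVine h0
      have hl := VineEq.numLeaves hρ hv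
      rw [et, es] at h
      -- If the `j`-th trees start at the same position, cancelling the code of the vine leaves
      -- equal codes on smaller trees. Their equivalence then aligns the next pair.
      have key : ∀ j < (leftVine w).numLeaves, offset g j = offset g' j →
          VineEq ρ (g j) (g' j) := fun j hj hoff =>
        ih _ ((hg j).elim (fun e => by rw [e]; exact hpos) id)
          (monCode_eq_of_graft h hj (hl ▸ hj) (hv.monCode hρ j) hoff) rfl
      rw [et, es]
      refine VineEq.graft_of_lt le_rfl hl.ge hv fun j hj => key j hj ?_
      exact offset_eq_of_numLeaves (fun i hi e => (key i hi e).numLeaves hρ) hj.le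

/-- Left-cancellation for trees. -/
theorem VineEq.of_graft (hρ : IsHomogeneous ρ) {t : BinaryTree σ} {f g : ℕ → BinaryTree σ}
    (h : VineEq ρ (graft t f) (graft t g)) {j : ℕ} (hj : j < t.numLeaves) :
    VineEq ρ (f j) (g j) := by
  have key : ∀ j < t.numLeaves, offset f j = offset g j → VineEq ρ (f j) (g j) :=
    fun j hj hoff => vineEq_of_monCode hρ
      (monCode_eq_of_graft (fun x _ _ => h.monCode hρ x) hj hj rfl hoff)
  exact key j hj (offset_eq_of_numLeaves (fun i hi e => (key i hi e).numLeaves hρ) hj.le)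

/-- Common right-multiples of trees. -/
theorem exists_graft_vineEq_graft (t s : BinaryTree σ) :
    ∃ F G : ℕ → BinaryTree σ, VineEq ρ (graft t F) (graft s G) := by
  induction hn : t.numNodes using Nat.strong_induction_on generalizing t s with
  | _ n ih =>
    subst hn
    by_cases ht : t = .nil
    · subst ht
      exact ⟨fun _ => s, fun _ => .nil, by rw [graft_nil]; exact .refl _⟩
    · have hpos : 0 < t.numNodes := by
        cases t with
        | nil => exact (ht rfl).elim
        | node c l r => exact Nat.succ_pos _
      obtain ⟨w, g, et, g0, hg⟩ := exists_eq_graft_leftVine t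
      obtain ⟨w', g', es, g0', -⟩ := exists_eq_graft_leftVine s
      obtain ⟨x, y, hxy⟩ := IsOreMonoid.ore (PresentedMonoid.mk ρ (FreeMonoid.ofList w))
        (PresentedMonoid.mk ρ (FreeMonoid.ofList w'))
      obtain ⟨p, rfl⟩ := PresentedMonoid.surjective_mk x
      obtain ⟨q, rfl⟩ := PresentedMonoid.surjective_mk y
      rw [← map_mul, ← map_mul] at hxy
      have hv := VineEq.leftVine hxy
      rw [FreeMonoid.toList_mul, FreeMonoid.toList_mul, leftVine_append, leftVine_append] at hv
      -- As `g` is trivial on the first leaf, prolonging the vine there by `p` commutes with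
      -- grafting `g`, whose trees merely move right by the length of `p`.
      have swap : ∀ (g : ℕ → BinaryTree σ) (p : List σ), g 0 = .nil →
          stack g (single (leftVine p)) = stack (single (leftVine p))
            (fun i => if i ≤ p.length then .nil else g (i - p.length)) := by
        intro g p g0
        funext i
        match i with
        | 0 =>
          rw [stack, stack, g0, offset_zero, offset_zero, graft]
          simp only [single, add_zero, if_true]
          conv_lhs => rw [← graft_nil (leftVine p)]
          refine graft_congr _ fun i hi => ?_
          rw [numLeaves_leftVine] at hi
          rw [if_pos (by omega)]
        | i + 1 =>
          have h1 : offset (single (leftVine p)) (i + 1) = p.length + 1 + i := by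
            rw [offset, Finset.sum_range_succ']
            simp [single, numLeaves_leftVine]
            omega
          have h2 := le_offset g (i + 1)
          rw [stack, stack, h1]
          conv_rhs => rw [single, if_neg (by omega)]
          rw [graft, if_neg (by omega), show p.length + 1 + i + 0 - p.length = i + 1 by omega]
          conv_rhs => rw [← graft_nil (g (i + 1))]
          refine graft_congr _ fun k _ => ?_
          rw [single, if_neg (by omega)]
      -- The vines now agree, and the common multiple is built leaf by leaf. The induction only
      -- needs the trees coming from `t` to be smaller than `t`.
      have hFG : ∀ i, ∃ F G : ℕ → BinaryTree σ,
          VineEq ρ (graft (if i ≤ p.toList.length then .nil else g (i - p.toList.length)) F)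
            (graft (if i ≤ q.toList.length then .nil else g' (i - q.toList.length)) G) := by
        intro i
        refine ih _ ?_ _ _ rfl
        split_ifs
        · exact hpos
        · exact (hg _).elim (fun e => by rw [e]; exact hpos) id
      choose F G hFG using hFG
      obtain ⟨P, hP, -⟩ := exists_stack_eq _ F
      obtain ⟨Q, hQ, -⟩ := exists_stack_eq _ G
      refine ⟨stack (single (leftVine p.toList)) P, stack (single (leftVine q.toList)) Q, ?_⟩
      rw [← graft_graft, ← graft_graft, et, es, graft_graft (leftVine w), graft_graft (leftVine w'),
        swap g _ g0, swap g' _ g0', ← graft_graft (leftVine w), ← graft_graft (leftVine w'),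
        graft_graft (graft (leftVine w) _), graft_graft (graft (leftVine w') _)]
      refine .graft hv fun i => ?_
      rw [hP, hQ]
      exact hFG i

end Ore

end Skein

/-! ## The forest-skein categories of a homogeneously presented monoid -/

section Categories

variable {σ : Type u} {ρ : FreeMonoid σ → FreeMonoid σ → Prop} {n m k : ℕ}

/-- Skein equivalence of forests, tree by tree. -/
def ForestEq (ρ : FreeMonoid σ → FreeMonoid σ → Prop) (f g : Forest σ n m) : Prop :=
  ∀ i, VineEq ρ (f.tree i) (g.tree i)

theorem ForestEq.refl (f : Forest σ n m) : ForestEq ρ f f := fun _ => .refl _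

theorem ForestEq.symm {f g : Forest σ n m} (h : ForestEq ρ f g) : ForestEq ρ g f :=
  fun i => .symm (h i)

theorem ForestEq.trans {f g e : Forest σ n m} (h : ForestEq ρ f g) (h' : ForestEq ρ g e) :
    ForestEq ρ f e := fun i => .trans (h i) (h' i)

theorem ForestEq.leafMult (hρ : IsHomogeneous ρ) {f g : Forest σ n m} (h : ForestEq ρ f g) :
    leafMult f.tree = leafMult g.tree := funext fun i => (h i).numLeaves hρ

theorem ForestEq.comp (hρ : IsHomogeneous ρ) {f f' : Forest σ n m} {g g' : Forest σ m k}
    (h : ForestEq ρ f f') (h' : ForestEq ρ g g') : ForestEq ρ (f.comp g) (f'.comp g') := by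
  intro i
  have e : offset f.tree i = offset f'.tree i :=
    Finset.sum_congr rfl fun j _ => (h j).numLeaves hρ
  simp only [Forest.comp, stack, e]
  exact .graft (h i) fun j => h' _

theorem ForestEq.of_comp (hρ : IsHomogeneous ρ) [IsOreMonoid (PresentedMonoid ρ)]
    {f : Forest σ n m} {g g' : Forest σ m k} (h : ForestEq ρ (f.comp g) (f.comp g')) :
    ForestEq ρ g g' := by
  intro x
  obtain ⟨j, i, hi, rfl⟩ := exists_offset f.tree x
  exact VineEq.of_graft hρ (h j) hi

theorem Forest.exists_comp_tree (f : Forest σ n m) (F : ℕ → ℕ → BinaryTree σ)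
    (hF : ∀ j i, n ≤ j → F j i = .nil) :
    ∃ (k : ℕ) (p : Forest σ m k), ∀ i, (f.comp p).tree i = graft (f.tree i) (F i) := by
  obtain ⟨P, h1, h2⟩ := exists_stack_eq f.tree F
  refine ⟨_, ⟨P, fun x hx => ?_, rfl⟩, h1⟩
  obtain ⟨j, i, hi, rfl⟩ := exists_offset f.tree x
  rw [h2 j i hi, hF j i]
  by_contra hj
  have h3 := offset_mono f.tree (show j + 1 ≤ n by omega)
  rw [f.leaves, offset_succ] at h3
  omega

theorem ForestEq.exists_comp (hρ : IsHomogeneous ρ) [IsOreMonoid (PresentedMonoid ρ)] {m' : ℕ}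
    (f : Forest σ n m) (g : Forest σ n m') :
    ∃ (k : ℕ) (p : Forest σ m k) (q : Forest σ m' k), ForestEq ρ (f.comp p) (g.comp q) := by
  have h : ∀ i, ∃ FG : (ℕ → BinaryTree σ) × (ℕ → BinaryTree σ),
      VineEq ρ (graft (f.tree i) FG.1) (graft (g.tree i) FG.2) ∧
        (n ≤ i → ∀ j, FG.1 j = .nil ∧ FG.2 j = .nil) := by
    intro i
    rcases Nat.lt_or_ge i n with hi | hi
    · obtain ⟨F, G, h⟩ := exists_graft_vineEq_graft (ρ := ρ) (f.tree i) (g.tree i)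
      exact ⟨(F, G), h, fun h => by omega⟩
    · refine ⟨(fun _ => .nil, fun _ => .nil), ?_, fun _ _ => ⟨rfl, rfl⟩⟩
      rw [f.padding i hi, g.padding i hi]
      exact .refl _
  choose FG h1 h2 using h
  obtain ⟨k, p, hp⟩ := f.exists_comp_tree (fun i => (FG i).1) fun j i hj => (h2 j hj i).1
  obtain ⟨k', q, hq⟩ := g.exists_comp_tree (fun i => (FG i).2) fun j i hj => (h2 j hj i).2
  have h3 : ∀ i, VineEq ρ ((f.comp p).tree i) ((g.comp q).tree i) := fun i => by
    rw [hp, hq]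
    exact h1 i
  obtain rfl : k = k' := by
    rw [← (f.comp p).leaves, ← (g.comp q).leaves]
    exact Finset.sum_congr rfl fun i _ => (h3 i).numLeaves hρ
  exact ⟨k, p, q, h3⟩

theorem congruence_skeinRel (hρ : IsHomogeneous ρ) : Congruence (skeinRel (vineRel ρ)) where
  comp_left {_ _ _} f _ _ h := ForestEq.comp hρ (ForestEq.refl f) h
  comp_right {_ _ _ _ _} g h := ForestEq.comp hρ h (ForestEq.refl g)
  equivalence := ⟨fun f => ForestEq.refl f, fun h => ForestEq.symm h, fun h h' =>
    ForestEq.trans h h'⟩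

/-- The class of a forest. -/
def fsMk (ρ : FreeMonoid σ → FreeMonoid σ → Prop) (f : Forest σ n m) :
    (⟨⟨n⟩⟩ : MonFS ρ) ⟶ ⟨⟨m⟩⟩ :=
  (Quotient.functor (skeinRel (vineRel ρ))).map (X := ⟨n⟩) (Y := ⟨m⟩) f

theorem fsMk_comp (f : Forest σ n m) (g : Forest σ m k) :
    fsMk ρ f ≫ fsMk ρ g = fsMk ρ (f.comp g) := rfl

theorem exists_fsMk (h : (⟨⟨n⟩⟩ : MonFS ρ) ⟶ ⟨⟨m⟩⟩) : ∃ f : Forest σ n m, h = fsMk ρ f := by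
  obtain ⟨f⟩ := h
  exact ⟨f, rfl⟩

theorem fsMk_eq_iff (hρ : IsHomogeneous ρ) {f g : Forest σ n m} :
    fsMk ρ f = fsMk ρ g ↔ ForestEq ρ f g := by
  have := congruence_skeinRel hρ
  exact Quotient.functor_map_eq_iff (skeinRel (vineRel ρ)) (X := ⟨n⟩) (Y := ⟨m⟩) f g

theorem isOreCategory_monFS (hρ : IsHomogeneous ρ) [IsOreMonoid (PresentedMonoid ρ)] :
    IsOreCategory (MonFS ρ) where
  left_cancel := by
    rintro ⟨⟨n⟩⟩ ⟨⟨m⟩⟩ ⟨⟨k⟩⟩ f g g' h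
    obtain ⟨f, rfl⟩ := exists_fsMk f
    obtain ⟨g, rfl⟩ := exists_fsMk g
    obtain ⟨g', rfl⟩ := exists_fsMk g'
    rw [fsMk_comp, fsMk_comp, fsMk_eq_iff hρ] at h
    exact (fsMk_eq_iff hρ).2 (h.of_comp hρ)
  ore := by
    rintro ⟨⟨n⟩⟩ ⟨⟨m⟩⟩ ⟨⟨m'⟩⟩ f g
    obtain ⟨f, rfl⟩ := exists_fsMk f
    obtain ⟨g, rfl⟩ := exists_fsMk g
    obtain ⟨k, p, q, h⟩ := ForestEq.exists_comp hρ f g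
    exact ⟨⟨⟨k⟩⟩, fsMk ρ p, fsMk ρ q, (fsMk_eq_iff hρ).2 h⟩

/-! ### The braided version -/

/-- A braid permutes the trees of the forests that are pulled through it. -/
theorem exists_perm_pull (b : Braid m) :
    ∃ π : Equiv.Perm ℕ, ∀ (k : ℕ) (f : Forest σ m k) (i : ℕ), (pull b f).tree i = f.tree (π i) := by
  induction b using braid_induction with
  | one => exact ⟨1, fun k f i => by rw [pull_one]; rfl⟩
  | of j =>
    refine ⟨Equiv.swap (j : ℕ) (j + 1), fun k f i => ?_⟩
    rw [pull_of, Equiv.swap_apply_def]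
    simp only [Forest.swap, swapSeq]
    split_ifs <;> rfl
  | inv b ih =>
    obtain ⟨π, h⟩ := ih
    refine ⟨π⁻¹, fun k f i => ?_⟩
    have h1 := h k (pull b⁻¹ f) (π⁻¹ i)
    rw [← pull_mul, mul_inv_cancel, pull_one] at h1
    rw [h1, ← Equiv.Perm.mul_apply, mul_inv_cancel, Equiv.Perm.one_apply]
  | mul b c hb hc =>
    obtain ⟨π, h⟩ := hb
    obtain ⟨π', h'⟩ := hc
    exact ⟨π' * π, fun k f i => by rw [pull_mul, h, h', Equiv.Perm.mul_apply]⟩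

theorem ForestEq.pull {f g : Forest σ m k} (h : ForestEq ρ f g) (b : Braid m) :
    ForestEq ρ (pull b f) (pull b g) := by
  obtain ⟨π, hπ⟩ := exists_perm_pull (σ := σ) b
  intro i
  rw [hπ, hπ]
  exact h _

theorem ForestEq.of_pull {f g : Forest σ m k} {b : Braid m}
    (h : ForestEq ρ (ForestSkein.pull b f) (ForestSkein.pull b g)) : ForestEq ρ f g := by
  have h1 := h.pull b⁻¹
  rwa [← pull_mul, ← pull_mul, inv_mul_cancel, pull_one, pull_one] at h1

/-- Homogeneous skein relations preserve leaf numbers, and cabling depends on nothing else. This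
dependence is explicit after passing to infinite braids. -/
theorem ForestEq.cable (hρ : IsHomogeneous ρ) {f g : Forest σ m k} (h : ForestEq ρ f g)
    (b : Braid m) : cable b f = cable b g := by
  apply toInf_injective
  rw [← (toInf_cable b f).2, ← (toInf_cable b g).2, h.leafMult hρ]

theorem congruence_skeinRelBV (hρ : IsHomogeneous ρ) : Congruence (skeinRelBV (vineRel ρ)) where
  comp_left {_ _ _} x y y' h := by
    obtain ⟨h1, h2⟩ := h
    refine ⟨ForestEq.comp hρ (ForestEq.refl x.1) (ForestEq.pull h1 x.2), ?_⟩
    exact congrArg₂ (· * ·) (ForestEq.cable hρ h1 x.2) h2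
  comp_right {_ _ _ x x'} y h := by
    obtain ⟨h1, h2⟩ := h
    obtain ⟨f, b⟩ := x
    obtain ⟨f', b'⟩ := x'
    obtain rfl : b = b' := h2
    exact ⟨ForestEq.comp hρ h1 (ForestEq.refl _), rfl⟩
  equivalence := ⟨fun x => ⟨ForestEq.refl _, rfl⟩, fun h => ⟨ForestEq.symm h.1, h.2.symm⟩,
    fun h h' => ⟨ForestEq.trans h.1 h'.1, h.2.trans h'.2⟩⟩

/-- The class of a braided forest. -/
def bvMk (ρ : FreeMonoid σ → FreeMonoid σ → Prop) (f : Forest σ n m) (b : Braid m) :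
    (⟨⟨n⟩⟩ : MonBVFS ρ) ⟶ ⟨⟨m⟩⟩ :=
  (Quotient.functor (skeinRelBV (vineRel ρ))).map (X := ⟨n⟩) (Y := ⟨m⟩) (f, b)

theorem bvMk_comp (f : Forest σ n m) (b : Braid m) (g : Forest σ m k) (c : Braid k) :
    bvMk ρ f b ≫ bvMk ρ g c = bvMk ρ (f.comp (pull b g)) (cable b g * c) := rfl

theorem exists_bvMk (h : (⟨⟨n⟩⟩ : MonBVFS ρ) ⟶ ⟨⟨m⟩⟩) :
    ∃ (f : Forest σ n m) (b : Braid m), h = bvMk ρ f b := by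
  obtain ⟨f, b⟩ := h
  exact ⟨f, b, rfl⟩

theorem bvMk_eq_iff (hρ : IsHomogeneous ρ) {f g : Forest σ n m} {b c : Braid m} :
    bvMk ρ f b = bvMk ρ g c ↔ ForestEq ρ f g ∧ b = c := by
  have := congruence_skeinRelBV hρ
  exact Quotient.functor_map_eq_iff (skeinRelBV (vineRel ρ)) (X := ⟨n⟩) (Y := ⟨m⟩) (f, b) (g, c)

theorem isOreCategory_monBVFS (hρ : IsHomogeneous ρ) [IsOreMonoid (PresentedMonoid ρ)] :
    IsOreCategory (MonBVFS ρ) where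
  left_cancel := by
    rintro ⟨⟨n⟩⟩ ⟨⟨m⟩⟩ ⟨⟨k⟩⟩ f g g' h
    obtain ⟨f, b, rfl⟩ := exists_bvMk f
    obtain ⟨g, c, rfl⟩ := exists_bvMk g
    obtain ⟨g', c', rfl⟩ := exists_bvMk g'
    rw [bvMk_comp, bvMk_comp, bvMk_eq_iff hρ] at h
    have h1 := (h.1.of_comp hρ).of_pull
    refine (bvMk_eq_iff hρ).2 ⟨h1, ?_⟩
    have h2 := h.2
    rw [h1.cable hρ b] at h2
    exact mul_left_cancel h2
  ore := by
    rintro ⟨⟨n⟩⟩ ⟨⟨m⟩⟩ ⟨⟨m'⟩⟩ f g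
    obtain ⟨f, b, rfl⟩ := exists_bvMk f
    obtain ⟨g, c, rfl⟩ := exists_bvMk g
    obtain ⟨k, p, q, h⟩ := ForestEq.exists_comp hρ f g
    -- The forests are chosen to become `p` and `q` when pulled through `b` and `c`, and the braids
    -- on top undo the cablings. Both composites are then forests with the trivial braid.
    refine ⟨⟨⟨k⟩⟩, bvMk ρ (pull b⁻¹ p) (cable b (pull b⁻¹ p))⁻¹,
      bvMk ρ (pull c⁻¹ q) (cable c (pull c⁻¹ q))⁻¹, ?_⟩
    simp only [bvMk_comp, ← pull_mul, mul_inv_cancel, pull_one]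
    exact (bvMk_eq_iff hρ).2 ⟨h, rfl⟩

end Categories

/-! ## Ordering the forest-skein groups -/

section Codes

variable {M : Type u} [Monoid M]

/-- The first nontrivial quotient of two sequences in a monoid is positive. -/
def CodePos [LinearOrder (Frac M)] (u v : ℕ → M) : Prop :=
  ∃ x, (∀ y < x, frac (u y) (v y) = 1) ∧ 1 < frac (u x) (v x)

variable [IsOreMonoid M] [LinearOrder (Frac M)]

theorem CodePos.trans (hG : ∀ g h k : Frac M, h ≤ k → g * h ≤ g * k) {a b c : ℕ → M}
    (h : CodePos a b) (h' : CodePos b c) : CodePos a c := by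
  obtain ⟨x, h1, h2⟩ := h
  obtain ⟨x', h3, h4⟩ := h'
  rcases lt_trichotomy x x' with hx | rfl | hx
  · refine ⟨x, fun y hy => ?_, ?_⟩
    · rw [← frac_mul_frac _ (b y), h1 y hy, h3 y (hy.trans hx), one_mul]
    · rwa [← frac_mul_frac _ (b x), h3 x hx, mul_one]
  · refine ⟨x, fun y hy => ?_, ?_⟩
    · rw [← frac_mul_frac _ (b y), h1 y hy, h3 y hy, one_mul]
    · rw [← frac_mul_frac _ (b x)]
      have h5 := hG (frac (a x) (b x)) _ _ h4.le
      rw [mul_one] at h5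
      exact h2.trans_le h5
  · refine ⟨x', fun y hy => ?_, ?_⟩
    · rw [← frac_mul_frac _ (b y), h1 y (hy.trans hx), h3 y hy, one_mul]
    · rwa [← frac_mul_frac _ (b x'), h1 x' hx, one_mul]

theorem not_codePos_self (a : ℕ → M) : ¬ CodePos a a := by
  rintro ⟨x, -, h⟩
  rw [frac_self] at h
  exact lt_irrefl _ h

theorem codePos_total (hG : ∀ g h k : Frac M, h ≤ k → g * h ≤ g * k) (a b : ℕ → M) :
    CodePos a b ∨ CodePos b a ∨ ∀ x, frac (a x) (b x) = 1 := by
  classical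
  by_cases h : ∃ x, frac (a x) (b x) ≠ 1
  · have h1 : ∀ y < Nat.find h, frac (a y) (b y) = 1 := fun y hy => not_not.1 (Nat.find_min h hy)
    rcases lt_or_gt_of_ne (Nat.find_spec h) with h2 | h2
    · refine Or.inr (Or.inl ⟨Nat.find h, fun y hy => ?_, ?_⟩)
      · rw [← frac_inv, h1 y hy, inv_one]
      · rw [← frac_inv]
        exact one_lt_inv_of_lt_one hG h2
    · exact Or.inl ⟨Nat.find h, h1, h2⟩
  · exact Or.inr (Or.inr fun x => not_not.1 fun hx => h ⟨x, hx⟩)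

end Codes

/-! ### Comparison of leaf codes under grafting and change of base tree -/

section TreeOrder

variable {σ : Type u} {ρ : FreeMonoid σ → FreeMonoid σ → Prop}
  [IsOreMonoid (PresentedMonoid ρ)] [LinearOrder (Frac (PresentedMonoid ρ))]

/-- The two codes of an old leaf are multiplied on the right by the same element, and a new leaf has
the same code on both sides. The first nontrivial quotient only moves from position `x` to `offset f
x`. -/
theorem CodePos.graft {t s : BinaryTree σ} (hts : t.numLeaves = s.numLeaves)
    (f : ℕ → BinaryTree σ) (h : CodePos (monCode ρ t) (monCode ρ s)) :
    CodePos (monCode ρ (graft t f)) (monCode ρ (graft s f)) := by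
  obtain ⟨x, h1, h2⟩ := h
  have hx : x < t.numLeaves := by
    by_contra hx
    rw [monCode_of_le t (by omega), monCode_of_le s (by omega), frac_self] at h2
    exact lt_irrefl _ h2
  have e : ∀ j < t.numLeaves, ∀ i < (f j).numLeaves,
      frac (monCode ρ (ForestSkein.graft t f) (offset f j + i))
        (monCode ρ (ForestSkein.graft s f) (offset f j + i)) =
      if i = 0 then frac (monCode ρ t j) (monCode ρ s j) else 1 := by
    intro j hj i hi
    rw [monCode_graft t f hj hi, monCode_graft s f (hts ▸ hj) hi, frac_mul_right]
    split_ifs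
    · rfl
    · exact frac_self _
  refine ⟨offset f x, fun y hy => ?_, ?_⟩
  · obtain ⟨j, i, hi, rfl⟩ := exists_offset f y
    have hj : j < x := by
      by_contra hj
      have := offset_mono f (not_lt.1 hj)
      omega
    rw [e j (by omega) i hi]
    split_ifs
    · exact h1 j hj
    · rfl
  · have := e x hx 0 (f x).numLeaves_pos
    rw [add_zero, if_pos rfl] at this
    rwa [this]

/-- Before the first nontrivial quotient the code lengths agree, so `q` and `p` have the same tree
boundaries up to it. A quotient there has the form `[au, av] = [a, 1][u, v][a, 1]⁻¹`, where `a` is a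
code of `s` or `1`. Replacing `s` by `t` conjugates it by `[b, 1][a, 1]⁻¹`. -/
theorem CodePos.conj (hρ : IsHomogeneous ρ)
    (hG : ∀ g h k : Frac (PresentedMonoid ρ), h ≤ k → g * h ≤ g * k ∧ h * g ≤ k * g)
    {t s : BinaryTree σ} (hts : t.numLeaves = s.numLeaves) {q p : ℕ → BinaryTree σ}
    (hqp : offset q s.numLeaves = offset p s.numLeaves)
    (h : CodePos (monCode ρ (ForestSkein.graft s q)) (monCode ρ (ForestSkein.graft s p))) :
    CodePos (monCode ρ (ForestSkein.graft t q)) (monCode ρ (ForestSkein.graft t p)) := by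
  obtain ⟨x, h1, h2⟩ := h
  have hx : x < offset q s.numLeaves := by
    by_contra hx
    rw [monCode_of_le _ (by rw [numLeaves_graft_eq_offset]; omega),
      monCode_of_le _ (by rw [numLeaves_graft_eq_offset]; omega), frac_self] at h2
    exact lt_irrefl _ h2
  have hlt : ∀ {j}, offset q j ≤ x → j < s.numLeaves := fun {j} hj => by
    by_contra hj'
    have := offset_mono q (not_lt.1 hj')
    omega
  have elen : ∀ j, offset q j ≤ x → offset q j = offset p j → ∀ y, y < (q j).numLeaves →
      y < (p j).numLeaves → offset q j + y < x →
      monLength hρ (monCode ρ (q j) y) = monLength hρ (monCode ρ (p j) y) := by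
    intro j hj hoff y hy hy' hyx
    -- A trivial fraction only gives equality after right multiplication by some `z`, which is
    -- enough to compare lengths.
    have h3 := h1 _ hyx
    have hj := hlt hj
    rw [monCode_graft s q hj hy, hoff, monCode_graft s p hj hy'] at h3
    obtain ⟨z, hz⟩ := exists_of_frac_eq_one h3
    have h4 := congrArg (monLength hρ) hz
    simp only [monLength_mul] at h4
    omega
  have hoff : ∀ j, offset q j ≤ x → offset q j = offset p j := by
    intro j
    induction j with
    | zero => intro _; rfl
    | succ j ih =>
      intro hj
      have h3 := offset_mono q (show j ≤ j + 1 by omega)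
      have h4 := ih (by omega)
      rw [offset_succ] at hj
      rw [offset_succ, offset_succ, h4, numLeaves_eq_of_len (monLength hρ) (monLength_one hρ)
        (monLength_of_mul hρ) fun y hy hy' => elen j (by omega) h4 y hy hy' (by omega)]
  have key : ∀ y ≤ x, ∃ g : Frac (PresentedMonoid ρ),
      frac (monCode ρ (ForestSkein.graft t q) y) (monCode ρ (ForestSkein.graft t p) y) =
        g * frac (monCode ρ (ForestSkein.graft s q) y) (monCode ρ (ForestSkein.graft s p) y) *
          g⁻¹ := by
    intro y hy
    obtain ⟨j, i, hi, rfl⟩ := exists_offset q y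
    have hj : offset q j ≤ x := by omega
    have hi' : i < (p j).numLeaves := by
      by_contra hi'
      have h3 := numLeaves_eq_of_len (monLength hρ) (monLength_one hρ) (monLength_of_mul hρ)
        fun y hy hy' => elen j hj (hoff j hj) y hy hy' (by omega)
      omega
    have hjs := hlt hj
    have hjt : j < t.numLeaves := hts ▸ hjs
    have e1 := monCode_graft (ρ := ρ) t q hjt hi
    have e2 := monCode_graft (ρ := ρ) s q hjs hi
    have e3 := monCode_graft (ρ := ρ) t p hjt hi'
    have e4 := monCode_graft (ρ := ρ) s p hjs hi'
    rw [← hoff j hj] at e3 e4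
    rw [e1, e2, e3, e4]
    generalize (if i = 0 then monCode ρ t j else 1) = b
    generalize (if i = 0 then monCode ρ s j else 1) = a
    refine ⟨frac b 1 * (frac a 1)⁻¹, ?_⟩
    rw [frac_mul_left b, frac_mul_left a]
    group
  refine ⟨x, fun y hy => ?_, ?_⟩
  · obtain ⟨g, hg⟩ := key y hy.le
    rw [hg, h1 y hy, mul_one, mul_inv_cancel]
  · obtain ⟨g, hg⟩ := key x le_rfl
    rw [hg]
    exact one_lt_conj hG g h2

end TreeOrder

/-! ### The positive cones of the two forest-skein groups -/

section Groups

variable {σ : Type u} {ρ : FreeMonoid σ → FreeMonoid σ → Prop} {m k : ℕ}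

theorem Forest.numLeaves_tree_zero (f : Forest σ 1 m) : (f.tree 0).numLeaves = m := by
  have h := f.leaves
  rwa [offset_succ, offset_zero, zero_add] at h

theorem Forest.comp_tree_zero (f : Forest σ 1 m) (g : Forest σ m k) :
    (f.comp g).tree 0 = graft (f.tree 0) g.tree := by
  simp only [Forest.comp, stack, offset_zero, zero_add]

theorem forestEq_of_tree_zero {f g : Forest σ 1 m} (h : VineEq ρ (f.tree 0) (g.tree 0)) :
    ForestEq ρ f g := by
  intro i
  match i with
  | 0 => exact h
  | i + 1 =>
    rw [f.padding _ (by omega), g.padding _ (by omega)]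
    exact .refl _

/-- The leaf code of a forest with one root. -/
abbrev treeCode (ρ : FreeMonoid σ → FreeMonoid σ → Prop) (f : Forest σ 1 m) :
    ℕ → PresentedMonoid ρ := monCode ρ (f.tree 0)

theorem ForestEq.treeCode (hρ : IsHomogeneous ρ) {f g : Forest σ 1 m} (h : ForestEq ρ f g) :
    treeCode ρ f = treeCode ρ g := funext fun x => (h 0).monCode hρ x

/-- A trivial quotient at leaf `x` means that the codes agree after right multiplication by some `z
x`. Growing at each leaf a left-vine that spells this element makes all codes equal. -/
theorem exists_comp_forestEq [IsOreMonoid (PresentedMonoid ρ)] (hρ : IsHomogeneous ρ) {f g : Forest σ 1 m}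
    (h : ∀ x, frac (treeCode ρ f x) (treeCode ρ g x) = 1) :
    ∃ (k : ℕ) (p : Forest σ m k), ForestEq ρ (f.comp p) (g.comp p) := by
  choose z hz using fun x => exists_of_frac_eq_one (h x)
  choose w hw using fun x => PresentedMonoid.surjective_mk (z x)
  obtain ⟨p, hp⟩ : ∃ p : ℕ → BinaryTree σ, ∀ i, p i = if i < m then leftVine (w i).toList else .nil :=
    ⟨_, fun _ => rfl⟩
  refine ⟨_, ⟨p, fun i hi => by rw [hp, if_neg (by omega)], rfl⟩,
    forestEq_of_tree_zero (vineEq_of_monCode hρ ?_)⟩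
  intro x hx hx'
  rw [Forest.comp_tree_zero, numLeaves_graft_eq_offset, f.numLeaves_tree_zero] at hx
  rw [Forest.comp_tree_zero, Forest.comp_tree_zero]
  change x < offset p m at hx
  change monCode ρ (graft (f.tree 0) p) x = monCode ρ (graft (g.tree 0) p) x
  obtain ⟨j, i, hi, rfl⟩ := exists_offset p x
  have hj : j < m := by
    by_contra hj
    have := offset_mono p (not_lt.1 hj)
    omega
  rw [monCode_graft _ p (by rwa [f.numLeaves_tree_zero]) hi,
    monCode_graft _ p (by rwa [g.numLeaves_tree_zero]) hi]
  split_ifs with h0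
  · subst h0
    have hpj : p j = leftVine (w j).toList := by rw [hp, if_pos hj]
    rw [hpj, monCode_leftVine_zero, FreeMonoid.ofList_toList, hw]
    exact hz j
  · rfl

/-- Under a common expansion the quotient of two braids is replaced by a cabling of itself. -/
theorem cable_mul_inv_cable (b c : Braid m) (f : Forest σ m k) :
    cable b f * (cable c f)⁻¹ = cable (b * c⁻¹) (pull c f) := by
  have h := cable_mul (b * c⁻¹) c f
  rw [inv_mul_cancel_right] at h
  rw [h, mul_inv_cancel_right]

variable [LinearOrder (Frac (PresentedMonoid ρ))]

/-- The positive pairs of morphisms of the forest-skein category. -/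
def FSPos {y : MonFS ρ} (f g : (⟨⟨1⟩⟩ : MonFS ρ) ⟶ y) : Prop :=
  ∃ F G : Forest σ 1 y.as.card, f = fsMk ρ F ∧ g = fsMk ρ G ∧
    CodePos (treeCode ρ F) (treeCode ρ G)

theorem fsPos_fsMk (hρ : IsHomogeneous ρ) {F G : Forest σ 1 m} :
    FSPos (fsMk ρ F) (fsMk ρ G) ↔ CodePos (treeCode ρ F) (treeCode ρ G) := by
  refine ⟨?_, fun h => ⟨F, G, rfl, rfl, h⟩⟩
  rintro ⟨F', G', hF, hG, h⟩
  rwa [((fsMk_eq_iff hρ).1 hF).treeCode hρ, ((fsMk_eq_iff hρ).1 hG).treeCode hρ]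

/-- The positive pairs of morphisms of the braided forest-skein category. -/
def BVPos {y : MonBVFS ρ} (f g : (⟨⟨1⟩⟩ : MonBVFS ρ) ⟶ y) : Prop :=
  ∃ (F G : Forest σ 1 y.as.card) (b c : Braid y.as.card), f = bvMk ρ F b ∧ g = bvMk ρ G c ∧
    (BraidInf.Pos (toInf y.as.card (b * c⁻¹)) ∨ b = c ∧ CodePos (treeCode ρ F) (treeCode ρ G))

theorem bvPos_bvMk (hρ : IsHomogeneous ρ) {F G : Forest σ 1 m} {b c : Braid m} :
    BVPos (bvMk ρ F b) (bvMk ρ G c) ↔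
      (BraidInf.Pos (toInf m (b * c⁻¹)) ∨ b = c ∧ CodePos (treeCode ρ F) (treeCode ρ G)) := by
  refine ⟨?_, fun h => ⟨F, G, b, c, rfl, rfl, h⟩⟩
  rintro ⟨F', G', b', c', hF, hG, h⟩
  obtain ⟨h1, rfl⟩ := (bvMk_eq_iff hρ).1 hF
  obtain ⟨h2, rfl⟩ := (bvMk_eq_iff hρ).1 hG
  rwa [h1.treeCode hρ, h2.treeCode hρ]

variable [IsOreMonoid (PresentedMonoid ρ)]

theorem codePos_comp {F G : Forest σ 1 m} (h : CodePos (treeCode ρ F) (treeCode ρ G))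
    (p : Forest σ m k) : CodePos (treeCode ρ (F.comp p)) (treeCode ρ (G.comp p)) := by
  rw [treeCode, treeCode, Forest.comp_tree_zero, Forest.comp_tree_zero]
  exact h.graft (F.numLeaves_tree_zero.trans G.numLeaves_tree_zero.symm) p.tree

theorem isPositivity_fsPos (hρ : IsHomogeneous ρ)
    (hG : ∀ g h k : Frac (PresentedMonoid ρ), h ≤ k → g * h ≤ g * k) :
    FracGroup.IsPositivity (C := MonFS ρ) (x := ⟨⟨1⟩⟩) FSPos where
  comp := by
    rintro ⟨⟨m⟩⟩ ⟨⟨k⟩⟩ f g p h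
    obtain ⟨F, rfl⟩ := exists_fsMk f
    obtain ⟨G, rfl⟩ := exists_fsMk g
    obtain ⟨p, rfl⟩ := exists_fsMk p
    rw [fsMk_comp, fsMk_comp, fsPos_fsMk hρ]
    exact codePos_comp ((fsPos_fsMk hρ).1 h) p
  trans := by
    rintro ⟨⟨m⟩⟩ f g e h h'
    obtain ⟨F, rfl⟩ := exists_fsMk f
    obtain ⟨G, rfl⟩ := exists_fsMk g
    obtain ⟨E, rfl⟩ := exists_fsMk e
    rw [fsPos_fsMk hρ] at *
    exact h.trans hG h'
  irrefl := by
    rintro ⟨⟨m⟩⟩ f h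
    obtain ⟨F, rfl⟩ := exists_fsMk f
    exact not_codePos_self _ ((fsPos_fsMk hρ).1 h)
  total := by
    rintro ⟨⟨m⟩⟩ f g
    obtain ⟨F, rfl⟩ := exists_fsMk f
    obtain ⟨G, rfl⟩ := exists_fsMk g
    rw [fsPos_fsMk hρ, fsPos_fsMk hρ]
    refine (codePos_total hG _ _).imp id (Or.imp id fun h => ?_)
    obtain ⟨k, p, hp⟩ := exists_comp_forestEq hρ h
    exact ⟨⟨⟨k⟩⟩, fsMk ρ p, (fsMk_eq_iff hρ).2 hp⟩

theorem fsPos_conj (hρ : IsHomogeneous ρ)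
    (hG : ∀ g h k : Frac (PresentedMonoid ρ), h ≤ k → g * h ≤ g * k ∧ h * g ≤ k * g)
    {y z : MonFS ρ} (s t : (⟨⟨1⟩⟩ : MonFS ρ) ⟶ y) (p q : y ⟶ z)
    (h : FSPos (s ≫ q) (s ≫ p)) : FSPos (t ≫ q) (t ≫ p) := by
  obtain ⟨⟨m⟩⟩ := y
  obtain ⟨⟨k⟩⟩ := z
  obtain ⟨s, rfl⟩ := exists_fsMk s
  obtain ⟨t, rfl⟩ := exists_fsMk t
  obtain ⟨p, rfl⟩ := exists_fsMk p
  obtain ⟨q, rfl⟩ := exists_fsMk q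
  rw [fsMk_comp, fsMk_comp, fsPos_fsMk hρ, treeCode, treeCode, Forest.comp_tree_zero,
    Forest.comp_tree_zero] at *
  refine h.conj hρ hG (t.numLeaves_tree_zero.trans s.numLeaves_tree_zero.symm) ?_
  rw [s.numLeaves_tree_zero, q.leaves, p.leaves]

/-- The braid quotient dominates, and cabling keeps it positive. If the braids are equal, both trees
are expanded by the same pulled forest and the braids stay equal. -/
theorem isPositivity_bvPos (hρ : IsHomogeneous ρ)
    (hG : ∀ g h k : Frac (PresentedMonoid ρ), h ≤ k → g * h ≤ g * k) :
    FracGroup.IsPositivity (C := MonBVFS ρ) (x := ⟨⟨1⟩⟩) BVPos where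
  comp := by
    rintro ⟨⟨m⟩⟩ ⟨⟨k⟩⟩ f g p h
    obtain ⟨F, b, rfl⟩ := exists_bvMk f
    obtain ⟨G, c, rfl⟩ := exists_bvMk g
    obtain ⟨p, d, rfl⟩ := exists_bvMk p
    rw [bvMk_comp, bvMk_comp, bvPos_bvMk hρ]
    rcases (bvPos_bvMk hρ).1 h with h1 | ⟨rfl, h1⟩
    · left
      rw [mul_inv_rev, mul_assoc, mul_inv_cancel_left, cable_mul_inv_cable]
      exact pos_toInf_cable h1 _
    · exact Or.inr ⟨rfl, codePos_comp h1 _⟩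
  trans := by
    rintro ⟨⟨m⟩⟩ f g e h h'
    obtain ⟨F, b, rfl⟩ := exists_bvMk f
    obtain ⟨G, c, rfl⟩ := exists_bvMk g
    obtain ⟨E, d, rfl⟩ := exists_bvMk e
    rw [bvPos_bvMk hρ] at *
    rcases h with h | ⟨rfl, h⟩
    · rcases h' with h' | ⟨rfl, h'⟩
      · left
        have h1 := h.mul h'
        rwa [← map_mul, mul_assoc, inv_mul_cancel_left] at h1
      · exact Or.inl h
    · rcases h' with h' | ⟨rfl, h'⟩
      · exact Or.inl h'
      · exact Or.inr ⟨rfl, h.trans hG h'⟩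
  irrefl := by
    rintro ⟨⟨m⟩⟩ f h
    obtain ⟨F, b, rfl⟩ := exists_bvMk f
    rcases (bvPos_bvMk hρ).1 h with h | ⟨-, h⟩
    · rw [mul_inv_cancel, map_one] at h
      exact BraidInf.not_pos_one h
    · exact not_codePos_self _ h
  total := by
    rintro ⟨⟨m⟩⟩ f g
    obtain ⟨F, b, rfl⟩ := exists_bvMk f
    obtain ⟨G, c, rfl⟩ := exists_bvMk g
    rw [bvPos_bvMk hρ, bvPos_bvMk hρ]
    rcases BraidInf.pos_or_eq_one_or_pos_inv (toInf m (b * c⁻¹)) with h | h | h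
    · exact Or.inl (Or.inl h)
    · obtain rfl : b = c := by
        rw [← mul_inv_eq_one]
        exact toInf_injective m (h.trans (map_one _).symm)
      rcases codePos_total hG (treeCode ρ F) (treeCode ρ G) with h1 | h1 | h1
      · exact Or.inl (Or.inr ⟨rfl, h1⟩)
      · exact Or.inr (Or.inl (Or.inr ⟨rfl, h1⟩))
      · obtain ⟨k, p, hp⟩ := exists_comp_forestEq hρ h1
        -- `p` has to arrive below the braid `b`, so it is pulled through `b⁻¹` beforehand.
        refine Or.inr (Or.inr ⟨⟨⟨k⟩⟩, bvMk ρ (pull b⁻¹ p) 1, ?_⟩)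
        rw [bvMk_comp, bvMk_comp, ← pull_mul, mul_inv_cancel, pull_one]
        exact (bvMk_eq_iff hρ).2 ⟨hp, rfl⟩
    · refine Or.inr (Or.inl (Or.inl ?_))
      rwa [← map_inv, mul_inv_rev, inv_inv] at h

end Groups

/-! ## The fraction group of the monoid inside the forest-skein groups -/

section Vines

variable {σ : Type u} (a : σ)

/-- The vine of a given length along the path from the root to the last leaf. -/
def rightVine : ℕ → BinaryTree σ
  | 0 => .nil
  | n + 1 => .node a .nil (rightVine n)

theorem numLeaves_rightVine (n : ℕ) : (rightVine a n).numLeaves = n + 1 := by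
  induction n with
  | zero => rfl
  | succ n ih => simp only [rightVine, BinaryTree.numLeaves, ih]; omega

theorem graft_rightVine (n k : ℕ) :
    graft (rightVine a n) (fun i => if i = n then rightVine a k else .nil) =
      rightVine a (n + k) := by
  induction n with
  | zero => rw [zero_add]; rfl
  | succ n ih =>
    rw [show n + 1 + k = n + k + 1 by omega, rightVine, rightVine, ← ih, graft, graft,
      if_neg (by omega)]
    congr 2
    funext i
    simp [BinaryTree.numLeaves, add_comm]

variable {m : ℕ}

/-- The caret with a left-vine on its left leaf and a right-vine on its right leaf. -/
def vForest (w : List σ) (n m : ℕ) (h : w.length + n + 2 = m) : Forest σ 1 m where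
  tree := single (.node a (leftVine w) (rightVine a n))
  padding i hi := if_neg (by omega)
  leaves := by
    rw [offset_succ, offset_zero, single, if_pos rfl, BinaryTree.numLeaves, numLeaves_leftVine,
      numLeaves_rightVine]
    omega

/-- A left-vine on the first root, a right-vine on the last one. -/
def vineEnds (z : List σ) (k l : ℕ) : Forest σ (l + 2) (l + 2 + z.length + k) where
  tree i := if i = 0 then leftVine z else if i = l + 1 then rightVine a k else .nil
  padding i hi := by rw [if_neg (by omega), if_neg (by omega)]
  leaves := by
    have h : ∀ i < l, BinaryTree.numLeaves (if i + 1 = 0 then leftVine z else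
        if i + 1 = l + 1 then rightVine a k else .nil) = 1 := fun i hi => by
      rw [if_neg (by omega), if_neg (by omega)]
      rfl
    rw [offset, Finset.sum_range_succ, Finset.sum_range_succ',
      Finset.sum_congr rfl fun i hi => h i (Finset.mem_range.1 hi), if_neg (Nat.succ_ne_zero l),
      if_pos rfl, if_pos rfl, numLeaves_leftVine, numLeaves_rightVine]
    simp
    omega

theorem vForest_comp_vineEnds (w z : List σ) (n k l : ℕ) (h : w.length + n + 2 = l + 2) :
    (vForest a w n (l + 2) h).comp (vineEnds a z k l) =
      vForest a (w ++ z) (n + k) (l + 2 + z.length + k) (by rw [List.length_append]; omega) := by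
  refine Forest.ext (funext fun i => ?_)
  match i with
  | 0 =>
    rw [Forest.comp_tree_zero]
    simp only [vForest, vineEnds, single, if_true, graft]
    rw [leftVine_append, ← graft_rightVine]
    congr 1
    · refine graft_congr _ fun i hi => ?_
      rw [numLeaves_leftVine] at hi
      rw [single]
      split_ifs <;> first | rfl | omega
    · refine graft_congr _ fun i hi => ?_
      rw [numLeaves_leftVine]
      split_ifs <;> first | rfl | omega
  | i + 1 =>
    rw [Forest.padding _ _ (by omega), Forest.padding _ _ (by omega)]

end Vines

section Difference

variable {σ : Type u} {ρ : FreeMonoid σ → FreeMonoid σ → Prop} {D : Type v} [Category.{w} D]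

/-- A functor from coloured forests that identifies skein equivalent forests and, up to
expansion, no others. -/
structure IsSkeinMap (ρ : FreeMonoid σ → FreeMonoid σ → Prop) (ob : ℕ → D)
    (J : ∀ {n m : ℕ}, Forest σ n m → (ob n ⟶ ob m)) : Prop where
  map_comp : ∀ {n m k : ℕ} (f : Forest σ n m) (g : Forest σ m k), J f ≫ J g = J (f.comp g)
  map_eq : ∀ {n m : ℕ} {f g : Forest σ n m}, ForestEq ρ f g → J f = J g
  exists_comp : ∀ {m : ℕ} {f g : Forest σ 1 m} {z : D} {r : ob m ⟶ z}, J f ≫ r = J g ≫ r →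
    ∃ (k : ℕ) (p : Forest σ m k), ForestEq ρ (f.comp p) (g.comp p)

variable {ob : ℕ → D} {J : ∀ {n m : ℕ}, Forest σ n m → (ob n ⟶ ob m)} (a : σ)

/-- The fraction of the trees attached to two words. -/
def vineFrac (J : ∀ {n m : ℕ}, Forest σ n m → (ob n ⟶ ob m)) (p q : List σ) :
    FracGroup D (ob 1) :=
  FracGroup.mk (J (vForest a p q.length _ rfl)) (J (vForest a q p.length _ (by omega)))

/-- The two trees have the same number of leaves, so a single forest prolongs both left-vines by `z`
at the first leaf and both right-vines by `k` at the last. -/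
theorem IsSkeinMap.mk_append (hJ : IsSkeinMap ρ ob J) (p q z : List σ) {n n' m k m' : ℕ}
    (h : p.length + n + 2 = m) (h' : q.length + n' + 2 = m)
    (h1 : (p ++ z).length + (n + k) + 2 = m') (h2 : (q ++ z).length + (n' + k) + 2 = m') :
    FracGroup.mk (J (vForest a (p ++ z) (n + k) m' h1)) (J (vForest a (q ++ z) (n' + k) m' h2)) =
      FracGroup.mk (J (vForest a p n m h)) (J (vForest a q n' m h')) := by
  obtain ⟨l, rfl⟩ : ∃ l, m = l + 2 := ⟨m - 2, by omega⟩
  obtain rfl : m' = l + 2 + z.length + k := by rw [List.length_append] at h1; omega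
  rw [← vForest_comp_vineEnds a p z n k l h, ← vForest_comp_vineEnds a q z n' k l h',
    ← hJ.map_comp, ← hJ.map_comp, FracGroup.mk_comp]

/-- Two choices of padding differ by the same amount in both trees, so one pair of trees is a common
expansion of the other. -/
theorem IsSkeinMap.vineFrac_eq (hJ : IsSkeinMap ρ ob J) (p q : List σ) {n n' m : ℕ}
    (h : p.length + n + 2 = m) (h' : q.length + n' + 2 = m) :
    vineFrac a J p q = FracGroup.mk (J (vForest a p n m h)) (J (vForest a q n' m h')) := by
  have key : ∀ {n n' m k j j' l : ℕ} (h : p.length + n + 2 = m) (h' : q.length + n' + 2 = m)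
      (h1 : p.length + j + 2 = l) (h2 : q.length + j' + 2 = l), j = n + k → j' = n' + k →
      FracGroup.mk (J (vForest a p j l h1)) (J (vForest a q j' l h2)) =
        FracGroup.mk (J (vForest a p n m h)) (J (vForest a q n' m h')) := by
    rintro n n' m k _ _ l h h' h1 h2 rfl rfl
    have := hJ.mk_append a p q [] (k := k) (m' := l) h h' (by simpa using h1) (by simpa using h2)
    simpa only [List.append_nil] using this
  rcases le_total n q.length with hn | hn
  · exact key (k := q.length - n) h h' _ _ (by omega) (by omega)
  · exact (key (k := n - q.length) _ _ h h' (by omega) (by omega)).symm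

theorem IsSkeinMap.vineFrac_append (hJ : IsSkeinMap ρ ob J) (p q z : List σ) :
    vineFrac a J (p ++ z) (q ++ z) = vineFrac a J p q := by
  rw [hJ.vineFrac_eq a (p ++ z) (q ++ z) (n := q.length + 0) (n' := p.length + 0) (m := _) rfl
    (by simp only [List.length_append]; omega)]
  exact hJ.mk_append a p q z _ _ _ _

/-- All three words are padded to one common number of leaves, after which the fractions compose
directly. -/
theorem IsSkeinMap.vineFrac_mul [IsOreCategory D] (hJ : IsSkeinMap ρ ob J) (p q z : List σ) :
    vineFrac a J p q * vineFrac a J q z = vineFrac a J p z := by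
  have h1 : p.length + (q.length + z.length) + 2 = p.length + q.length + z.length + 2 := by omega
  have h2 : q.length + (p.length + z.length) + 2 = p.length + q.length + z.length + 2 := by omega
  have h3 : z.length + (p.length + q.length) + 2 = p.length + q.length + z.length + 2 := by omega
  rw [hJ.vineFrac_eq a p q h1 h2, hJ.vineFrac_eq a q z h2 h3, hJ.vineFrac_eq a p z h1 h3,
    FracGroup.mk_mul_mk_self]

theorem vineEq_node {p q : FreeMonoid σ} (h : PresentedMonoid.mk ρ p = PresentedMonoid.mk ρ q)
    (t : BinaryTree σ) :
    VineEq ρ (.node a (leftVine p.toList) t) (.node a (leftVine q.toList) t) := by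
  have e : ∀ s : BinaryTree σ, BinaryTree.node a s t =
      graft (.node a .nil .nil) (fun i => if i = 0 then s else t) := fun s => rfl
  rw [e, e]
  refine .graft (.refl _) fun i => ?_
  split_ifs
  · exact VineEq.leftVine h
  · exact .refl _

theorem IsSkeinMap.vineFrac_congr (hρ : IsHomogeneous ρ) (hJ : IsSkeinMap ρ ob J)
    {p p' q q' : FreeMonoid σ} (h : PresentedMonoid.mk ρ p = PresentedMonoid.mk ρ p')
    (h' : PresentedMonoid.mk ρ q = PresentedMonoid.mk ρ q') :
    vineFrac a J p.toList q.toList = vineFrac a J p'.toList q'.toList := by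
  have hl : ∀ {p p' : FreeMonoid σ}, PresentedMonoid.mk ρ p = PresentedMonoid.mk ρ p' →
      p.toList.length = p'.toList.length := fun {p p'} h => by
    have := congrArg (monLength hρ) h
    rwa [monLength_mk, monLength_mk] at this
  have e := hl h
  have e' := hl h'
  rw [hJ.vineFrac_eq a p'.toList q'.toList (n := q.toList.length) (n' := p.toList.length)
    (m := p.toList.length + q.toList.length + 2) (by omega) (by omega), vineFrac]
  congr 1
  · exact hJ.map_eq (forestEq_of_tree_zero (vineEq_node a h _))
  · exact hJ.map_eq (forestEq_of_tree_zero (vineEq_node a h' _))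

/-- In a common expansion the first leaf codes are `a p z` and `a q z`, where `z` is the first code
of the grafted forest; the root colour `a` cancels on the left. -/
theorem IsSkeinMap.exists_of_vineFrac_eq_one [IsOreCategory D] [IsOreMonoid (PresentedMonoid ρ)]
    (hρ : IsHomogeneous ρ) (hJ : IsSkeinMap ρ ob J) (p q : FreeMonoid σ)
    (h : vineFrac a J p.toList q.toList = 1) :
    ∃ z, PresentedMonoid.mk ρ p * z = PresentedMonoid.mk ρ q * z := by
  obtain ⟨y, r, hr⟩ := FracGroup.exists_of_mk_eq_one h
  obtain ⟨k, f, hf⟩ := hJ.exists_comp hr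
  have h0 := (hf 0).monCode hρ 0
  rw [Forest.comp_tree_zero, Forest.comp_tree_zero, monCode_graft_zero, monCode_graft_zero] at h0
  have e : ∀ (p : FreeMonoid σ) (t : BinaryTree σ), monCode ρ (.node a (leftVine p.toList) t) 0 =
      PresentedMonoid.of ρ a * PresentedMonoid.mk ρ p := fun p t => by
    have := monCode_leftVine_zero (ρ := ρ) p.toList
    rw [FreeMonoid.ofList_toList] at this
    rw [monCode, leafCode, if_pos (BinaryTree.numLeaves_pos _), if_pos rfl, ← this]
  refine ⟨monCode ρ (f.tree 0) 0, IsOreMonoid.left_cancel (PresentedMonoid.of ρ a) _ _ ?_⟩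
  rw [← mul_assoc, ← mul_assoc, ← e p (rightVine a q.toList.length),
    ← e q (rightVine a p.toList.length)]
  exact h0

theorem IsSkeinMap.exists_isDifference [IsOreCategory D] [IsOreMonoid (PresentedMonoid ρ)]
    [Nonempty σ] (hρ : IsHomogeneous ρ) (hJ : IsSkeinMap ρ ob J) :
    ∃ φ : PresentedMonoid ρ → PresentedMonoid ρ → FracGroup D (ob 1), IsDifference φ := by
  obtain ⟨a⟩ := ‹Nonempty σ›
  choose c hc using PresentedMonoid.surjective_mk (rels := ρ)
  refine ⟨fun x y => vineFrac a J (c x).toList (c y).toList,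
    fun x y z => hJ.vineFrac_mul a _ _ _, fun x y z => ?_, fun x y h => ?_⟩
  · rw [← hJ.vineFrac_append a (c x).toList (c y).toList (c z).toList, ← FreeMonoid.toList_mul,
      ← FreeMonoid.toList_mul]
    refine hJ.vineFrac_congr a hρ ?_ ?_ <;> rw [map_mul, hc, hc, hc]
  · have := hJ.exists_of_vineFrac_eq_one a hρ _ _ h
    rwa [hc, hc] at this

theorem isSkeinMap_fsMk (hρ : IsHomogeneous ρ) :
    IsSkeinMap ρ (fun n => (⟨⟨n⟩⟩ : MonFS ρ)) (fun f => fsMk ρ f) where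
  map_comp := fsMk_comp
  map_eq h := (fsMk_eq_iff hρ).2 h
  exists_comp := by
    rintro m f g ⟨⟨k⟩⟩ r h
    obtain ⟨p, rfl⟩ := exists_fsMk r
    exact ⟨k, p, (fsMk_eq_iff hρ).1 h⟩

theorem isSkeinMap_bvMk (hρ : IsHomogeneous ρ) :
    IsSkeinMap ρ (fun n => (⟨⟨n⟩⟩ : MonBVFS ρ)) (fun f => bvMk ρ f 1) where
  map_comp f g := by rw [bvMk_comp, pull_one, cable_one, one_mul]
  map_eq h := (bvMk_eq_iff hρ).2 ⟨h, rfl⟩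
  exists_comp := by
    rintro m f g ⟨⟨k⟩⟩ r h
    obtain ⟨p, b, rfl⟩ := exists_bvMk r
    rw [bvMk_comp, bvMk_comp, pull_one, bvMk_eq_iff hρ] at h
    exact ⟨k, p, h.1⟩

end Difference

end ForestSkein

theorem mainTheorem7 {σ : Type*} [Nonempty σ] (ρ : FreeMonoid σ → FreeMonoid σ → Prop)
    (hρ : ForestSkein.IsHomogeneous ρ) [ForestSkein.IsOreMonoid (PresentedMonoid ρ)] :
    ∃ (_ : ForestSkein.IsOreCategory (ForestSkein.MonFS ρ))
      (_ : ForestSkein.IsOreCategory (ForestSkein.MonBVFS ρ)),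
      (ForestSkein.LeftOrderable (ForestSkein.FSGroup ρ) ↔
        ForestSkein.LeftOrderable (ForestSkein.Frac (PresentedMonoid ρ))) ∧
      (ForestSkein.BiOrderable (ForestSkein.FSGroup ρ) ↔
        ForestSkein.BiOrderable (ForestSkein.Frac (PresentedMonoid ρ))) ∧
      (ForestSkein.LeftOrderable (ForestSkein.BVFSGroup ρ) ↔
        ForestSkein.LeftOrderable (ForestSkein.Frac (PresentedMonoid ρ))) := by
  have h1 := ForestSkein.isOreCategory_monFS hρ
  have h2 := ForestSkein.isOreCategory_monBVFS hρ
  -- The maps `φ` and `ψ` restrict orders to `Frac(M)`; the backward implications use the cones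
  -- built from leaf codes and braids.
  obtain ⟨φ, hφ⟩ := (ForestSkein.isSkeinMap_fsMk hρ).exists_isDifference hρ
  obtain ⟨ψ, hψ⟩ := (ForestSkein.isSkeinMap_bvMk hρ).exists_isDifference hρ
  refine ⟨h1, h2, ⟨hφ.leftOrderable, ?_⟩, ⟨hφ.biOrderable, ?_⟩, ⟨hψ.leftOrderable, ?_⟩⟩
  · rintro ⟨_, hG⟩
    exact (ForestSkein.isPositivity_fsPos hρ hG).leftOrderable
  · rintro ⟨_, hG⟩
    exact (ForestSkein.isPositivity_fsPos hρ fun g h k hk => (hG g h k hk).1).biOrderable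
      (ForestSkein.fsPos_conj hρ hG)
  · rintro ⟨_, hG⟩
    exact (ForestSkein.isPositivity_bvPos hρ hG).leftOrderable
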